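/- For $t\in\mathbf R$ put $\langle t\rangle=(1+t^2)^{1/2}$. For open $U\subseteq\mathbf R^{d_1}$, $V\subseteq\mathbf R^{d_2}$ and $1\le p,q<\infty$, the Bochner–Sobolev space $W_{m,p}^{n,q}(U,V)$ consists of the real functions $f(x,y)$ on $U\times V$ whose weak derivatives $\partial_x^\alpha\partial_y^\beta f$, $|\alpha|\le m$, $|\beta|\le n$, all exist and belong to $L^p(U;L^q(V))$, with norm $$\|f\|_{W_{m,p}^{n,q}(U,V)}=\Big(\sum_{|\alpha|\le m}\int_U\Big(\sum_{|\beta|\le n}\int_V|\partial_x^\alpha\partial_y^\beta f(x,y)|^q\,dy\Big)^{p/q}dx\Big)^{1/p}.$$ For a measurable weight $\vartheta:\mathbf R^2\to(0,\infty)$, the space $W_{k_1,\infty}^{k_2,\infty}(\vartheta;\mathbf R,\mathbf R)$ consists of the functions $\sigma:\mathbf R^2\to\mathbf R$ with weak derivatives satisfying $\vartheta\,\partial_1^i\partial_2^j\sigma\in L^\infty(\mathbf R^2)$ for all $i\le k_1$, $j\le k_2$. Let $d_1,d_2\ge 1$ and $n_1,n_2\ge 0$ be integers, $k_i\ge n_i$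 and $m_i=n_i+\lfloor d_i/2\rfloor+2$ for $i=1,2$. Let $\vartheta:\mathbf R^2\to(0,\infty)$ be a measurable weight such that, for some $\gamma_1,\gamma_2>1$ and $c>0$, $\langle t_1\rangle^{\gamma_1}\langle t_2\rangle^{\gamma_2}\le c\,\vartheta(t_1,t_2)$ for all $t_1,t_2\in\mathbf R$, and let $\sigma\in W_{k_1,\infty}^{k_2,\infty}(\vartheta;\mathbf R,\mathbf R)$ be an activation function that is not almost everywhere zero. For bounded open sets $U\subset\mathbf R^{d_1}$, $V\subset\mathbf R^{d_2}$ let $\mathbb D_\sigma$ be the dictionary of those functions $$(x,y)\mapsto\sigma(\xi_1\cdot x+b_1,\ \xi_2\cdot y+b_2),\qquad \xi_i\in\mathbf R^{d_i},\ b_i\in\mathbf R,$$ that belong to $W_{n_1,2}^{n_2,2}(U,V)$, and for $N\in\mathbf N$, $M>0$ let $$\Sigma_{N,M}(\mathbb D_\sigma)=\Big\{\sum_{j=1}^N a_jh_j:\ h_j\in\mathbb D_\sigma,\ a_j\in\mathbf R,\ \sum_{j=1}^N|a_j|\le M\Big\}$$ be the corresponding two-block shallow networks of width $N$. Then for all $r_1,r_2\in\mathbf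 R$ there is a constant $C>0$, depending only on $d_i,n_i,k_i,\gamma_i,\vartheta,\sigma,r_1,r_2$, such that for all open $U\subseteq\{|x|\le r_1\}\subset\mathbf R^{d_1}$ and $V\subseteq\{|y|\le r_2\}\subset\mathbf R^{d_2}$, all real $f\in W_{m_1,2}^{m_2,2}(\mathbf R^{d_1},\mathbf R^{d_2})$, and all sufficiently large $M$ (that is, all $M\ge M_0$ for some $M_0>0$ not depending on $N$), $$\inf_{f_N\in\Sigma_{N,M}(\mathbb D_\sigma)}\|f-f_N\|_{W_{n_1,2}^{n_2,2}(U,V)}\ \le\ C\,N^{-1/2}\,|U|^{1/2}\,|V|^{1/2}\,\|f\|_{W_{m_1,2}^{m_2,2}(\mathbf R^{d_1},\mathbf R^{d_2})}\qquad\text{for all integers }N\ge1.$$ -/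

import Mathlib

open MeasureTheory
open scoped ContDiff ENNReal

noncomputable section

namespace TwoBlock

/-- The multi-indices `α ∈ ℕ^d` with `|α| = α₁ + ⋯ + α_d ≤ n`. -/
def multiIndices (d n : ℕ) : Finset (Fin d → ℕ) :=
  (Fintype.piFinset fun _ => Finset.range (n + 1)).filter fun α => ∑ i, α i ≤ n

/-- The derivative of `φ` in the direction `v`. -/
def dirDeriv {E : Type*} [NormedAddCommGroup E] [NormedSpace ℝ E]
    (v : E) (φ : E → ℝ) : E → ℝ :=
  fun z => fderiv ℝ φ z v

/-- `∂^α φ = ∂_{e₁}^{α₁} ⋯ ∂_{e_d}^{α_d} φ` for the directions `e₁, …, e_d`. -/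
def iterDeriv {E : Type*} [NormedAddCommGroup E] [NormedSpace ℝ E] {d : ℕ}
    (e : Fin d → E) (α : Fin d → ℕ) (φ : E → ℝ) : E → ℝ :=
  (List.finRange d).foldr (fun i g => (dirDeriv (e i))^[α i] g) φ

/-- The classical derivative `∂_x^α ∂_y^β φ` of a function of two blocks of variables
`(x, y) ∈ E₁ × E₂`, where `e₁`, `e₂` are the coordinate directions of the blocks. -/
def mixedDeriv {E₁ E₂ : Type*} [NormedAddCommGroup E₁] [NormedSpace ℝ E₁]
    [NormedAddCommGroup E₂] [NormedSpace ℝ E₂] {d₁ d₂ : ℕ}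
    (e₁ : Fin d₁ → E₁) (e₂ : Fin d₂ → E₂) (α : Fin d₁ → ℕ) (β : Fin d₂ → ℕ)
    (φ : E₁ × E₂ → ℝ) : E₁ × E₂ → ℝ :=
  iterDeriv (fun i => ((e₁ i, 0) : E₁ × E₂)) α
    (iterDeriv (fun j => ((0, e₂ j) : E₁ × E₂)) β φ)

/-- `g` is the weak derivative `∂_x^α ∂_y^β f` on the open set `U × V`. -/
def IsWeakDeriv {E₁ E₂ : Type*} [NormedAddCommGroup E₁] [NormedSpace ℝ E₁] [MeasureSpace E₁]
    [NormedAddCommGroup E₂] [NormedSpace ℝ E₂] [MeasureSpace E₂] {d₁ d₂ : ℕ}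
    (e₁ : Fin d₁ → E₁) (e₂ : Fin d₂ → E₂) (U : Set E₁) (V : Set E₂)
    (α : Fin d₁ → ℕ) (β : Fin d₂ → ℕ) (f g : E₁ × E₂ → ℝ) : Prop :=
  LocallyIntegrableOn f (U ×ˢ V) volume ∧ LocallyIntegrableOn g (U ×ˢ V) volume ∧
    ∀ φ : E₁ × E₂ → ℝ, ContDiff ℝ ∞ φ → HasCompactSupport φ → tsupport φ ⊆ U ×ˢ V →
      ∫ z in U ×ˢ V, f z * mixedDeriv e₁ e₂ α β φ z
        = (-1 : ℝ) ^ (∑ i, α i + ∑ j, β j) * ∫ z in U ×ˢ V, g z * φ z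

open Classical in
/-- A representative of the weak derivative `∂_x^α ∂_y^β f` on `U × V` (unique almost everywhere);
zero if the weak derivative does not exist. -/
def weakDeriv {E₁ E₂ : Type*} [NormedAddCommGroup E₁] [NormedSpace ℝ E₁] [MeasureSpace E₁]
    [NormedAddCommGroup E₂] [NormedSpace ℝ E₂] [MeasureSpace E₂] {d₁ d₂ : ℕ}
    (e₁ : Fin d₁ → E₁) (e₂ : Fin d₂ → E₂) (U : Set E₁) (V : Set E₂)
    (α : Fin d₁ → ℕ) (β : Fin d₂ → ℕ) (f : E₁ × E₂ → ℝ) : E₁ × E₂ → ℝ :=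
  if h : ∃ g, IsWeakDeriv e₁ e₂ U V α β f g then h.choose else 0

/-- The mixed Lebesgue norm `‖g‖_{L^{p,q}(U,V)}`: the `L^q(V)` norm in `y`, then the `L^p(U)` norm
in `x`. -/
def mixedLpNorm {E₁ E₂ : Type*} [MeasureSpace E₁] [MeasureSpace E₂]
    (p q : ℝ≥0∞) (U : Set E₁) (V : Set E₂) (g : E₁ × E₂ → ℝ) : ℝ≥0∞ :=
  eLpNorm (fun x => eLpNorm (fun y => g (x, y)) q (volume.restrict V)) p (volume.restrict U)

/-- Membership in the weighted Bochner-Sobolev space `W_{m,p}^{n,q}(w; U, V)` (order `m` and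
exponent `p` in the first block, order `n` and exponent `q` in the second one): all weak
derivatives `∂_x^α ∂_y^β f` with `|α| ≤ m`, `|β| ≤ n` exist and `w ∂_x^α ∂_y^β f ∈ L^{p,q}(U,V)`. -/
def MemBochnerSobolev {E₁ E₂ : Type*} [NormedAddCommGroup E₁] [NormedSpace ℝ E₁] [MeasureSpace E₁]
    [NormedAddCommGroup E₂] [NormedSpace ℝ E₂] [MeasureSpace E₂] {d₁ d₂ : ℕ}
    (e₁ : Fin d₁ → E₁) (e₂ : Fin d₂ → E₂) (m n : ℕ) (p q : ℝ≥0∞) (w : E₁ × E₂ → ℝ)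
    (U : Set E₁) (V : Set E₂) (f : E₁ × E₂ → ℝ) : Prop :=
  ∀ α ∈ multiIndices d₁ m, ∀ β ∈ multiIndices d₂ n, ∃ g : E₁ × E₂ → ℝ,
    IsWeakDeriv e₁ e₂ U V α β f g ∧ mixedLpNorm p q U V (fun z => w z * g z) < ⊤

open Classical in
/-- The norm of the (unweighted) Bochner-Sobolev space `W_{m,p}^{n,q}(U, V)` for finite exponents
`p`, `q`, with the value `∞` for functions outside the space. -/
def bochnerSobolevNorm {E₁ E₂ : Type*}
    [NormedAddCommGroup E₁] [NormedSpace ℝ E₁] [MeasureSpace E₁]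
    [NormedAddCommGroup E₂] [NormedSpace ℝ E₂] [MeasureSpace E₂] {d₁ d₂ : ℕ}
    (e₁ : Fin d₁ → E₁) (e₂ : Fin d₂ → E₂) (m n : ℕ) (p q : ℝ≥0∞)
    (U : Set E₁) (V : Set E₂) (f : E₁ × E₂ → ℝ) : ℝ≥0∞ :=
  if MemBochnerSobolev e₁ e₂ m n p q (fun _ => 1) U V f then
    (∑ α ∈ multiIndices d₁ m, ∫⁻ x in U, (∑ β ∈ multiIndices d₂ n, ∫⁻ y in V,
      ‖weakDeriv e₁ e₂ U V α β f (x, y)‖ₑ ^ q.toReal) ^ (p.toReal / q.toReal)) ^ (1 / p.toReal)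
  else ⊤

/-- The standard coordinate directions of `ℝ^d`. -/
def stdDir (d : ℕ) : Fin d → EuclideanSpace ℝ (Fin d) :=
  fun i => EuclideanSpace.single i 1

/-- The coordinate direction of `ℝ`, as a family with one member. -/
def realDir : Fin 1 → ℝ := fun _ => 1

/-- The bracket `⟨t⟩ = (1 + t²)^{1/2}`. -/
def bracket (t : ℝ) : ℝ := Real.sqrt (1 + t ^ 2)

/-- The two-block neuron `(x, y) ↦ σ(ξ₁ · x + b₁, ξ₂ · y + b₂)`. -/
def neuron {d₁ d₂ : ℕ} (σ : ℝ × ℝ → ℝ)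
    (ξ : EuclideanSpace ℝ (Fin d₁) × EuclideanSpace ℝ (Fin d₂)) (b : ℝ × ℝ) :
    EuclideanSpace ℝ (Fin d₁) × EuclideanSpace ℝ (Fin d₂) → ℝ :=
  fun z => σ (inner ℝ ξ.1 z.1 + b.1, inner ℝ ξ.2 z.2 + b.2)

/-- The dictionary of all two-block neurons that belong to `W_{n₁,2}^{n₂,2}(U, V)`; weights and
biases range over the whole parameter space. -/
def dictionary {d₁ d₂ : ℕ} (σ : ℝ × ℝ → ℝ) (n₁ n₂ : ℕ)
    (U : Set (EuclideanSpace ℝ (Fin d₁))) (V : Set (EuclideanSpace ℝ (Fin d₂))) :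
    Set (EuclideanSpace ℝ (Fin d₁) × EuclideanSpace ℝ (Fin d₂) → ℝ) :=
  {h | MemBochnerSobolev (stdDir d₁) (stdDir d₂) n₁ n₂ 2 2 (fun _ => 1) U V h ∧
    ∃ ξ : EuclideanSpace ℝ (Fin d₁) × EuclideanSpace ℝ (Fin d₂), ∃ b : ℝ × ℝ, h = neuron σ ξ b}

/-- `Σ_{N,M}(D)`: linear combinations of `N` elements of `D` with real coefficients whose absolute
values sum to at most `M`. -/
def sparseSpan {X : Type*} (N : ℕ) (M : ℝ) (D : Set (X → ℝ)) : Set (X → ℝ) :=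
  {g | ∃ (a : Fin N → ℝ) (h : Fin N → X → ℝ),
    (∀ j, h j ∈ D) ∧ ∑ j, |a j| ≤ M ∧ g = fun z => ∑ j, a j * h j z}

end TwoBlock

end

/-! Because γ₁, γ₂ > 1, the activation σ is integrable, and its derivatives up to the given orders
are bounded. An integrable σ ≠ 0 has a window ψ whose two-block ridgelet transform R reproduces
every test function F: the integral of σ(ξ₁·x + t₁, ξ₂·y + t₂) R(ξ,t) over all weights and biases
equals c F(x,y) with c ≠ 0 (`exists_admissible_window`, `integral_ridgelet_eq`). So F is a
continuous superposition of neurons.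

A derivative of order at most (n₁, n₂) of a neuron is bounded by a constant times w(ξ) = (1+|ξ₁|)^n₁
(1+|ξ₂|)^n₂, so the quantity to control is ∫ |R| w. For fixed ξ the biases that matter fill a box
with sides of order 1+|ξᵢ|, which costs one power in each block (`lintegral_ridgelet_le`). The
resulting weighted L¹ norm of the Fourier transform of F is bounded, through Cauchy–Schwarz and
Plancherel, by L² norms of derivatives at the price of ⌊dᵢ/2⌋+1 further powers
(`exists_lintegral_ft_weight_le`). The total order is mᵢ = nᵢ + ⌊dᵢ/2⌋ + 2.

The tuple of all derivatives up to order (n₁, n₂), the jet, is one element of the Hilbert space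
L²(count × (U × V)). By Hahn–Banach the jet of F lies in the closed convex hull of multiples of
neuron jets with norm O(A |U|^½ |V|^½), where A is a multiple of the Sobolev norm
(`mem_closure_convexHull_atoms`, `norm_le_of_mem_atoms`). Cut-off and mollification extend this to
Sobolev f (`exists_sobolev_jet_mem_closure`). Maurey's argument (`exists_norm_sub_average_le`) then
selects N neurons with error O(N^(-½)), and since w ≥ 1 their coefficients sum to at most A in
absolute value. -/

noncomputable section

namespace TwoBlock

set_option linter.unusedSectionVars false

/-! ### Multi-indices flattened to lists of directions. -/

section DirList

variable {X Y : Type*} {d : ℕ}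

/-- The directions of `∂^α`, with multiplicity. -/
def dirList (e : Fin d → X) (α : Fin d → ℕ) : List X :=
  (List.finRange d).flatMap fun i => List.replicate (α i) (e i)

lemma length_dirList (e : Fin d → X) (α : Fin d → ℕ) :
    (dirList e α).length = ∑ i, α i := by
  simp [dirList, List.length_flatMap, ← List.ofFn_eq_map, List.sum_ofFn]

lemma dirList_map (g : X → Y) (e : Fin d → X) (α : Fin d → ℕ) :
    (dirList e α).map g = dirList (g ∘ e) α := by
  simp [dirList, List.map_flatMap]

/-- This is how monomials arise, both from the Fourier symbol of a derivative and from the chain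
rule for neurons. -/
lemma prod_map_dirList {M : Type*} [CommMonoid M] (c : X → M) (e : Fin d → X) (α : Fin d → ℕ) :
    ((dirList e α).map c).prod = ∏ i, c (e i) ^ α i := by
  have : ∀ l : List (Fin d), ((l.flatMap fun i => List.replicate (α i) (e i)).map c).prod =
      (l.map fun i => c (e i) ^ α i).prod := by
    intro l
    induction l with
    | nil => simp
    | cons i l ih => simp [ih]
  rw [dirList, this, ← List.ofFn_eq_map, List.prod_ofFn]

/-- Along a single direction only the total order survives, so the derivatives of a neuron see σ
only through |α| and |β|. -/
lemma dirList_const (x : X) (α : Fin d → ℕ) :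
    dirList (fun _ => x) α = List.replicate (∑ i, α i) x := by
  rw [List.eq_replicate_iff]
  refine ⟨length_dirList _ _, fun y hy => ?_⟩
  simp only [dirList, List.mem_flatMap, List.mem_replicate] at hy
  obtain ⟨_, _, _, h⟩ := hy
  exact h

end DirList

/-! ### Calculus of iterated directional derivatives. -/

section ListDeriv

variable {E : Type*} [NormedAddCommGroup E] [NormedSpace ℝ E]

/-- Iterated directional derivative along a list of directions, the last one applied first. -/
def listDeriv (L : List E) (φ : E → ℝ) : E → ℝ := L.foldr dirDeriv φ

@[simp] lemma listDeriv_nil (φ : E → ℝ) : listDeriv [] φ = φ := rfl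

@[simp] lemma listDeriv_cons (v : E) (L : List E) (φ : E → ℝ) :
    listDeriv (v :: L) φ = dirDeriv v (listDeriv L φ) := rfl

lemma listDeriv_append (L L' : List E) (φ : E → ℝ) :
    listDeriv (L ++ L') φ = listDeriv L (listDeriv L' φ) := by
  simp [listDeriv, List.foldr_append]

lemma listDeriv_replicate (n : ℕ) (v : E) (φ : E → ℝ) :
    listDeriv (List.replicate n v) φ = (dirDeriv v)^[n] φ := by
  induction n with
  | zero => rfl
  | succ n ih => rw [List.replicate_succ, listDeriv_cons, ih, Function.iterate_succ_apply']

lemma iterDeriv_eq_listDeriv {d : ℕ} (e : Fin d → E) (α : Fin d → ℕ) (φ : E → ℝ) :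
    iterDeriv e α φ = listDeriv (dirList e α) φ := by
  unfold iterDeriv dirList
  induction List.finRange d with
  | nil => rfl
  | cons i l ih =>
    rw [List.foldr_cons, ih, List.flatMap_cons, listDeriv_append, listDeriv_replicate]

lemma contDiff_dirDeriv {φ : E → ℝ} (hφ : ContDiff ℝ ∞ φ) (v : E) :
    ContDiff ℝ ∞ (dirDeriv v φ) :=
  (hφ.fderiv_right (m := ∞) (by simp)).clm_apply contDiff_const

lemma contDiff_listDeriv {φ : E → ℝ} (hφ : ContDiff ℝ ∞ φ) (L : List E) :
    ContDiff ℝ ∞ (listDeriv L φ) := by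
  induction L with
  | nil => exact hφ
  | cons v L ih => exact contDiff_dirDeriv ih v

lemma tsupport_dirDeriv_subset (v : E) (φ : E → ℝ) : tsupport (dirDeriv v φ) ⊆ tsupport φ := by
  refine (closure_mono fun x hx => ?_).trans (tsupport_fderiv_subset ℝ (f := φ))
  intro h
  exact hx (by simp [dirDeriv, h])

lemma tsupport_listDeriv_subset (L : List E) (φ : E → ℝ) :
    tsupport (listDeriv L φ) ⊆ tsupport φ := by
  induction L with
  | nil => exact subset_rfl
  | cons v L ih => exact (tsupport_dirDeriv_subset v _).trans ih

lemma hasCompactSupport_listDeriv {φ : E → ℝ} (hφ : HasCompactSupport φ) (L : List E) :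
    HasCompactSupport (listDeriv L φ) :=
  hφ.of_isClosed_subset isClosed_closure (tsupport_listDeriv_subset L φ)

lemma dirDeriv_comm {φ : E → ℝ} (hφ : ContDiff ℝ ∞ φ) (v w : E) :
    dirDeriv v (dirDeriv w φ) = dirDeriv w (dirDeriv v φ) := by
  have hd : Differentiable ℝ (fderiv ℝ φ) :=
    (hφ.fderiv_right (m := ∞) (by simp)).differentiable (by simp)
  have key : ∀ a b z, dirDeriv a (dirDeriv b φ) z = fderiv ℝ (fderiv ℝ φ) z a b := by
    intro a b z
    have : HasFDerivAt (fun y => fderiv ℝ φ y b)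
        ((ContinuousLinearMap.apply ℝ ℝ b).comp (fderiv ℝ (fderiv ℝ φ) z)) z :=
      (ContinuousLinearMap.apply ℝ ℝ b).hasFDerivAt.comp z (hd z).hasFDerivAt
    have h2 : dirDeriv b φ = fun y => fderiv ℝ φ y b := rfl
    rw [dirDeriv, h2, this.fderiv]
    rfl
  funext z
  rw [key, key]
  exact (hφ.contDiffAt.isSymmSndFDerivAt
    (by simpa using WithTop.coe_le_coe.2 (le_top : (2 : ℕ∞) ≤ ⊤))) v w

/-- Integration by parts reverses the order of differentiation; symmetry of second derivatives
undoes this. -/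
lemma listDeriv_perm {φ : E → ℝ} (hφ : ContDiff ℝ ∞ φ) {L L' : List E} (h : L.Perm L') :
    listDeriv L φ = listDeriv L' φ := by
  induction h with
  | nil => rfl
  | cons v _ ih => rw [listDeriv_cons, listDeriv_cons, ih]
  | swap v w l => exact dirDeriv_comm (contDiff_listDeriv hφ l) _ _
  | trans _ _ ih1 ih2 => rw [ih1, ih2]

lemma dirDeriv_smul_dir (c : ℝ) (v : E) (φ : E → ℝ) :
    dirDeriv (c • v) φ = fun z => c * dirDeriv v φ z := by
  funext z
  simp [dirDeriv]

lemma dirDeriv_const_mul (c : ℝ) (v : E) {φ : E → ℝ} (hφ : ContDiff ℝ ∞ φ) :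
    dirDeriv v (fun z => c * φ z) = fun z => c * dirDeriv v φ z := by
  funext z
  simp only [dirDeriv]
  rw [fderiv_const_mul (hφ.differentiable (by simp) z)]
  simp

lemma dirDeriv_mul (v : E) {φ χ : E → ℝ} (hφ : ContDiff ℝ ∞ φ) (hχ : ContDiff ℝ ∞ χ) :
    dirDeriv v (fun z => χ z * φ z) =
      fun z => dirDeriv v χ z * φ z + χ z * dirDeriv v φ z := by
  funext z
  simp only [dirDeriv]
  rw [fderiv_fun_mul (hχ.differentiable (by simp) z) (hφ.differentiable (by simp) z)]
  simp
  ring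

lemma dirDeriv_add (v : E) {φ χ : E → ℝ} (hφ : ContDiff ℝ ∞ φ) (hχ : ContDiff ℝ ∞ χ) :
    dirDeriv v (fun z => χ z + φ z) = fun z => dirDeriv v χ z + dirDeriv v φ z := by
  funext z
  simp only [dirDeriv]
  rw [fderiv_fun_add (hχ.differentiable (by simp) z) (hφ.differentiable (by simp) z)]
  simp

lemma listDeriv_add (L : List E) {φ χ : E → ℝ} (hφ : ContDiff ℝ ∞ φ) (hχ : ContDiff ℝ ∞ χ) :
    listDeriv L (fun z => χ z + φ z) = fun z => listDeriv L χ z + listDeriv L φ z := by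
  induction L with
  | nil => rfl
  | cons v L ih =>
    rw [listDeriv_cons, ih, dirDeriv_add v (contDiff_listDeriv hφ L) (contDiff_listDeriv hχ L)]
    rfl

/-- Differentiation of an affine pullback. -/
lemma listDeriv_comp_affine {G : Type*} [NormedAddCommGroup G] [NormedSpace ℝ G]
    (A : E →L[ℝ] G) (b : G) (L : List E) {s : G → ℝ} (hs : ContDiff ℝ ∞ s) :
    listDeriv L (fun z => s (A z + b)) = fun z => listDeriv (L.map A) s (A z + b) := by
  induction L with
  | nil => rfl
  | cons v L ih =>
    rw [listDeriv_cons, ih]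
    funext z
    have h1 : HasFDerivAt (listDeriv (L.map A) s) (fderiv ℝ (listDeriv (L.map A) s) (A z + b))
        (A z + b) := ((contDiff_listDeriv hs _).differentiable (by simp) _).hasFDerivAt
    have h2 : HasFDerivAt (fun z => A z + b) (A : E →L[ℝ] G) z := A.hasFDerivAt.add_const b
    have h3 := h1.comp z h2
    simp only [dirDeriv, List.map_cons, listDeriv_cons]
    rw [show (fun z => listDeriv (L.map A) s (A z + b)) =
      listDeriv (L.map A) s ∘ (fun z => A z + b) from rfl, h3.fderiv]
    rfl

/-- Rescaling each direction. -/
lemma listDeriv_map_smul {ι : Type*} (c : ι → ℝ) (v : ι → E) (L : List ι) {s : E → ℝ}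
    (hs : ContDiff ℝ ∞ s) :
    listDeriv (L.map fun i => c i • v i) s = fun z => (L.map c).prod * listDeriv (L.map v) s z := by
  induction L with
  | nil => simp
  | cons i L ih =>
    simp only [List.map_cons, listDeriv_cons, List.prod_cons]
    rw [dirDeriv_smul_dir, ih, dirDeriv_const_mul _ _ (contDiff_listDeriv hs _)]
    funext z
    ring

lemma listDeriv_reflect (L : List E) (z : E) {η : E → ℝ} (hη : ContDiff ℝ ∞ η) :
    listDeriv L (fun w => η (z - w)) = fun w => (-1 : ℝ) ^ L.length * listDeriv L η (z - w) := by
  have h := listDeriv_comp_affine (-ContinuousLinearMap.id ℝ E) z L hη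
  have h2 := listDeriv_map_smul (fun _ : E => (-1 : ℝ)) id L hη
  have e1 : (fun w => η (z - w)) = fun w => η ((-ContinuousLinearMap.id ℝ E) w + z) := by
    funext w; congr 1; simp; abel
  rw [e1, h]
  funext w
  have e2 : L.map (-ContinuousLinearMap.id ℝ E) = L.map fun i => (-1 : ℝ) • id i := by
    simp
  have e3 : (-ContinuousLinearMap.id ℝ E) w + z = z - w := by simp; abel
  rw [e2, h2, e3]
  simp

/-- The Leibniz rule, as a pointwise bound by the derivatives along sublists. -/
lemma exists_abs_listDeriv_mul_le (L : List E) {χ : E → ℝ} (hχ : ContDiff ℝ ∞ χ)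
    (hχc : HasCompactSupport χ) :
    ∃ C : ℝ, 0 ≤ C ∧ ∀ φ : E → ℝ, ContDiff ℝ ∞ φ → ∀ z,
      |listDeriv L (fun z => χ z * φ z) z| ≤ C * (L.sublists.map fun K => |listDeriv K φ z|).sum := by
  -- Reversal puts the innermost direction v at the head. Differentiating along it first leaves the
  -- products (∂_v χ)φ and χ(∂_v φ), to which the induction hypothesis applies.
  suffices H : ∀ (L : List E) (χ : E → ℝ), ContDiff ℝ ∞ χ → HasCompactSupport χ →
      ∃ C : ℝ, 0 ≤ C ∧ ∀ φ : E → ℝ, ContDiff ℝ ∞ φ → ∀ z,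
      |listDeriv L.reverse (fun z => χ z * φ z) z| ≤
        C * (L.sublists.map fun K => |listDeriv K.reverse φ z|).sum by
    obtain ⟨C, hC, h⟩ := H L.reverse χ hχ hχc
    refine ⟨C, hC, fun φ hφ z => ?_⟩
    have := h φ hφ z
    rw [List.reverse_reverse, List.sublists_reverse] at this
    refine this.trans (le_of_eq ?_)
    rw [List.map_map]
    congr 1
    have hp : ((L.sublists').map fun K => |listDeriv K φ z|).Perm
        (L.sublists.map fun K => |listDeriv K φ z|) :=
      (List.sublists_perm_sublists' L).symm.map _
    rw [← hp.sum_eq]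
    congr 1
    apply List.map_congr_left
    intro K _
    simp
  clear hχ hχc χ L
  intro L
  induction L with
  | nil =>
    intro χ hχ hχc
    obtain ⟨C, hC⟩ := hχ.continuous.bounded_above_of_compact_support hχc
    refine ⟨max C 0, le_max_right _ _, fun φ _ z => ?_⟩
    simp only [List.reverse_nil, listDeriv_nil, abs_mul, List.sublists_nil, List.map_cons,
      List.map_nil, List.sum_cons, List.sum_nil, add_zero]
    exact mul_le_mul_of_nonneg_right ((hC z).trans (le_max_left _ _)) (abs_nonneg _)
  | cons v L ih =>
    intro χ hχ hχc
    obtain ⟨C1, hC1, h1⟩ := ih _ (contDiff_dirDeriv hχ v)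
      (hχc.of_isClosed_subset isClosed_closure (tsupport_dirDeriv_subset v χ))
    obtain ⟨C2, hC2, h2⟩ := ih χ hχ hχc
    refine ⟨C1 + C2, by positivity, fun φ hφ z => ?_⟩
    rw [List.reverse_cons, listDeriv_append]
    simp only [listDeriv_cons, listDeriv_nil]
    rw [dirDeriv_mul v hφ hχ, listDeriv_add _ (hχ.mul (contDiff_dirDeriv hφ v))
      ((contDiff_dirDeriv hχ v).mul hφ)]
    have hs : ((v :: L).sublists.map fun K => |listDeriv K.reverse φ z|).sum =
        (L.sublists.map fun K => |listDeriv K.reverse φ z|).sum +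
        (L.sublists.map fun K => |listDeriv K.reverse (dirDeriv v φ) z|).sum := by
      have hp : ((v :: L).sublists.map fun K => |listDeriv K.reverse φ z|).Perm
          ((L.sublists ++ L.sublists.map (List.cons v)).map fun K => |listDeriv K.reverse φ z|) :=
        (List.sublists_cons_perm_append v L).map _
      rw [hp.sum_eq, List.map_append, List.sum_append, List.map_map]
      congr 2
      apply List.map_congr_left
      intro K _
      simp [listDeriv_append]
    rw [hs]
    have n1 : 0 ≤ (L.sublists.map fun K => |listDeriv K.reverse φ z|).sum :=
      List.sum_nonneg (by simp only [List.mem_map]; rintro _ ⟨K, _, rfl⟩; exact abs_nonneg _)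
    have n2 : 0 ≤ (L.sublists.map fun K => |listDeriv K.reverse (dirDeriv v φ) z|).sum :=
      List.sum_nonneg (by simp only [List.mem_map]; rintro _ ⟨K, _, rfl⟩; exact abs_nonneg _)
    calc _ ≤ _ := abs_add_le _ _
      _ ≤ _ := add_le_add (h1 φ hφ z) (h2 _ (contDiff_dirDeriv hφ v) z)
      _ ≤ _ := by nlinarith [mul_nonneg hC1 n2, mul_nonneg hC2 n1]

end ListDeriv

/-! ### Mixed derivatives in two blocks. -/

section Mixed

variable {E₁ E₂ : Type*} [NormedAddCommGroup E₁] [NormedSpace ℝ E₁]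
  [NormedAddCommGroup E₂] [NormedSpace ℝ E₂] {d₁ d₂ : ℕ}

/-- The directions of `∂_x^α ∂_y^β`, with multiplicity. -/
def mixedList (e₁ : Fin d₁ → E₁) (e₂ : Fin d₂ → E₂) (α : Fin d₁ → ℕ) (β : Fin d₂ → ℕ) :
    List (E₁ × E₂) :=
  dirList (fun i => ((e₁ i, 0) : E₁ × E₂)) α ++ dirList (fun j => ((0, e₂ j) : E₁ × E₂)) β

lemma mixedDeriv_eq_listDeriv (e₁ : Fin d₁ → E₁) (e₂ : Fin d₂ → E₂) (α : Fin d₁ → ℕ)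
    (β : Fin d₂ → ℕ) (φ : E₁ × E₂ → ℝ) :
    mixedDeriv e₁ e₂ α β φ = listDeriv (mixedList e₁ e₂ α β) φ := by
  rw [mixedDeriv, mixedList, listDeriv_append, iterDeriv_eq_listDeriv, iterDeriv_eq_listDeriv]

lemma length_mixedList (e₁ : Fin d₁ → E₁) (e₂ : Fin d₂ → E₂) (α : Fin d₁ → ℕ)
    (β : Fin d₂ → ℕ) : (mixedList e₁ e₂ α β).length = ∑ i, α i + ∑ j, β j := by
  rw [mixedList, List.length_append, length_dirList, length_dirList]

end Mixed

/-! ### Mollification: derivatives, bounds and L² convergence. -/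

section Convolution

open Filter Topology

variable {E : Type*} [NormedAddCommGroup E] [NormedSpace ℝ E] [FiniteDimensional ℝ E]
  [MeasurableSpace E] [BorelSpace E] {μ : Measure E} [μ.IsAddHaarMeasure]

lemma integral_mul_dirDeriv (v : E) {f φ : E → ℝ} (hf : ContDiff ℝ ∞ f) (hφ : ContDiff ℝ ∞ φ)
    (hφc : HasCompactSupport φ) :
    ∫ z, f z * dirDeriv v φ z ∂μ = -∫ z, dirDeriv v f z * φ z ∂μ := by
  have hφ' := contDiff_dirDeriv hφ v
  have hf' := contDiff_dirDeriv hf v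
  have hc' : HasCompactSupport (dirDeriv v φ) :=
    hφc.of_isClosed_subset isClosed_closure (tsupport_dirDeriv_subset v φ)
  refine integral_mul_fderiv_eq_neg_fderiv_mul_of_integrable ?_ ?_ ?_
    (fun x _ => hf.differentiable (by simp) x) (fun x _ => hφ.differentiable (by simp) x)
  · exact (hf'.continuous.mul hφ.continuous).integrable_of_hasCompactSupport hφc.mul_left
  · exact (hf.continuous.mul hφ'.continuous).integrable_of_hasCompactSupport hc'.mul_left
  · exact (hf.continuous.mul hφ.continuous).integrable_of_hasCompactSupport hφc.mul_left

lemma integral_mul_listDeriv (L : List E) {f φ : E → ℝ} (hf : ContDiff ℝ ∞ f)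
    (hφ : ContDiff ℝ ∞ φ) (hφc : HasCompactSupport φ) :
    ∫ z, f z * listDeriv L φ z ∂μ = (-1 : ℝ) ^ L.length * ∫ z, listDeriv L f z * φ z ∂μ := by
  -- Each integration by parts takes the outermost direction off φ and makes it the innermost one on
  -- f.
  suffices H : ∀ f : E → ℝ, ContDiff ℝ ∞ f → ∫ z, f z * listDeriv L φ z ∂μ =
      (-1 : ℝ) ^ L.length * ∫ z, listDeriv L.reverse f z * φ z ∂μ by
    rw [H f hf, listDeriv_perm hf L.reverse_perm]
  clear hf f
  induction L with
  | nil => intro f _; simp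
  | cons v L ih =>
    intro f hf
    rw [listDeriv_cons, integral_mul_dirDeriv v hf (contDiff_listDeriv hφ L)
      (hasCompactSupport_listDeriv hφc L), ih _ (contDiff_dirDeriv hf v), List.reverse_cons,
      listDeriv_append, List.length_cons, pow_succ]
    simp

/-- Mollification of `f` by `η`. -/
def mollify (μ : Measure E) (η f : E → ℝ) : E → ℝ :=
  convolution η f (ContinuousLinearMap.lsmul ℝ ℝ) μ

lemma mollify_apply (η f : E → ℝ) (z : E) :
    mollify μ η f z = ∫ w, η w * f (z - w) ∂μ := rfl

lemma mollify_apply_swap (η f : E → ℝ) (z : E) :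
    mollify μ η f z = ∫ w, f w * η (z - w) ∂μ := by
  rw [mollify_apply, ← integral_sub_left_eq_self _ μ z]
  simp [mul_comm]

lemma dirDeriv_mollify (v : E) {η f : E → ℝ} (hη : ContDiff ℝ ∞ η) (hηc : HasCompactSupport η)
    (hf : LocallyIntegrable f μ) : dirDeriv v (mollify μ η f) = mollify μ (dirDeriv v η) f := by
  funext z
  have h := hηc.hasFDerivAt_convolution_left (ContinuousLinearMap.lsmul ℝ ℝ)
    (hη.of_le (by simp)) hf z
  rw [dirDeriv, mollify, h.fderiv, mollify, convolution, convolution]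
  rw [ContinuousLinearMap.integral_apply]
  · rfl
  · exact (hηc.fderiv (𝕜 := ℝ)).convolutionExists_left _
      (hη.continuous_fderiv (by simp)) hf z

lemma contDiff_mollify {η f : E → ℝ} (hη : ContDiff ℝ ∞ η) (hηc : HasCompactSupport η)
    (hf : LocallyIntegrable f μ) : ContDiff ℝ ∞ (mollify μ η f) :=
  hηc.contDiff_convolution_left _ hη hf

lemma listDeriv_mollify (L : List E) {η f : E → ℝ} (hη : ContDiff ℝ ∞ η)
    (hηc : HasCompactSupport η) (hf : LocallyIntegrable f μ) :
    listDeriv L (mollify μ η f) = mollify μ (listDeriv L η) f := by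
  induction L with
  | nil => rfl
  | cons v L ih =>
    rw [listDeriv_cons, ih, dirDeriv_mollify v (contDiff_listDeriv hη L)
      (hasCompactSupport_listDeriv hηc L) hf]
    rfl

/-- Derivatives of a mollification are mollified weak derivatives. -/
lemma listDeriv_mollify_of_weak (L : List E) {η f g : E → ℝ} (hη : ContDiff ℝ ∞ η)
    (hηc : HasCompactSupport η) (hf : LocallyIntegrable f μ)
    (hfg : ∀ φ : E → ℝ, ContDiff ℝ ∞ φ → HasCompactSupport φ →
      ∫ z, f z * listDeriv L φ z ∂μ = (-1 : ℝ) ^ L.length * ∫ z, g z * φ z ∂μ) :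
    listDeriv L (mollify μ η f) = mollify μ η g := by
  rw [listDeriv_mollify L hη hηc hf]
  funext z
  -- The test function is the reflected translate of η. Its reflection sign is the sign in the
  -- definition of weak derivatives, so the two cancel.
  have h := hfg (fun w => η (z - w)) (hη.comp (contDiff_const.sub contDiff_id))
    (hηc.comp_homeomorph (Homeomorph.subLeft z))
  rw [listDeriv_reflect L z hη] at h
  rw [mollify_apply_swap, mollify_apply_swap]
  have e : ∀ w, f w * ((-1 : ℝ) ^ L.length * listDeriv L η (z - w)) =
    (-1 : ℝ) ^ L.length * (f w * listDeriv L η (z - w)) := fun w => by ring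
  simp only [e] at h
  rw [integral_const_mul] at h
  exact mul_left_cancel₀ (pow_ne_zero _ (by norm_num)) h

/-- A sequence of bump functions shrinking to the origin. -/
def bumpSeq (E : Type*) [NormedAddCommGroup E] (n : ℕ) : ContDiffBump (0 : E) where
  rIn := 1 / ((n : ℝ) + 1)
  rOut := 2 / ((n : ℝ) + 1)
  rIn_pos := by positivity
  rIn_lt_rOut := by gcongr; norm_num

/-- The normalised mollifiers of `bumpSeq`. -/
def mollifier (μ : Measure E) (n : ℕ) : E → ℝ := (bumpSeq E n).normed μ

lemma contDiff_mollifier (n : ℕ) : ContDiff ℝ ∞ (mollifier μ n) := (bumpSeq E n).contDiff_normed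

lemma hasCompactSupport_mollifier (n : ℕ) : HasCompactSupport (mollifier μ n) :=
  (bumpSeq E n).hasCompactSupport_normed

lemma mollifier_nonneg (n : ℕ) (z : E) : 0 ≤ mollifier μ n z := (bumpSeq E n).nonneg_normed z

lemma ae_tendsto_mollify {f : E → ℝ} (hf : LocallyIntegrable f μ) :
    ∀ᵐ z ∂μ, Tendsto (fun n => mollify μ (mollifier μ n) f z) atTop (𝓝 (f z)) := by
  -- The ratio of outer to inner radius is constantly 2, the bound that Lebesgue differentiation
  -- needs.
  refine ContDiffBump.ae_convolution_tendsto_right_of_locallyIntegrable (K := 2) (μ := μ)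
    (φ := bumpSeq E) ?_ ?_ hf
  · exact by
      have h := (tendsto_one_div_add_atTop_nhds_zero_nat (𝕜 := ℝ)).const_mul 2
      simpa [bumpSeq, div_eq_mul_inv] using h
  · refine Eventually.of_forall fun n => le_of_eq ?_
    simp only [bumpSeq]; ring

lemma abs_mollify_mollifier_le {f : E → ℝ} {B : ℝ} (hf : ∀ᵐ z ∂μ, |f z| ≤ B) (n : ℕ) (z : E) :
    |mollify μ (mollifier μ n) f z| ≤ B := by
  rw [mollify_apply_swap]
  have h1 : ∫ w, mollifier μ n (z - w) ∂μ = 1 := by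
    rw [integral_sub_left_eq_self (mollifier μ n) μ z]; exact (bumpSeq E n).integral_normed
  have hi : Integrable (fun w => B * mollifier μ n (z - w)) μ :=
    (((contDiff_mollifier n).continuous.comp (continuous_const.sub continuous_id))
      |>.integrable_of_hasCompactSupport
      ((hasCompactSupport_mollifier n).comp_homeomorph (Homeomorph.subLeft z))).const_mul B
  calc |∫ w, f w * mollifier μ n (z - w) ∂μ| ≤ ∫ w, B * mollifier μ n (z - w) ∂μ := by
        rw [← Real.norm_eq_abs]
        refine norm_integral_le_of_norm_le hi ?_
        filter_upwards [hf] with w hw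
        rw [norm_mul, Real.norm_eq_abs, Real.norm_eq_abs, abs_of_nonneg
          (mollifier_nonneg n _)]
        exact mul_le_mul_of_nonneg_right hw (mollifier_nonneg n _)
    _ = B := by rw [integral_const_mul, h1, mul_one]

/-- Young's inequality for a kernel of mass one: Cauchy–Schwarz for the probability measure |η| dμ
bounds the square of the average by the average of the square, and Tonelli with translation
invariance integrates it. -/
lemma eLpNorm_mollify_mollifier_le {f : E → ℝ} (hf : AEStronglyMeasurable f μ) (n : ℕ) :
    eLpNorm (mollify μ (mollifier μ n) f) 2 μ ≤ eLpNorm f 2 μ := by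
  set η := mollifier μ n with hη
  have hηm : Measurable fun w => ‖η w‖ₑ := (contDiff_mollifier n).continuous.measurable.enorm
  have hη1 : ∫⁻ w, ‖η w‖ₑ ∂μ = 1 := by
    have h := (bumpSeq E n).integral_normed (μ := μ)
    have hi : Integrable η μ := (contDiff_mollifier n).continuous.integrable_of_hasCompactSupport
      (hasCompactSupport_mollifier n)
    have h2 := ofReal_integral_eq_lintegral_ofReal hi
      (Eventually.of_forall fun w => (bumpSeq E n).nonneg_normed w)
    rw [show ∫ w, η w ∂μ = 1 from h] at h2
    rw [← ENNReal.ofReal_one, h2]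
    refine lintegral_congr fun w => ?_
    rw [Real.enorm_eq_ofReal (mollifier_nonneg n w)]
  set ν := μ.withDensity fun w => ‖η w‖ₑ with hν
  have hνac : ν ≪ μ := withDensity_absolutelyContinuous _ _
  have hν1 : ν Set.univ = 1 := by
    rw [hν, withDensity_apply _ MeasurableSet.univ, Measure.restrict_univ, hη1]
  have : IsProbabilityMeasure ν := ⟨hν1⟩
  have hfz : ∀ z, AEMeasurable (fun w => f (z - w)) μ := fun z =>
    (hf.comp_quasiMeasurePreserving (quasiMeasurePreserving_sub_left μ z)).aemeasurable
  have hpt : ∀ z, ‖mollify μ η f z‖ₑ ^ (2 : ℝ) ≤ ∫⁻ w, ‖η w‖ₑ * ‖f (z - w)‖ₑ ^ (2 : ℝ) ∂μ := by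
    intro z
    have h1 : ‖mollify μ η f z‖ₑ ≤ ∫⁻ w, ‖f (z - w)‖ₑ ∂ν := by
      rw [mollify_apply]
      refine (enorm_integral_le_lintegral_enorm _).trans (le_of_eq ?_)
      rw [hν, lintegral_withDensity_eq_lintegral_mul₀ hηm.aemeasurable
        (hfz z).enorm]
      simp [enorm_mul]
    have h2 : ∫⁻ w, ‖f (z - w)‖ₑ ∂ν ≤ (∫⁻ w, ‖f (z - w)‖ₑ ^ (2 : ℝ) ∂ν) ^ (1 / 2 : ℝ) := by
      have := ENNReal.lintegral_mul_le_Lp_mul_Lq ν Real.HolderConjugate.two_two ((hfz z).mono_ac hνac).enorm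
        (g := fun _ => 1) aemeasurable_const
      simpa [hν1] using this
    calc ‖mollify μ η f z‖ₑ ^ (2 : ℝ) ≤ ((∫⁻ w, ‖f (z - w)‖ₑ ^ (2 : ℝ) ∂ν) ^ (1 / 2 : ℝ)) ^ (2 : ℝ) :=
          ENNReal.rpow_le_rpow (h1.trans h2) (by norm_num)
      _ = ∫⁻ w, ‖f (z - w)‖ₑ ^ (2 : ℝ) ∂ν := by rw [← ENNReal.rpow_mul]; norm_num
      _ = _ := by
        rw [hν, lintegral_withDensity_eq_lintegral_mul₀ hηm.aemeasurable
          ((hfz z).enorm.pow_const _)]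
        rfl
  rw [eLpNorm_eq_lintegral_rpow_enorm_toReal (by norm_num) (by norm_num),
    eLpNorm_eq_lintegral_rpow_enorm_toReal (by norm_num) (by norm_num)]
  refine ENNReal.rpow_le_rpow ?_ (by simp)
  simp only [ENNReal.toReal_ofNat]
  calc ∫⁻ z, ‖mollify μ η f z‖ₑ ^ (2 : ℝ) ∂μ
      ≤ ∫⁻ z, ∫⁻ w, ‖η w‖ₑ * ‖f (z - w)‖ₑ ^ (2 : ℝ) ∂μ ∂μ := lintegral_mono hpt
    _ = ∫⁻ w, ∫⁻ z, ‖η w‖ₑ * ‖f (z - w)‖ₑ ^ (2 : ℝ) ∂μ ∂μ := by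
        rw [lintegral_lintegral_swap]
        have h1 : AEStronglyMeasurable (fun p : E × E => f (p.1 - p.2)) (μ.prod μ) :=
          hf.comp_quasiMeasurePreserving (quasiMeasurePreserving_sub μ μ)
        exact (hηm.comp measurable_snd).aemeasurable.mul (h1.aemeasurable.enorm.pow_const _)
    _ = ∫⁻ w, ‖η w‖ₑ * ∫⁻ z, ‖f z‖ₑ ^ (2 : ℝ) ∂μ ∂μ := by
        refine lintegral_congr fun w => ?_
        rw [lintegral_const_mul' _ _ enorm_ne_top,
          lintegral_sub_right_eq_self (fun z => ‖f z‖ₑ ^ (2 : ℝ)) w]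
    _ = ∫⁻ z, ‖f z‖ₑ ^ (2 : ℝ) ∂μ := by
        rw [lintegral_mul_const _ hηm, hη1, one_mul]

/-- Almost everywhere convergence without increase of norm gives convergence in `L²`. -/
lemma tendsto_eLpNorm_sub_of_ae {X : Type*} [MeasurableSpace X] {ν : Measure X}
    {h : ℕ → X → ℝ} {g : X → ℝ} (hg : MemLp g 2 ν)
    (hh : ∀ n, AEStronglyMeasurable (h n) ν) (hle : ∀ n, eLpNorm (h n) 2 ν ≤ eLpNorm g 2 ν)
    (hlim : ∀ᵐ x ∂ν, Tendsto (fun n => h n x) atTop (𝓝 (g x))) :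
    Tendsto (fun n => eLpNorm (h n - g) 2 ν) atTop (𝓝 0) := by
  have hhm : ∀ n, MemLp (h n) 2 ν := fun n => ⟨hh n, (hle n).trans_lt hg.2⟩
  set G : Lp ℝ 2 ν := hg.toLp g
  set H : ℕ → Lp ℝ 2 ν := fun n => (hhm n).toLp (h n)
  have hnH : ∀ n, ‖H n‖ ≤ ‖G‖ := fun n => by
    rw [Lp.norm_toLp, Lp.norm_toLp]
    exact ENNReal.toReal_mono hg.2.ne (hle n)
  -- Fatou gives ‖2g‖ ≤ lim inf ‖hₙ + g‖. As ‖hₙ‖ ≤ ‖g‖, the parallelogram law then forces ‖hₙ - g‖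
  -- → 0.
  have hfat : eLpNorm (g + g) 2 ν ≤ liminf (fun n => eLpNorm (h n + g) 2 ν) atTop := by
    refine Lp.eLpNorm_lim_le_liminf_eLpNorm (fun n => ((hh n).add hg.1)) _ ?_
    filter_upwards [hlim] with x hx
    exact hx.add_const _
  have hsub : ∀ n, eLpNorm (h n - g) 2 ν = ENNReal.ofReal ‖H n - G‖ := fun n => by
    rw [← MemLp.toLp_sub, Lp.norm_toLp, ENNReal.ofReal_toReal ((hhm n).sub hg).2.ne]
  have hadd : ∀ n, eLpNorm (h n + g) 2 ν = ENNReal.ofReal ‖H n + G‖ := fun n => by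
    rw [← MemLp.toLp_add, Lp.norm_toLp, ENNReal.ofReal_toReal ((hhm n).add hg).2.ne]
  have hadd' : eLpNorm (g + g) 2 ν = ENNReal.ofReal (2 * ‖G‖) := by
    have : 2 * ‖G‖ = ‖G + G‖ := by rw [← two_smul ℝ G, norm_smul]; simp
    rw [this, ← MemLp.toLp_add, Lp.norm_toLp, ENNReal.ofReal_toReal (hg.add hg).2.ne]
  simp only [hsub]
  rw [← ENNReal.ofReal_zero]
  refine ENNReal.tendsto_ofReal ?_
  have hsq : ∀ n, ‖H n - G‖ ^ 2 ≤ 4 * ‖G‖ ^ 2 - ‖H n + G‖ ^ 2 := fun n => by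
    have := parallelogram_law_with_norm ℝ (H n) G
    nlinarith [hnH n, norm_nonneg (H n), norm_nonneg G]
  rw [Metric.tendsto_atTop]
  intro ε hε
  by_cases hG : ‖G‖ = 0
  · refine ⟨0, fun n _ => ?_⟩
    have h1 := hsq n
    have h2 : ‖H n - G‖ = 0 := by
      have : ‖H n - G‖ ^ 2 ≤ 0 := by rw [hG] at h1; nlinarith [sq_nonneg ‖H n + G‖]
      exact pow_eq_zero_iff (two_ne_zero) |>.1 (le_antisymm this (sq_nonneg _))
    simpa [h2] using hε
  have hGpos : 0 < ‖G‖ := lt_of_le_of_ne (norm_nonneg _) (Ne.symm hG)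
  -- If ‖Hₙ + G‖ > 2‖G‖ - δ > 0, then ‖Hₙ - G‖² < 4‖G‖² - (2‖G‖ - δ)² < 4‖G‖δ < ε².
  obtain ⟨δ, hδ, hδG, hδε⟩ : ∃ δ : ℝ, 0 < δ ∧ δ < 2 * ‖G‖ ∧ 4 * ‖G‖ * δ < ε ^ 2 := by
    refine ⟨min ‖G‖ (ε ^ 2 / (8 * ‖G‖)), by positivity, ?_, ?_⟩
    · exact (min_le_left _ _).trans_lt (by linarith)
    · have h1 : min ‖G‖ (ε ^ 2 / (8 * ‖G‖)) ≤ ε ^ 2 / (8 * ‖G‖) := min_le_right _ _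
      calc 4 * ‖G‖ * min ‖G‖ (ε ^ 2 / (8 * ‖G‖)) ≤ 4 * ‖G‖ * (ε ^ 2 / (8 * ‖G‖)) := by gcongr
        _ = ε ^ 2 / 2 := by field_simp; norm_num
        _ < ε ^ 2 := by nlinarith [sq_pos_of_pos hε]
  have hlt : ENNReal.ofReal (2 * ‖G‖ - δ) < liminf (fun n => eLpNorm (h n + g) 2 ν) atTop := by
    refine lt_of_lt_of_le ?_ hfat
    rw [hadd']
    exact (ENNReal.ofReal_lt_ofReal_iff (by linarith)).2 (by linarith)
  have hev := eventually_lt_of_lt_liminf hlt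
  obtain ⟨n0, hn0⟩ := eventually_atTop.1 hev
  refine ⟨n0, fun n hn => ?_⟩
  have h1 := hn0 n hn
  rw [hadd, ENNReal.ofReal_lt_ofReal_iff_of_nonneg (by linarith)] at h1
  rw [dist_zero_right, Real.norm_eq_abs, abs_of_nonneg (norm_nonneg _)]
  refine lt_of_pow_lt_pow_left₀ 2 hε.le ?_
  have := hsq n
  nlinarith

lemma tendsto_eLpNorm_mollify_sub {f : E → ℝ} (hf : MemLp f 2 μ) :
    Tendsto (fun n => eLpNorm (mollify μ (mollifier μ n) f - f) 2 μ) atTop (𝓝 0) := by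
  have hloc : LocallyIntegrable f μ := hf.locallyIntegrable (by norm_num)
  refine tendsto_eLpNorm_sub_of_ae hf (fun n => ?_)
    (fun n => eLpNorm_mollify_mollifier_le hf.1 n) (ae_tendsto_mollify hloc)
  exact (contDiff_mollify (contDiff_mollifier n) (hasCompactSupport_mollifier n)
    hloc).continuous.aestronglyMeasurable

end Convolution

/-! ### Weak derivatives and the Sobolev norm at exponent two. -/

section WeakDeriv

variable {E₁ E₂ : Type*} [NormedAddCommGroup E₁] [NormedSpace ℝ E₁] [FiniteDimensional ℝ E₁]
  [MeasureSpace E₁] [BorelSpace E₁] [(volume : Measure E₁).IsAddHaarMeasure]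
  [NormedAddCommGroup E₂] [NormedSpace ℝ E₂] [FiniteDimensional ℝ E₂]
  [MeasureSpace E₂] [BorelSpace E₂] [(volume : Measure E₂).IsAddHaarMeasure]
  {d₁ d₂ : ℕ} {e₁ : Fin d₁ → E₁} {e₂ : Fin d₂ → E₂} {U : Set E₁} {V : Set E₂}
  {α : Fin d₁ → ℕ} {β : Fin d₂ → ℕ} {f g g' : E₁ × E₂ → ℝ}

instance : (volume : Measure (E₁ × E₂)).IsAddHaarMeasure :=
  inferInstanceAs ((volume : Measure E₁).prod (volume : Measure E₂)).IsAddHaarMeasure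

lemma IsWeakDeriv.aestronglyMeasurable (h : IsWeakDeriv e₁ e₂ U V α β f g) :
    AEStronglyMeasurable g (volume.restrict (U ×ˢ V)) :=
  h.2.1.aestronglyMeasurable

lemma integrable_mul_of_tsupport_subset {W : Set (E₁ × E₂)}
    (hg : LocallyIntegrableOn g W volume) {φ : E₁ × E₂ → ℝ} (h1 : Continuous φ)
    (h2 : HasCompactSupport φ) (h3 : tsupport φ ⊆ W) : Integrable (fun z => g z * φ z) := by
  have h := (hg.integrableOn_compact_subset h3 h2).mul_continuousOn h1.continuousOn h2
  refine (integrableOn_iff_integrable_of_support_subset fun z hz => ?_).1 h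
  exact subset_tsupport φ fun h0 => hz (by simp [h0])

lemma ae_eq_of_integral_mul_eq {W : Set (E₁ × E₂)} (hW : IsOpen W)
    (hg : LocallyIntegrableOn g W volume) (hg' : LocallyIntegrableOn g' W volume)
    (h : ∀ φ : E₁ × E₂ → ℝ, ContDiff ℝ ∞ φ → HasCompactSupport φ → tsupport φ ⊆ W →
      ∫ z in W, g z * φ z = ∫ z in W, g' z * φ z) :
    g =ᵐ[volume.restrict W] g' := by
  have key := hW.ae_eq_zero_of_integral_contDiff_smul_eq_zero (hg.sub hg') fun φ h1 h2 h3 => ?_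
  · rw [Filter.EventuallyEq, ae_restrict_iff' hW.measurableSet]
    filter_upwards [key] with z hz hzW
    exact sub_eq_zero.1 (hz hzW)
  · have hi : ∀ k : E₁ × E₂ → ℝ, LocallyIntegrableOn k W volume →
        IntegrableOn (fun z => φ z • k z) W volume := fun k hk => by
      simpa [mul_comm] using
        (integrable_mul_of_tsupport_subset hk h1.continuous h2 h3).integrableOn (s := W)
    have e1 : ∫ z, φ z • (g - g') z = ∫ z in W, φ z • (g - g') z := by
      refine (setIntegral_eq_integral_of_forall_compl_eq_zero fun z hz => ?_).symm
      rw [image_eq_zero_of_notMem_tsupport (fun hh => hz (h3 hh)), zero_smul]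
    rw [e1]
    have := h φ h1 h2 h3
    simp only [Pi.sub_apply, smul_sub]
    rw [integral_sub (hi g hg) (hi g' hg')]
    simp only [smul_eq_mul, mul_comm (φ _)]
    rw [this, sub_self]

lemma IsWeakDeriv.ae_eq (hU : IsOpen U) (hV : IsOpen V) (h : IsWeakDeriv e₁ e₂ U V α β f g)
    (h' : IsWeakDeriv e₁ e₂ U V α β f g') : g =ᵐ[volume.restrict (U ×ˢ V)] g' := by
  refine ae_eq_of_integral_mul_eq (hU.prod hV) h.2.1 h'.2.1 fun φ h1 h2 h3 => ?_
  have := (h.2.2 φ h1 h2 h3).symm.trans (h'.2.2 φ h1 h2 h3)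
  exact mul_left_cancel₀ (pow_ne_zero _ (by norm_num)) this

lemma IsWeakDeriv.mono {U' : Set E₁} {V' : Set E₂} (hU : U' ⊆ U) (hV : V' ⊆ V)
    (h : IsWeakDeriv e₁ e₂ U V α β f g) : IsWeakDeriv e₁ e₂ U' V' α β f g := by
  have hs : U' ×ˢ V' ⊆ U ×ˢ V := Set.prod_mono hU hV
  refine ⟨h.1.mono_set hs, h.2.1.mono_set hs, fun φ h1 h2 h3 => ?_⟩
  have key := h.2.2 φ h1 h2 (h3.trans hs)
  have hz : ∀ z ∉ U' ×ˢ V', φ z = 0 := fun z hz =>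
    image_eq_zero_of_notMem_tsupport fun hh => hz (h3 hh)
  have hz' : ∀ z ∉ U' ×ˢ V', mixedDeriv e₁ e₂ α β φ z = 0 := fun z hz => by
    rw [mixedDeriv_eq_listDeriv]
    exact image_eq_zero_of_notMem_tsupport fun hh => hz (h3 (tsupport_listDeriv_subset _ _ hh))
  rw [setIntegral_eq_integral_of_forall_compl_eq_zero
      (fun z hh => by rw [hz' z (fun h => hh (hs h)), mul_zero]),
    setIntegral_eq_integral_of_forall_compl_eq_zero
      (fun z hh => by rw [hz z (fun h => hh (hs h)), mul_zero])] at key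
  rw [setIntegral_eq_integral_of_forall_compl_eq_zero (fun z hh => by rw [hz' z hh, mul_zero]),
    setIntegral_eq_integral_of_forall_compl_eq_zero (fun z hh => by rw [hz z hh, mul_zero])]
  exact key

lemma IsWeakDeriv.sub {f' : E₁ × E₂ → ℝ} (h : IsWeakDeriv e₁ e₂ U V α β f g) (h' : IsWeakDeriv e₁ e₂ U V α β f' g') :
    IsWeakDeriv e₁ e₂ U V α β (fun z => f z - f' z) (fun z => g z - g' z) := by
  refine ⟨h.1.sub h'.1, h.2.1.sub h'.2.1, fun φ h1 h2 h3 => ?_⟩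
  have hm := contDiff_listDeriv h1 (mixedList e₁ e₂ α β)
  have hmc := hasCompactSupport_listDeriv h2 (mixedList e₁ e₂ α β)
  have hms := (tsupport_listDeriv_subset (mixedList e₁ e₂ α β) φ).trans h3
  have a1 := h.2.2 φ h1 h2 h3
  have a2 := h'.2.2 φ h1 h2 h3
  rw [mixedDeriv_eq_listDeriv] at a1 a2 ⊢
  simp only [sub_mul]
  rw [integral_sub (integrable_mul_of_tsupport_subset h.1 hm.continuous hmc hms).integrableOn
      (integrable_mul_of_tsupport_subset h'.1 hm.continuous hmc hms).integrableOn,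
    integral_sub (integrable_mul_of_tsupport_subset h.2.1 h1.continuous h2 h3).integrableOn
      (integrable_mul_of_tsupport_subset h'.2.1 h1.continuous h2 h3).integrableOn, a1, a2]
  ring

lemma IsWeakDeriv.sum {ι : Type*} (s : Finset ι) (a : ι → ℝ) {f g : ι → E₁ × E₂ → ℝ}
    (hU : IsOpen U) (hV : IsOpen V) (h : ∀ i ∈ s, IsWeakDeriv e₁ e₂ U V α β (f i) (g i)) :
    IsWeakDeriv e₁ e₂ U V α β (fun z => ∑ i ∈ s, a i * f i z) (fun z => ∑ i ∈ s, a i * g i z) := by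
  have hl : ∀ k : ι → E₁ × E₂ → ℝ, (∀ i ∈ s, LocallyIntegrableOn (k i) (U ×ˢ V) volume) →
      LocallyIntegrableOn (fun z => ∑ i ∈ s, a i * k i z) (U ×ˢ V) volume := by
    intro k hk
    rw [locallyIntegrableOn_iff (hU.prod hV).isLocallyClosed]
    intro K hK hKc
    refine integrable_finsetSum _ fun i hi => ?_
    exact ((locallyIntegrableOn_iff (hU.prod hV).isLocallyClosed).1 (hk i hi) K hK hKc).const_mul _
  refine ⟨hl f fun i hi => (h i hi).1, hl g fun i hi => (h i hi).2.1, fun φ h1 h2 h3 => ?_⟩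
  have hm := contDiff_listDeriv h1 (mixedList e₁ e₂ α β)
  have hmc := hasCompactSupport_listDeriv h2 (mixedList e₁ e₂ α β)
  have hms := (tsupport_listDeriv_subset (mixedList e₁ e₂ α β) φ).trans h3
  rw [mixedDeriv_eq_listDeriv]
  simp only [Finset.sum_mul, mul_assoc]
  rw [integral_finsetSum, integral_finsetSum, Finset.mul_sum]
  · refine Finset.sum_congr rfl fun i hi => ?_
    have a1 := (h i hi).2.2 φ h1 h2 h3
    rw [mixedDeriv_eq_listDeriv] at a1
    rw [integral_const_mul, integral_const_mul, a1]
    ring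
  · exact fun i hi => (integrable_mul_of_tsupport_subset (h i hi).2.1 h1.continuous
      h2 h3).integrableOn.const_mul _
  · exact fun i hi => (integrable_mul_of_tsupport_subset (h i hi).1 hm.continuous
      hmc hms).integrableOn.const_mul _

lemma isWeakDeriv_zero (hf : LocallyIntegrableOn f (U ×ˢ V) volume) :
    IsWeakDeriv e₁ e₂ U V 0 0 f f := by
  refine ⟨hf, hf, fun φ _ _ _ => ?_⟩
  have : mixedList e₁ e₂ 0 0 = [] := List.eq_nil_of_length_eq_zero (by simp [length_mixedList])
  rw [mixedDeriv_eq_listDeriv, this]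
  simp

/-- A smooth function has weak derivatives, given by its classical derivatives. -/
lemma isWeakDeriv_of_contDiff (hf : ContDiff ℝ ∞ f) :
    IsWeakDeriv e₁ e₂ U V α β f (mixedDeriv e₁ e₂ α β f) := by
  rw [mixedDeriv_eq_listDeriv]
  refine ⟨hf.continuous.locallyIntegrable.locallyIntegrableOn _,
    (contDiff_listDeriv hf _).continuous.locallyIntegrable.locallyIntegrableOn _,
    fun φ h1 h2 h3 => ?_⟩
  have hz : ∀ z ∉ U ×ˢ V, φ z = 0 := fun z hz =>
    image_eq_zero_of_notMem_tsupport fun hh => hz (h3 hh)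
  have hz' : ∀ z ∉ U ×ˢ V, listDeriv (mixedList e₁ e₂ α β) φ z = 0 := fun z hz =>
    image_eq_zero_of_notMem_tsupport fun hh => hz (h3 (tsupport_listDeriv_subset _ _ hh))
  rw [mixedDeriv_eq_listDeriv]
  rw [setIntegral_eq_integral_of_forall_compl_eq_zero (fun z hh => by rw [hz' z hh, mul_zero]),
    setIntegral_eq_integral_of_forall_compl_eq_zero (fun z hh => by rw [hz z hh, mul_zero]),
    integral_mul_listDeriv _ hf h1 h2, length_mixedList]

lemma mixedLpNorm_two (hg : AEStronglyMeasurable g (volume.restrict (U ×ˢ V))) :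
    mixedLpNorm 2 2 U V g = eLpNorm g 2 (volume.restrict (U ×ˢ V)) := by
  rw [mixedLpNorm]
  simp only [eLpNorm_eq_lintegral_rpow_enorm_toReal (p := 2) (by norm_num) (by norm_num),
    ENNReal.toReal_ofNat, enorm_eq_self]
  congr 1
  rw [Measure.volume_eq_prod, ← Measure.prod_restrict, lintegral_prod]
  · refine lintegral_congr fun x => ?_
    rw [← ENNReal.rpow_mul]; norm_num
  · rw [Measure.prod_restrict]
    exact hg.aemeasurable.enorm.pow_const _

lemma memBochnerSobolev_two_of_memLp {m n : ℕ} {g : (Fin d₁ → ℕ) → (Fin d₂ → ℕ) → E₁ × E₂ → ℝ}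
    (hg : ∀ α ∈ multiIndices d₁ m, ∀ β ∈ multiIndices d₂ n,
      IsWeakDeriv e₁ e₂ U V α β f (g α β) ∧ MemLp (g α β) 2 (volume.restrict (U ×ˢ V))) :
    MemBochnerSobolev e₁ e₂ m n 2 2 (fun _ => 1) U V f := by
  intro α hα β hβ
  refine ⟨g α β, (hg α hα β hβ).1, ?_⟩
  simp only [one_mul]
  rw [mixedLpNorm_two (hg α hα β hβ).2.1]
  exact (hg α hα β hβ).2.2

lemma MemBochnerSobolev.exists_memLp {m n : ℕ}
    (h : MemBochnerSobolev e₁ e₂ m n 2 2 (fun _ => 1) U V f) :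
    ∃ g : (Fin d₁ → ℕ) → (Fin d₂ → ℕ) → E₁ × E₂ → ℝ,
      ∀ α ∈ multiIndices d₁ m, ∀ β ∈ multiIndices d₂ n,
      IsWeakDeriv e₁ e₂ U V α β f (g α β) ∧ MemLp (g α β) 2 (volume.restrict (U ×ˢ V)) := by
  choose! g hg using h
  refine ⟨g, fun α hα β hβ => ⟨(hg α hα β hβ).1, (hg α hα β hβ).1.aestronglyMeasurable, ?_⟩⟩
  have := (hg α hα β hβ).2
  simp only [one_mul] at this
  rwa [mixedLpNorm_two (hg α hα β hβ).1.aestronglyMeasurable] at this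

/-- Weak derivatives are unique almost everywhere, so the chosen representatives may be replaced by
any others. For p = q = 2 the inner power p/q is 1, and Tonelli merges the iterated integrals. -/
lemma bochnerSobolevNorm_two {m n : ℕ} {g : (Fin d₁ → ℕ) → (Fin d₂ → ℕ) → E₁ × E₂ → ℝ}
    (hU : IsOpen U) (hV : IsOpen V)
    (hg : ∀ α ∈ multiIndices d₁ m, ∀ β ∈ multiIndices d₂ n,
      IsWeakDeriv e₁ e₂ U V α β f (g α β) ∧ MemLp (g α β) 2 (volume.restrict (U ×ˢ V))) :
    bochnerSobolevNorm e₁ e₂ m n 2 2 U V f =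
      (∑ α ∈ multiIndices d₁ m, ∑ β ∈ multiIndices d₂ n,
        eLpNorm (g α β) 2 (volume.restrict (U ×ˢ V)) ^ (2 : ℝ)) ^ (1 / 2 : ℝ) := by
  have hmem := memBochnerSobolev_two_of_memLp hg
  rw [bochnerSobolevNorm, if_pos hmem]
  have hprod : (volume : Measure (E₁ × E₂)).restrict (U ×ˢ V) =
      (volume.restrict U).prod (volume.restrict V) := by
    rw [Measure.volume_eq_prod, Measure.prod_restrict]
  have hw : ∀ α ∈ multiIndices d₁ m, ∀ β ∈ multiIndices d₂ n,
      weakDeriv e₁ e₂ U V α β f =ᵐ[volume.restrict (U ×ˢ V)] g α β := by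
    intro α hα β hβ
    have hex : ∃ g, IsWeakDeriv e₁ e₂ U V α β f g := ⟨_, (hg α hα β hβ).1⟩
    rw [weakDeriv, dif_pos hex]
    exact hex.choose_spec.ae_eq hU hV (hg α hα β hβ).1
  have hwm : ∀ α ∈ multiIndices d₁ m, ∀ β ∈ multiIndices d₂ n,
      AEMeasurable (weakDeriv e₁ e₂ U V α β f) (volume.restrict (U ×ˢ V)) := fun α hα β hβ =>
    ((hg α hα β hβ).2.1.aemeasurable).congr (hw α hα β hβ).symm
  simp only [ENNReal.toReal_ofNat]
  congr 1
  refine Finset.sum_congr rfl fun α hα => ?_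
  have h1 : ∀ᵐ x ∂(volume.restrict U : Measure E₁), ∀ β ∈ multiIndices d₂ n,
      AEMeasurable (fun y => ‖weakDeriv e₁ e₂ U V α β f (x, y)‖ₑ ^ (2 : ℝ))
        (volume.restrict V) := by
    rw [Filter.eventually_all_finset]
    intro β hβ
    have hm := hwm α hα β hβ
    rw [hprod] at hm
    filter_upwards [hm.aestronglyMeasurable.prodMk_left] with x hx
    exact hx.aemeasurable.enorm.pow_const _
  have hm2 : ∀ β ∈ multiIndices d₂ n, AEMeasurable
      (fun z => ‖weakDeriv e₁ e₂ U V α β f z‖ₑ ^ (2 : ℝ))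
        ((volume.restrict U).prod (volume.restrict V)) := by
    intro β hβ
    have hm := hwm α hα β hβ
    rw [hprod] at hm
    exact hm.enorm.pow_const _
  calc _ = ∫⁻ x in U, ∑ β ∈ multiIndices d₂ n,
        ∫⁻ y in V, ‖weakDeriv e₁ e₂ U V α β f (x, y)‖ₑ ^ (2 : ℝ) := by
        refine lintegral_congr fun x => ?_
        rw [div_self (by norm_num), ENNReal.rpow_one]
    _ = ∑ β ∈ multiIndices d₂ n, ∫⁻ x in U,
        ∫⁻ y in V, ‖weakDeriv e₁ e₂ U V α β f (x, y)‖ₑ ^ (2 : ℝ) :=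
        lintegral_finsetSum' _ fun β hβ => (hm2 β hβ).lintegral_prod_right'
    _ = _ := by
        refine Finset.sum_congr rfl fun β hβ => ?_
        rw [← lintegral_prod _ (hm2 β hβ), ← hprod,
          eLpNorm_eq_lintegral_rpow_enorm_toReal (by norm_num) (by norm_num), ← ENNReal.rpow_mul]
        simp only [ENNReal.toReal_ofNat]
        rw [one_div_mul_cancel (by norm_num), ENNReal.rpow_one]
        refine lintegral_congr_ae ?_
        filter_upwards [hw α hα β hβ] with z hz
        rw [hz]

/-- Iterated essential suprema bound the function for almost every x and then almost every y.
Passing to almost every (x, y) needs a measurable exceptional set, hence the detour through the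
representative `hg.mk k`. -/
lemma ae_abs_le_of_mixedLpNorm_top_lt_top {w : E₁ × E₂ → ℝ}
    (hg : AEStronglyMeasurable (fun z => w z * g z) volume)
    (h : mixedLpNorm ⊤ ⊤ Set.univ Set.univ (fun z => w z * g z) < ⊤) :
    ∃ B : ℝ, ∀ᵐ z, |w z * g z| ≤ B := by
  simp only [mixedLpNorm, Measure.restrict_univ] at h
  set k := fun z => w z * g z
  set B := eLpNorm (fun x => eLpNorm (fun y => k (x, y)) ⊤ volume) ⊤ volume with hB
  refine ⟨B.toReal, ?_⟩
  have hk' : k =ᵐ[volume] hg.mk k := hg.ae_eq_mk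
  suffices H : ∀ᵐ z, |hg.mk k z| ≤ B.toReal by
    filter_upwards [H, hk'] with z h1 h2
    rw [← h2] at h1
    exact h1
  have hms : MeasurableSet {z | |hg.mk k z| ≤ B.toReal} :=
    measurableSet_le hg.stronglyMeasurable_mk.measurable.abs measurable_const
  refine (Measure.ae_prod_iff_ae_ae hms).2 ?_
  filter_upwards [Measure.ae_ae_of_ae_prod hk',
    enorm_ae_le_eLpNormEssSup (fun x => eLpNorm (fun y => k (x, y)) ⊤ volume) volume] with x h1 h2
  rw [← eLpNorm_exponent_top, ← hB, enorm_eq_self] at h2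
  filter_upwards [h1, enorm_ae_le_eLpNormEssSup (fun y => k (x, y)) volume] with y h3 h4
  rw [← eLpNorm_exponent_top] at h4
  rw [← h3, ← Real.norm_eq_abs, ← toReal_enorm]
  exact ENNReal.toReal_mono h.ne (h4.trans h2)

end WeakDeriv

/-! ### Weak derivatives of neurons. -/

section Neuron

open Filter Topology

/-- The linear part of the argument of a neuron, `(x, y) ↦ (ξ₁ · x, ξ₂ · y)`. -/
def pairing {E₁ E₂ : Type*} [NormedAddCommGroup E₁] [InnerProductSpace ℝ E₁]
    [NormedAddCommGroup E₂] [InnerProductSpace ℝ E₂] (ξ : E₁ × E₂) : E₁ × E₂ →L[ℝ] ℝ × ℝ :=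
  ((innerSL ℝ ξ.1).comp (ContinuousLinearMap.fst ℝ E₁ E₂)).prod
    ((innerSL ℝ ξ.2).comp (ContinuousLinearMap.snd ℝ E₁ E₂))

lemma pairing_apply {E₁ E₂ : Type*} [NormedAddCommGroup E₁] [InnerProductSpace ℝ E₁]
    [NormedAddCommGroup E₂] [InnerProductSpace ℝ E₂] (ξ z : E₁ × E₂) :
    pairing ξ z = (inner ℝ ξ.1 z.1, inner ℝ ξ.2 z.2) := rfl

variable {d₁ d₂ : ℕ} {ξ : EuclideanSpace ℝ (Fin d₁) × EuclideanSpace ℝ (Fin d₂)}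

lemma neuron_eq (σ : ℝ × ℝ → ℝ) (ξ : EuclideanSpace ℝ (Fin d₁) × EuclideanSpace ℝ (Fin d₂))
    (b : ℝ × ℝ) : neuron σ ξ b = fun z => σ (pairing ξ z + b) := rfl

/-- With both weights nonzero the linear part is onto ℝ², so Lebesgue measure is pushed to a
(possibly infinite) multiple of Lebesgue measure. Null sets thus pull back to null sets, and
composing almost everywhere defined derivatives of σ makes sense. -/
lemma quasiMeasurePreserving_pairing (h₁ : ξ.1 ≠ 0) (h₂ : ξ.2 ≠ 0) (b : ℝ × ℝ) :
    Measure.QuasiMeasurePreserving (fun z => pairing ξ z + b) volume volume := by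
  have hs : Function.Surjective (pairing ξ).toLinearMap := by
    rintro ⟨s, t⟩
    refine ⟨((s / ‖ξ.1‖ ^ 2) • ξ.1, (t / ‖ξ.2‖ ^ 2) • ξ.2), ?_⟩
    have n1 : ‖ξ.1‖ ≠ 0 := norm_ne_zero_iff.2 h₁
    have n2 : ‖ξ.2‖ ≠ 0 := norm_ne_zero_iff.2 h₂
    simp only [ContinuousLinearMap.coe_coe, pairing_apply, real_inner_smul_right,
      real_inner_self_eq_norm_sq]
    rw [div_mul_cancel₀ _ (pow_ne_zero 2 n1), div_mul_cancel₀ _ (pow_ne_zero 2 n2)]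
  obtain ⟨c, -, hc⟩ := (pairing ξ).toLinearMap.exists_map_addHaar_eq_smul_addHaar volume volume hs
  have h1 : Measure.QuasiMeasurePreserving (pairing ξ) volume volume := by
    refine ⟨(pairing ξ).continuous.measurable, ?_⟩
    have : Measure.map (pairing ξ) volume = c • (volume : Measure (ℝ × ℝ)) := hc
    rw [this]
    exact Measure.smul_absolutelyContinuous
  exact ((measurePreserving_add_right (volume : Measure (ℝ × ℝ)) b).quasiMeasurePreserving).comp h1

/-- The factor `ξ₁^α ξ₂^β` of the chain rule for neurons. -/
def monomial (ξ : EuclideanSpace ℝ (Fin d₁) × EuclideanSpace ℝ (Fin d₂)) (α : Fin d₁ → ℕ)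
    (β : Fin d₂ → ℕ) : ℝ := (∏ i, ξ.1 i ^ α i) * ∏ j, ξ.2 j ^ β j

lemma listDeriv_neuron (α : Fin d₁ → ℕ) (β : Fin d₂ → ℕ) (b : ℝ × ℝ) {s : ℝ × ℝ → ℝ}
    (hs : ContDiff ℝ ∞ s) :
    listDeriv (mixedList (stdDir d₁) (stdDir d₂) α β) (fun z => s (pairing ξ z + b)) =
      fun z => monomial ξ α β *
        listDeriv (mixedList realDir realDir (fun _ => ∑ i, α i) (fun _ => ∑ j, β j)) s
          (pairing ξ z + b) := by
  rw [listDeriv_comp_affine _ _ _ hs]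
  -- The i-th coordinate direction is mapped to the scalar `c i` times the basis vector `v i` of ℝ².
  -- The scalars multiply up to the monomial, and the basis vectors give the derivative of s.
  set l : List (Fin d₁ ⊕ Fin d₂) := dirList Sum.inl α ++ dirList Sum.inr β with hl
  set c : Fin d₁ ⊕ Fin d₂ → ℝ := Sum.elim (fun i => ξ.1 i) (fun j => ξ.2 j) with hc
  set v : Fin d₁ ⊕ Fin d₂ → ℝ × ℝ := Sum.elim (fun _ => (1, 0)) (fun _ => (0, 1)) with hv
  have h1 : (mixedList (stdDir d₁) (stdDir d₂) α β).map (pairing ξ) =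
      l.map fun i => c i • v i := by
    rw [mixedList, hl, List.map_append, List.map_append, dirList_map, dirList_map, dirList_map,
      dirList_map]
    congr 2
    · funext i
      simp [c, v, pairing_apply, stdDir, EuclideanSpace.inner_single_right]
    · funext i
      simp [c, v, pairing_apply, stdDir, EuclideanSpace.inner_single_right]
  have h2 : l.map v = mixedList realDir realDir (fun _ => ∑ i, α i) (fun _ => ∑ j, β j) := by
    rw [mixedList, hl, List.map_append, dirList_map, dirList_map]
    simp only [hv, Sum.elim_comp_inl, Sum.elim_comp_inr, realDir, dirList_const]
    simp
  have h3 : (l.map c).prod = monomial ξ α β := by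
    rw [hl, List.map_append, List.prod_append, prod_map_dirList, prod_map_dirList]
    rfl
  funext z
  rw [h1, listDeriv_map_smul c v l hs, h2, h3]

lemma locallyIntegrable_of_ae_abs_le {E : Type*} [NormedAddCommGroup E] [MeasurableSpace E]
    {μ : Measure E} [IsLocallyFiniteMeasure μ] {f : E → ℝ} {B : ℝ}
    (hf : AEStronglyMeasurable f μ) (hB : ∀ᵐ z ∂μ, |f z| ≤ B) : LocallyIntegrable f μ :=
  (locallyIntegrable_const B).mono hf (hB.mono fun z hz => by
    rw [Real.norm_eq_abs]; exact hz.trans (le_abs_self B))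

/-- The chain rule for weak derivatives of neurons. -/
lemma isWeakDeriv_neuron {σ s : ℝ × ℝ → ℝ} {B : ℝ} {α : Fin d₁ → ℕ} {β : Fin d₂ → ℕ}
    (hs : IsWeakDeriv realDir realDir Set.univ Set.univ (fun _ => ∑ i, α i) (fun _ => ∑ j, β j) σ s)
    (hσB : ∀ᵐ t, |σ t| ≤ B) (hsB : ∀ᵐ t, |s t| ≤ B) (h₁ : ξ.1 ≠ 0) (h₂ : ξ.2 ≠ 0) (b : ℝ × ℝ)
    (U : Set (EuclideanSpace ℝ (Fin d₁))) (V : Set (EuclideanSpace ℝ (Fin d₂))) :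
    IsWeakDeriv (stdDir d₁) (stdDir d₂) U V α β (neuron σ ξ b)
      (fun z => monomial ξ α β * s (pairing ξ z + b)) := by
  refine IsWeakDeriv.mono (Set.subset_univ U) (Set.subset_univ V) ?_
  have hq := quasiMeasurePreserving_pairing h₁ h₂ b
  rw [neuron_eq]
  have hσl : LocallyIntegrable σ volume := by
    simpa [locallyIntegrableOn_univ] using hs.1
  have hsl : LocallyIntegrable s volume := by
    simpa [locallyIntegrableOn_univ] using hs.2.1
  have hl : ∀ k : ℝ × ℝ → ℝ, LocallyIntegrable k volume → (∀ᵐ t, |k t| ≤ B) →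
      LocallyIntegrable (fun z => k (pairing ξ z + b)) volume := fun k hk hkB =>
    locallyIntegrable_of_ae_abs_le (hk.aestronglyMeasurable.comp_quasiMeasurePreserving hq)
      (hq.ae hkB)
  refine ⟨(hl σ hσl hσB).locallyIntegrableOn _,
    ((hl s hsl hsB).smul (monomial ξ α β)).locallyIntegrableOn _, fun φ h1 h2 _ => ?_⟩
  simp only [Set.univ_prod_univ, Measure.restrict_univ, mixedDeriv_eq_listDeriv]
  set L := mixedList (stdDir d₁) (stdDir d₂) α β with hL
  set n := ∑ i, α i + ∑ j, β j with hn
  have hLn : L.length = n := length_mixedList _ _ _ _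
  -- The chain rule is proved for mollified activations and passed to the limit by dominated
  -- convergence. Almost everywhere convergence on ℝ² transfers to the neuron because null sets pull
  -- back to null sets.
  have hlim : ∀ k : ℝ × ℝ → ℝ, LocallyIntegrable k volume → (∀ᵐ t, |k t| ≤ B) →
      ∀ χ : EuclideanSpace ℝ (Fin d₁) × EuclideanSpace ℝ (Fin d₂) → ℝ, Continuous χ →
      HasCompactSupport χ →
      Tendsto (fun m => ∫ z, mollify volume (mollifier volume m) k (pairing ξ z + b) * χ z) atTop
        (𝓝 (∫ z, k (pairing ξ z + b) * χ z)) := by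
    intro k hk hkB χ hχ hχc
    refine tendsto_integral_of_dominated_convergence (fun z => B * ‖χ z‖) (fun m => ?_)
      ((hχ.norm.integrable_of_hasCompactSupport hχc.norm).const_mul B) (fun m => ?_) ?_
    · exact (((contDiff_mollify (contDiff_mollifier m) (hasCompactSupport_mollifier m)
        hk).continuous.comp ((pairing ξ).continuous.add continuous_const)).mul
        hχ).aestronglyMeasurable
    · refine Eventually.of_forall fun z => ?_
      rw [norm_mul]
      exact mul_le_mul_of_nonneg_right (abs_mollify_mollifier_le hkB m _) (norm_nonneg _)
    · filter_upwards [hq.ae (ae_tendsto_mollify hk)] with z hz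
      exact hz.mul_const _
  have hA := hlim σ hσl hσB (listDeriv L φ) (contDiff_listDeriv h1 L).continuous
    (hasCompactSupport_listDeriv h2 L)
  have hB := ((hlim s hsl hsB φ h1.continuous h2).const_mul (monomial ξ α β)).const_mul
    ((-1 : ℝ) ^ n)
  have heq : ∀ m, ∫ z, mollify volume (mollifier volume m) σ (pairing ξ z + b) * listDeriv L φ z =
      (-1 : ℝ) ^ n * (monomial ξ α β *
        ∫ z, mollify volume (mollifier volume m) s (pairing ξ z + b) * φ z) := by
    intro m
    have hsm := contDiff_mollify (contDiff_mollifier (μ := (volume : Measure (ℝ × ℝ))) m)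
      (hasCompactSupport_mollifier m) hσl
    have hsm' : ContDiff ℝ ∞ fun z => mollify volume (mollifier volume m) σ (pairing ξ z + b) :=
      hsm.comp ((pairing ξ).contDiff.add contDiff_const)
    rw [integral_mul_listDeriv L hsm' h1 h2, hLn, ← integral_const_mul (monomial ξ α β)]
    congr 1
    refine integral_congr_ae (Eventually.of_forall fun z => ?_)
    have e1 := congrFun (listDeriv_neuron (ξ := ξ) α β b hsm) z
    have e2 := listDeriv_mollify_of_weak
      (mixedList realDir realDir (fun _ => ∑ i, α i) (fun _ => ∑ j, β j))
      (contDiff_mollifier (μ := (volume : Measure (ℝ × ℝ))) m) (hasCompactSupport_mollifier m) hσl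
      (g := s) (fun φ g1 g2 => by
        have := hs.2.2 φ g1 g2 (by simp)
        simpa [mixedDeriv_eq_listDeriv, length_mixedList] using this)
    rw [e2] at e1
    beta_reduce
    rw [hL, e1]
    ring
  have := tendsto_nhds_unique (hA.congr heq) hB
  rw [this, ← integral_const_mul (monomial ξ α β)]
  congr 1
  refine integral_congr_ae (Eventually.of_forall fun z => ?_)
  simp only []
  ring

end Neuron

/-! ### The Fourier transform on a product of two blocks. -/

section Fourier

open Filter Topology FourierTransform

/-- The character `s ↦ exp(2πis)`. -/
def char (s : ℝ) : ℂ := (Real.fourierChar s : ℂ)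

lemma char_add (s t : ℝ) : char (s + t) = char s * char t := by
  simp [char, AddChar.map_add_eq_mul]

@[simp] lemma char_zero : char 0 = 1 := by simp [char]

@[simp] lemma norm_char (s : ℝ) : ‖char s‖ = 1 := Circle.norm_coe _

lemma continuous_char : Continuous char :=
  continuous_subtype_val.comp Real.continuous_fourierChar

lemma hasDerivAt_char (s : ℝ) : HasDerivAt char (2 * Real.pi * Complex.I * char s) s :=
  Real.hasDerivAt_fourierChar s

variable {E₁ E₂ : Type*} [NormedAddCommGroup E₁] [InnerProductSpace ℝ E₁] [FiniteDimensional ℝ E₁]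
  [MeasurableSpace E₁] [BorelSpace E₁]
  [NormedAddCommGroup E₂] [InnerProductSpace ℝ E₂] [FiniteDimensional ℝ E₂]
  [MeasurableSpace E₂] [BorelSpace E₂]

/-- The scalar product of the product of two inner product spaces. -/
def dot (κ z : E₁ × E₂) : ℝ := inner ℝ κ.1 z.1 + inner ℝ κ.2 z.2

lemma continuous_dot : Continuous fun p : (E₁ × E₂) × (E₁ × E₂) => dot p.1 p.2 := by
  unfold dot; fun_prop

/-- The Fourier transform on the product of two inner product spaces. -/
def ft (F : E₁ × E₂ → ℝ) (κ : E₁ × E₂) : ℂ := ∫ z, char (-dot κ z) * (F z : ℂ)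

/-- A test function, transported to the inner product space `WithLp 2 (E₁ × E₂)`. -/
def toWithLp (F : E₁ × E₂ → ℝ) : WithLp 2 (E₁ × E₂) → ℂ := fun w => (F (WithLp.ofLp w) : ℂ)

/-- The product carries the maximum norm and is no inner product space. Through this
volume-preserving identification, Fourier inversion and Plancherel are imported from `WithLp 2 (E₁ ×
E₂)`. -/
lemma integral_withLp (G : WithLp 2 (E₁ × E₂) → ℂ) :
    ∫ w, G w = ∫ z : E₁ × E₂, G (WithLp.toLp 2 z) :=
  ((WithLp.volume_preserving_toLp E₁ E₂).integral_comp
    ((MeasurableEquiv.toLp 2 (E₁ × E₂)).measurableEmbedding) G).symm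

lemma lintegral_withLp (G : WithLp 2 (E₁ × E₂) → ℝ≥0∞) :
    ∫⁻ w, G w = ∫⁻ z : E₁ × E₂, G (WithLp.toLp 2 z) :=
  ((WithLp.volume_preserving_toLp E₁ E₂).lintegral_comp_emb
    ((MeasurableEquiv.toLp 2 (E₁ × E₂)).measurableEmbedding) G).symm

lemma ft_eq_fourier (F : E₁ × E₂ → ℝ) (κ : E₁ × E₂) :
    ft F κ = 𝓕 (toWithLp F) (WithLp.toLp 2 κ) := by
  rw [Real.fourier_eq, integral_withLp]
  refine integral_congr_ae (Eventually.of_forall fun z => ?_)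
  simp only [toWithLp, Circle.smul_def, smul_eq_mul, char, dot, WithLp.prod_inner_apply]
  rw [real_inner_comm, real_inner_comm z.2]

variable {F : E₁ × E₂ → ℝ}

lemma exists_schwartz (hF : ContDiff ℝ ∞ F) (hFc : HasCompactSupport F) :
    ∃ S : SchwartzMap (WithLp 2 (E₁ × E₂)) ℂ, (S : WithLp 2 (E₁ × E₂) → ℂ) = toWithLp F := by
  have h1 : ContDiff ℝ ∞ (toWithLp F) := by
    have := Complex.ofRealCLM.contDiff.comp
      (hF.comp (WithLp.prodContinuousLinearEquiv 2 ℝ E₁ E₂).contDiff)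
    exact this
  have h2 : HasCompactSupport (toWithLp F) := by
    have h3 := hFc.comp_homeomorph (WithLp.prodContinuousLinearEquiv 2 ℝ E₁ E₂).toHomeomorph
    exact h3.comp_left (g := fun x : ℝ => (x : ℂ)) (by simp)
  exact ⟨h2.toSchwartzMap h1, rfl⟩

lemma exists_schwartz_ft (hF : ContDiff ℝ ∞ F) (hFc : HasCompactSupport F) :
    ∃ S : SchwartzMap (WithLp 2 (E₁ × E₂)) ℂ, ∀ κ, ft F κ = S (WithLp.toLp 2 κ) := by
  obtain ⟨S, hS⟩ := exists_schwartz hF hFc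
  refine ⟨𝓕 S, fun κ => ?_⟩
  rw [ft_eq_fourier, SchwartzMap.fourier_coe, hS]

lemma continuous_ft (hF : ContDiff ℝ ∞ F) (hFc : HasCompactSupport F) : Continuous (ft F) := by
  obtain ⟨S, hS⟩ := exists_schwartz_ft hF hFc
  rw [funext hS]
  exact S.continuous.comp (WithLp.prodContinuousLinearEquiv 2 ℝ E₁ E₂).symm.continuous

lemma exists_norm_ft_le (hF : ContDiff ℝ ∞ F) (hFc : HasCompactSupport F) (k : ℕ) :
    ∃ C : ℝ, 0 ≤ C ∧ ∀ κ, (1 + ‖κ‖) ^ k * ‖ft F κ‖ ≤ C := by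
  obtain ⟨S, hS⟩ := exists_schwartz_ft hF hFc
  refine ⟨2 ^ k * (Finset.Iic (k, 0)).sup (schwartzSeminormFamily ℝ _ ℂ) S, by positivity,
    fun κ => ?_⟩
  have h := SchwartzMap.one_add_le_sup_seminorm_apply (𝕜 := ℝ) (m := (k, 0)) le_rfl le_rfl S
    (WithLp.toLp 2 κ)
  rw [norm_iteratedFDeriv_zero] at h
  refine le_trans ?_ h
  rw [hS]
  have : ‖κ‖ ≤ ‖WithLp.toLp 2 κ‖ := by
    rw [Prod.norm_def, WithLp.prod_norm_eq_of_L2]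
    refine max_le ?_ ?_ <;> refine Real.le_sqrt_of_sq_le ?_ <;> simp
  gcongr

lemma integrable_ft_mul (hF : ContDiff ℝ ∞ F) (hFc : HasCompactSupport F) (k : ℕ) :
    Integrable fun κ => (1 + ‖κ‖) ^ k * ‖ft F κ‖ := by
  -- One power more than the dimension leaves an integrable factor after the Schwartz bound.
  set r := Module.finrank ℝ (E₁ × E₂) + 1 with hr
  obtain ⟨C, hC, h⟩ := exists_norm_ft_le hF hFc (k + r)
  have hi : Integrable (fun κ : E₁ × E₂ => C * (1 + ‖κ‖) ^ (-(r : ℝ))) :=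
    (integrable_one_add_norm (by rw [hr]; push_cast; linarith)).const_mul C
  refine hi.mono' ?_ (Eventually.of_forall fun κ => ?_)
  · exact (((continuous_const.add continuous_norm).pow k).mul
      (continuous_ft hF hFc).norm).aestronglyMeasurable
  · rw [Real.norm_of_nonneg (by positivity), Real.rpow_neg (by positivity), Real.rpow_natCast,
      ← div_eq_mul_inv, le_div_iff₀ (by positivity)]
    refine le_trans (le_of_eq ?_) (h κ)
    ring

lemma integrable_ft (hF : ContDiff ℝ ∞ F) (hFc : HasCompactSupport F) : Integrable (ft F) := by
  have h := integrable_ft_mul hF hFc 0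
  simp only [pow_zero, one_mul] at h
  exact (integrable_norm_iff (continuous_ft hF hFc).aestronglyMeasurable).1 h

lemma ft_inversion (hF : ContDiff ℝ ∞ F) (hFc : HasCompactSupport F) (z : E₁ × E₂) :
    (F z : ℂ) = ∫ κ, char (dot κ z) * ft F κ := by
  obtain ⟨S, hS⟩ := exists_schwartz hF hFc
  have h1 : 𝓕⁻ (𝓕 (S : WithLp 2 (E₁ × E₂) → ℂ)) (WithLp.toLp 2 z) = S (WithLp.toLp 2 z) := by
    refine S.integrable.fourierInv_fourier_eq ?_ S.continuous.continuousAt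
    rw [← SchwartzMap.fourier_coe]
    exact (𝓕 S).integrable
  rw [hS, Real.fourierInv_eq, integral_withLp] at h1
  rw [show (F z : ℂ) = toWithLp F (WithLp.toLp 2 z) from rfl, ← h1]
  refine integral_congr_ae (Eventually.of_forall fun κ => ?_)
  simp only [← ft_eq_fourier, Circle.smul_def, smul_eq_mul, char, dot, WithLp.prod_inner_apply]

lemma lintegral_ft_sq (hF : ContDiff ℝ ∞ F) (hFc : HasCompactSupport F) :
    ∫⁻ κ, ‖ft F κ‖ₑ ^ (2 : ℝ) = ∫⁻ z, ‖F z‖ₑ ^ (2 : ℝ) := by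
  obtain ⟨S, hS⟩ := exists_schwartz hF hFc
  have h0 : ∀ T : SchwartzMap (WithLp 2 (E₁ × E₂)) ℂ,
      ∫⁻ w, ‖T w‖ₑ ^ (2 : ℝ) = ENNReal.ofReal (∫ w, ‖T w‖ ^ 2) := by
    intro T
    have hi : Integrable fun w => ‖T w‖ ^ 2 := by
      simpa using (T.memLp 2 volume).integrable_norm_pow (by norm_num)
    rw [ofReal_integral_eq_lintegral_ofReal hi
      (Eventually.of_forall fun w => by positivity)]
    refine lintegral_congr fun w => ?_
    rw [← ofReal_norm, ENNReal.ofReal_rpow_of_nonneg (norm_nonneg _) (by norm_num)]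
    norm_num
  have h2 : ∫⁻ w, ‖(𝓕 S) w‖ₑ ^ (2 : ℝ) = ∫⁻ w, ‖S w‖ₑ ^ (2 : ℝ) := by
    rw [h0, h0, SchwartzMap.integral_norm_sq_fourier]
  rw [SchwartzMap.fourier_coe, hS, lintegral_withLp, lintegral_withLp] at h2
  simp only [← ft_eq_fourier] at h2
  rw [h2]
  refine lintegral_congr fun z => ?_
  simp only [toWithLp, ← ofReal_norm, Complex.norm_real]

lemma ft_dirDeriv (hF : ContDiff ℝ ∞ F) (hFc : HasCompactSupport F) (v κ : E₁ × E₂) :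
    ft (dirDeriv v F) κ = 2 * Real.pi * Complex.I * dot κ v * ft F κ := by
  set D : E₁ × E₂ →L[ℝ] ℝ := ((innerSL ℝ κ.1).comp (ContinuousLinearMap.fst ℝ E₁ E₂)) +
    ((innerSL ℝ κ.2).comp (ContinuousLinearMap.snd ℝ E₁ E₂)) with hD
  have hDz : ∀ z, D z = dot κ z := fun z => rfl
  have hchar : ∀ z, HasFDerivAt (fun z => char (-dot κ z))
      ((2 * Real.pi * Complex.I * char (-dot κ z)) • (Complex.ofRealCLM.comp (-D))) z := by
    intro z
    have h1 : HasFDerivAt (fun z => -dot κ z) (-D) z :=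
      HasFDerivAt.neg (f := fun z => D z) D.hasFDerivAt
    have h2 := (hasDerivAt_char (-dot κ z)).hasFDerivAt.comp z h1
    refine h2.congr_fderiv (ContinuousLinearMap.ext fun w => ?_)
    simp [mul_comm]
  have hFd : ∀ z, HasFDerivAt (fun z => (F z : ℂ)) (Complex.ofRealCLM.comp (fderiv ℝ F z)) z :=
    fun z => Complex.ofRealCLM.hasFDerivAt.comp z (hF.differentiable (by simp) z).hasFDerivAt
  have hcc : Continuous fun z => char (-dot κ z) :=
    continuous_char.comp (continuous_dot.comp (continuous_const.prodMk continuous_id)).neg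
  have hint : ∀ G : E₁ × E₂ → ℝ, Continuous G → HasCompactSupport G →
      Integrable fun z => char (-dot κ z) * (G z : ℂ) := fun G hG hGc =>
    (hcc.mul (Complex.continuous_ofReal.comp hG)).integrable_of_hasCompactSupport
      (HasCompactSupport.mul_left (hGc.comp_left (g := fun x : ℝ => (x : ℂ)) (by simp)))
  have hcd := hint _ (contDiff_dirDeriv hF v).continuous
    (hFc.of_isClosed_subset isClosed_closure (tsupport_dirDeriv_subset v F))
  have hc0 := hint F hF.continuous hFc
  have e1 : ∀ z, fderiv ℝ (fun z => char (-dot κ z)) z v * (F z : ℂ) =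
      -(2 * Real.pi * Complex.I * dot κ v) * (char (-dot κ z) * (F z : ℂ)) := by
    intro z
    rw [(hchar z).fderiv]
    simp [hDz]
    ring
  have e2 : ∀ z, char (-dot κ z) * fderiv ℝ (fun z => (F z : ℂ)) z v =
      char (-dot κ z) * (dirDeriv v F z : ℂ) := by
    intro z
    rw [(hFd z).fderiv]
    rfl
  have key := integral_mul_fderiv_eq_neg_fderiv_mul_of_integrable
    (μ := (volume : Measure (E₁ × E₂)))
    (f := fun z => char (-dot κ z)) (g := fun z => (F z : ℂ)) (v := v)
    (by simp only [e1]; exact hc0.const_mul _) (by simp only [e2]; exact hcd) hc0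
    (fun z _ => (hchar z).differentiableAt) (fun z _ => (hFd z).differentiableAt)
  simp only [e1, e2] at key
  rw [ft, key, integral_const_mul, ft]
  ring

lemma ft_listDeriv (hF : ContDiff ℝ ∞ F) (hFc : HasCompactSupport F) (L : List (E₁ × E₂))
    (κ : E₁ × E₂) :
    ft (listDeriv L F) κ = (L.map fun v => (2 * Real.pi * Complex.I * dot κ v : ℂ)).prod * ft F κ := by
  induction L with
  | nil => simp
  | cons v L ih =>
    rw [listDeriv_cons, ft_dirDeriv (contDiff_listDeriv hF L) (hasCompactSupport_listDeriv hFc L),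
      ih, List.map_cons, List.prod_cons]
    ring

end Fourier

/-! ### Multiplication by a cut-off on the Sobolev scale. -/

section Leibniz

lemma zero_mem_multiIndices (d n : ℕ) : (0 : Fin d → ℕ) ∈ multiIndices d n := by
  simp [multiIndices, Fintype.mem_piFinset]

lemma mem_multiIndices {d n : ℕ} {α : Fin d → ℕ} : α ∈ multiIndices d n ↔ ∑ i, α i ≤ n := by
  simp only [multiIndices, Finset.mem_filter, Fintype.mem_piFinset, Finset.mem_range,
    and_iff_right_iff_imp]
  intro h i
  exact Nat.lt_succ_of_le ((Finset.single_le_sum (fun _ _ => Nat.zero_le _)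
    (Finset.mem_univ i)).trans h)

lemma exists_dirList_of_sublist {X : Type*} {d : ℕ} (e : Fin d → X) (α : Fin d → ℕ) {K : List X}
    (hK : K.Sublist (dirList e α)) : ∃ α' : Fin d → ℕ, α' ≤ α ∧ K = dirList e α' := by
  -- Distinct indices allow the multiplicity of the head to be updated without changing the tail.
  suffices H : ∀ l : List (Fin d), l.Nodup → ∀ K : List X,
      K.Sublist (l.flatMap fun i => List.replicate (α i) (e i)) →
      ∃ α' : Fin d → ℕ, α' ≤ α ∧ K = l.flatMap fun i => List.replicate (α' i) (e i) from
    H _ (List.nodup_finRange d) K hK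
  intro l
  induction l with
  | nil =>
    intro _ K hK
    exact ⟨α, le_rfl, by simpa using hK⟩
  | cons i l ih =>
    intro hl K hK
    rw [List.flatMap_cons, List.sublist_append_iff] at hK
    obtain ⟨K₁, K₂, rfl, h₁, h₂⟩ := hK
    obtain ⟨k, hk, rfl⟩ := List.sublist_replicate_iff.1 h₁
    obtain ⟨α', hα', rfl⟩ := ih (List.nodup_cons.1 hl).2 K₂ h₂
    refine ⟨Function.update α' i k, fun j => ?_, ?_⟩
    · by_cases hj : j = i
      · subst hj; simpa using hk
      · simpa [hj] using hα' j
    · rw [List.flatMap_cons, Function.update_self]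
      congr 1
      refine List.flatMap_congr fun j hj => ?_
      rw [Function.update_of_ne]
      rintro rfl
      exact (List.nodup_cons.1 hl).1 hj

variable {E₁ E₂ : Type*} [NormedAddCommGroup E₁] [NormedSpace ℝ E₁] [FiniteDimensional ℝ E₁]
  [MeasureSpace E₁] [BorelSpace E₁] [(volume : Measure E₁).IsAddHaarMeasure]
  [NormedAddCommGroup E₂] [NormedSpace ℝ E₂] [FiniteDimensional ℝ E₂]
  [MeasureSpace E₂] [BorelSpace E₂] [(volume : Measure E₂).IsAddHaarMeasure]
  {d₁ d₂ : ℕ}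

/-- The terms produced by the Leibniz rule are again mixed derivatives within the same orders, so
they are covered by the hypothesis on φ. -/
lemma exists_mixedList_of_sublist (e₁ : Fin d₁ → E₁) (e₂ : Fin d₂ → E₂) {m n : ℕ}
    {α : Fin d₁ → ℕ} {β : Fin d₂ → ℕ} (hα : α ∈ multiIndices d₁ m) (hβ : β ∈ multiIndices d₂ n)
    {K : List (E₁ × E₂)} (hK : K.Sublist (mixedList e₁ e₂ α β)) :
    ∃ α' ∈ multiIndices d₁ m, ∃ β' ∈ multiIndices d₂ n, K = mixedList e₁ e₂ α' β' := by
  rw [mixedList, List.sublist_append_iff] at hK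
  obtain ⟨K₁, K₂, rfl, h₁, h₂⟩ := hK
  obtain ⟨α', hα', rfl⟩ := exists_dirList_of_sublist _ _ h₁
  obtain ⟨β', hβ', rfl⟩ := exists_dirList_of_sublist _ _ h₂
  rw [mem_multiIndices] at hα hβ
  exact ⟨α', mem_multiIndices.2 ((Finset.sum_le_sum fun i _ => hα' i).trans hα), β',
    mem_multiIndices.2 ((Finset.sum_le_sum fun i _ => hβ' i).trans hβ), rfl⟩

/-- Multiplication by a test function is bounded on the Bochner-Sobolev scale. -/
lemma exists_eLpNorm_mixedDeriv_mul_le (e₁ : Fin d₁ → E₁) (e₂ : Fin d₂ → E₂) (m n : ℕ)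
    {χ : E₁ × E₂ → ℝ} (hχ : ContDiff ℝ ∞ χ) (hχc : HasCompactSupport χ) :
    ∃ C : ℝ≥0∞, C ≠ ⊤ ∧ ∀ (φ : E₁ × E₂ → ℝ) (R : ℝ≥0∞), ContDiff ℝ ∞ φ →
      (∀ α ∈ multiIndices d₁ m, ∀ β ∈ multiIndices d₂ n,
        eLpNorm (mixedDeriv e₁ e₂ α β φ) 2 volume ≤ R) →
      ∀ α ∈ multiIndices d₁ m, ∀ β ∈ multiIndices d₂ n,
        eLpNorm (mixedDeriv e₁ e₂ α β (fun z => χ z * φ z)) 2 volume ≤ C * R := by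
  suffices H : ∀ α ∈ multiIndices d₁ m, ∀ β ∈ multiIndices d₂ n, ∃ C : ℝ≥0∞, C ≠ ⊤ ∧
      ∀ (φ : E₁ × E₂ → ℝ) (R : ℝ≥0∞), ContDiff ℝ ∞ φ →
      (∀ α ∈ multiIndices d₁ m, ∀ β ∈ multiIndices d₂ n,
        eLpNorm (mixedDeriv e₁ e₂ α β φ) 2 volume ≤ R) →
        eLpNorm (mixedDeriv e₁ e₂ α β (fun z => χ z * φ z)) 2 volume ≤ C * R by
    choose! C hC h using H
    refine ⟨∑ α ∈ multiIndices d₁ m, ∑ β ∈ multiIndices d₂ n, C α β, ?_,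
      fun φ R hφ hR α hα β hβ => (h α hα β hβ φ R hφ hR).trans ?_⟩
    · rw [ENNReal.sum_ne_top]
      intro α hα
      rw [ENNReal.sum_ne_top]
      exact fun β hβ => hC α hα β hβ
    · refine mul_le_mul_left ?_ R
      exact (Finset.single_le_sum (f := fun β => C α β) (fun _ _ => zero_le) hβ).trans
        (Finset.single_le_sum (f := fun α => ∑ β ∈ multiIndices d₂ n, C α β)
          (fun _ _ => zero_le) hα)
  intro α hα β hβ
  set L := mixedList e₁ e₂ α β
  obtain ⟨C, hC, h⟩ := exists_abs_listDeriv_mul_le L hχ hχc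
  refine ⟨ENNReal.ofReal C * L.sublists.length, ENNReal.mul_ne_top ENNReal.ofReal_ne_top
    (ENNReal.natCast_ne_top _), fun φ R hφ hR => ?_⟩
  rw [mixedDeriv_eq_listDeriv]
  have hsum : ∀ S : List (List (E₁ × E₂)), (∀ K ∈ S, K.Sublist L) →
      eLpNorm (fun z => (S.map fun K => |listDeriv K φ z|).sum) 2 volume ≤ S.length * R := by
    intro S
    induction S with
    | nil => simp
    | cons K S ih =>
      intro hS
      have h1 : eLpNorm (fun z => |listDeriv K φ z|) 2 volume ≤ R := by
        obtain ⟨α', hα', β', hβ', rfl⟩ :=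
          exists_mixedList_of_sublist e₁ e₂ hα hβ (hS K (by simp))
        have := hR α' hα' β' hβ'
        rw [mixedDeriv_eq_listDeriv] at this
        simpa [← Real.norm_eq_abs] using this
      have h2 := ih fun K' hK' => hS K' (by simp [hK'])
      have hm : ∀ S : List (List (E₁ × E₂)),
          Continuous fun z => (S.map fun K => |listDeriv K φ z|).sum := by
        intro S
        induction S with
        | nil => simpa using continuous_const
        | cons K S ih =>
          simp only [List.map_cons, List.sum_cons]
          exact (contDiff_listDeriv hφ K).continuous.abs.add ih
      simp only [List.map_cons, List.sum_cons, List.length_cons]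
      refine (eLpNorm_add_le (contDiff_listDeriv hφ K).continuous.abs.aestronglyMeasurable
        (hm S).aestronglyMeasurable (by norm_num)).trans ((add_le_add h1 h2).trans (le_of_eq ?_))
      push_cast
      ring
  calc eLpNorm (listDeriv L fun z => χ z * φ z) 2 volume
      ≤ ENNReal.ofReal C * eLpNorm (fun z => (L.sublists.map fun K => |listDeriv K φ z|).sum)
          2 volume := by
        refine eLpNorm_le_mul_eLpNorm_of_ae_le_mul (Filter.Eventually.of_forall fun z => ?_) 2
        refine (h φ hφ z).trans ?_
        rw [Real.norm_eq_abs]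
        exact mul_le_mul_of_nonneg_left (le_abs_self _) hC
    _ ≤ ENNReal.ofReal C * (L.sublists.length * R) := by
        gcongr
        exact hsum _ fun K hK => List.mem_sublists.1 hK
    _ = _ := by ring

end Leibniz

/-! ### From L² derivatives to weighted L¹ bounds in frequency. -/

section Barron

variable {d d₁ d₂ : ℕ}

/-- 1+|x| is at most d+1 times the largest of 1, |x₁|, …, |x_d|. The (2m)-th power of this maximum
is itself a term of the sum, with α = 0 or α = m at a single index. -/
lemma one_add_norm_pow_le (m : ℕ) (x : EuclideanSpace ℝ (Fin d)) :
    (1 + ‖x‖) ^ (2 * m) ≤ (d + 1) ^ (2 * m) * ∑ α ∈ multiIndices d m, (∏ i, x i ^ α i) ^ 2 := by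
  set y : Option (Fin d) → ℝ := fun o => o.elim 1 fun i => |x i| with hy
  have hy0 : ∀ o, 0 ≤ y o := by rintro (_ | i) <;> simp [y]
  obtain ⟨j, -, hj⟩ := Finset.exists_max_image Finset.univ y Finset.univ_nonempty
  have h1 : 1 + ‖x‖ ≤ (d + 1) * y j := by
    have hx : ‖x‖ ≤ ∑ i, |x i| := by
      rw [EuclideanSpace.norm_eq]
      refine Real.sqrt_le_iff.2 ⟨Finset.sum_nonneg fun i _ => abs_nonneg _, ?_⟩
      simp only [Real.norm_eq_abs]
      exact Finset.sum_sq_le_sq_sum_of_nonneg fun i _ => abs_nonneg _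
    calc 1 + ‖x‖ ≤ ∑ o, y o := by simpa [Fintype.sum_option, y] using hx
      _ ≤ ∑ _o : Option (Fin d), y j := Finset.sum_le_sum fun o _ => hj o (Finset.mem_univ _)
      _ = (d + 1) * y j := by simp
  have h2 : y j ^ (2 * m) ≤ ∑ α ∈ multiIndices d m, (∏ i, x i ^ α i) ^ 2 := by
    obtain ⟨α, hα, he⟩ : ∃ α ∈ multiIndices d m, y j ^ (2 * m) = (∏ i, x i ^ α i) ^ 2 := by
      rcases j with _ | i
      · exact ⟨0, zero_mem_multiIndices d m, by simp [y]⟩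
      · refine ⟨Pi.single i m, mem_multiIndices.2 (by simp), ?_⟩
        rw [Finset.prod_eq_single i (fun k _ hk => by simp [hk]) (by simp)]
        simp only [y, Option.elim_some, Pi.single_eq_same]
        rw [pow_mul, sq_abs, ← pow_mul, ← pow_mul, mul_comm]
    rw [he]
    exact Finset.single_le_sum (f := fun α : Fin d → ℕ => (∏ i, x i ^ α i) ^ 2)
      (fun _ _ => sq_nonneg _) hα
  calc (1 + ‖x‖) ^ (2 * m) ≤ ((d + 1) * y j) ^ (2 * m) := by gcongr
    _ = (d + 1) ^ (2 * m) * y j ^ (2 * m) := mul_pow _ _ _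
    _ ≤ _ := by gcongr

/-- The polynomial weight `(1 + |x|)^a (1 + |y|)^b`. -/
def weight {E₁ E₂ : Type*} [Norm E₁] [Norm E₂] (a b : ℕ) (κ : E₁ × E₂) : ℝ :=
  (1 + ‖κ.1‖) ^ a * (1 + ‖κ.2‖) ^ b

lemma weight_pos {E₁ E₂ : Type*} [NormedAddCommGroup E₁] [NormedAddCommGroup E₂] (a b : ℕ)
    (κ : E₁ × E₂) : 0 < weight a b κ := by unfold weight; positivity

lemma one_le_weight {E₁ E₂ : Type*} [NormedAddCommGroup E₁] [NormedAddCommGroup E₂] (a b : ℕ)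
    (κ : E₁ × E₂) : 1 ≤ weight a b κ :=
  one_le_mul_of_one_le_of_one_le (one_le_pow₀ (by linarith [norm_nonneg κ.1]))
    (one_le_pow₀ (by linarith [norm_nonneg κ.2]))

lemma continuous_weight {E₁ E₂ : Type*} [NormedAddCommGroup E₁] [NormedAddCommGroup E₂] (a b : ℕ) :
    Continuous (weight a b : E₁ × E₂ → ℝ) := by unfold weight; fun_prop

/-- Each derivative contributes a factor 2πi κⱼ to the Fourier transform; the factors 2π ≥ 1 are
discarded. -/
lemma abs_monomial_mul_norm_ft_le
    {F : EuclideanSpace ℝ (Fin d₁) × EuclideanSpace ℝ (Fin d₂) → ℝ} (hF : ContDiff ℝ ∞ F)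
    (hFc : HasCompactSupport F) (α : Fin d₁ → ℕ) (β : Fin d₂ → ℕ)
    (κ : EuclideanSpace ℝ (Fin d₁) × EuclideanSpace ℝ (Fin d₂)) :
    |monomial κ α β| * ‖ft F κ‖ ≤ ‖ft (mixedDeriv (stdDir d₁) (stdDir d₂) α β F) κ‖ := by
  rw [mixedDeriv_eq_listDeriv, ft_listDeriv hF hFc, norm_mul, mixedList, List.map_append,
    List.prod_append, prod_map_dirList, prod_map_dirList, norm_mul, norm_prod, norm_prod, monomial,
    abs_mul, Finset.abs_prod, Finset.abs_prod]
  have h2 : ∀ x : ℝ, |x| ≤ ‖(2 * Real.pi * Complex.I * x : ℂ)‖ := by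
    intro x
    simp only [norm_mul, Complex.norm_real, Complex.norm_I, Real.norm_eq_abs, Complex.norm_ofNat,
      mul_one, abs_of_pos Real.pi_pos]
    nlinarith [abs_nonneg x, Real.pi_gt_three]
  refine mul_le_mul_of_nonneg_right (mul_le_mul (Finset.prod_le_prod (fun _ _ => abs_nonneg _)
    fun i _ => ?_) (Finset.prod_le_prod (fun _ _ => abs_nonneg _) fun i _ => ?_)
    (Finset.prod_nonneg fun _ _ => abs_nonneg _) (Finset.prod_nonneg fun _ _ => norm_nonneg _))
    (norm_nonneg _)
  · rw [abs_pow, norm_pow]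
    refine pow_le_pow_left₀ (abs_nonneg _) ((h2 _).trans (le_of_eq ?_)) _
    simp [dot, stdDir, EuclideanSpace.inner_single_right]
  · rw [abs_pow, norm_pow]
    refine pow_le_pow_left₀ (abs_nonneg _) ((h2 _).trans (le_of_eq ?_)) _
    simp [dot, stdDir, EuclideanSpace.inner_single_right]

/-- The exponent 2(⌊d/2⌋+1) exceeds d, and the integral splits over the two blocks. -/
lemma lintegral_weight_neg_lt_top (d₁ d₂ : ℕ) :
    ∫⁻ κ : EuclideanSpace ℝ (Fin d₁) × EuclideanSpace ℝ (Fin d₂),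
      ENNReal.ofReal ((weight (d₁ / 2 + 1) (d₂ / 2 + 1) κ)⁻¹) ^ (2 : ℝ) < ⊤ := by
  have h1 : ∀ d : ℕ, ∫⁻ x : EuclideanSpace ℝ (Fin d),
      ENNReal.ofReal ((1 + ‖x‖) ^ (-((2 * (d / 2 + 1) : ℕ) : ℝ))) < ⊤ := by
    intro d
    have : Integrable fun x : EuclideanSpace ℝ (Fin d) =>
        (1 + ‖x‖) ^ (-((2 * (d / 2 + 1) : ℕ) : ℝ)) := by
      refine integrable_one_add_norm ?_
      rw [finrank_euclideanSpace_fin]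
      exact_mod_cast (by omega : d < 2 * (d / 2 + 1))
    exact this.lintegral_lt_top
  have h2 : ∀ κ : EuclideanSpace ℝ (Fin d₁) × EuclideanSpace ℝ (Fin d₂),
      ENNReal.ofReal ((weight (d₁ / 2 + 1) (d₂ / 2 + 1) κ)⁻¹) ^ (2 : ℝ) =
      ENNReal.ofReal ((1 + ‖κ.1‖) ^ (-((2 * (d₁ / 2 + 1) : ℕ) : ℝ))) *
      ENNReal.ofReal ((1 + ‖κ.2‖) ^ (-((2 * (d₂ / 2 + 1) : ℕ) : ℝ))) := by
    intro κ
    have p1 : 0 < 1 + ‖κ.1‖ := by positivity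
    have p2 : 0 < 1 + ‖κ.2‖ := by positivity
    rw [ENNReal.ofReal_rpow_of_nonneg (inv_nonneg.2 (weight_pos _ _ _).le) (by norm_num),
      ← ENNReal.ofReal_mul (by positivity), weight, Real.rpow_neg p1.le, Real.rpow_neg p2.le,
      Real.rpow_natCast, Real.rpow_natCast, Real.rpow_ofNat, pow_mul', pow_mul', ← mul_inv,
      ← mul_pow, inv_pow]
  simp only [h2]
  rw [Measure.volume_eq_prod, lintegral_prod_mul
    (f := fun x : EuclideanSpace ℝ (Fin d₁) =>
      ENNReal.ofReal ((1 + ‖x‖) ^ (-((2 * (d₁ / 2 + 1) : ℕ) : ℝ))))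
    (g := fun y : EuclideanSpace ℝ (Fin d₂) =>
      ENNReal.ofReal ((1 + ‖y‖) ^ (-((2 * (d₂ / 2 + 1) : ℕ) : ℝ))))
    (by fun_prop) (by fun_prop)]
  exact ENNReal.mul_lt_top (h1 d₁) (h1 d₂)

/-- The Barron-type bound for the Fourier transform in terms of `L²` norms of derivatives. -/
lemma exists_lintegral_ft_weight_le (d₁ d₂ n₁ n₂ : ℕ) :
    ∃ C : ℝ≥0∞, C ≠ ⊤ ∧ ∀ (F : EuclideanSpace ℝ (Fin d₁) × EuclideanSpace ℝ (Fin d₂) → ℝ)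
      (R : ℝ≥0∞), ContDiff ℝ ∞ F → HasCompactSupport F →
      (∀ α ∈ multiIndices d₁ (n₁ + d₁ / 2 + 2), ∀ β ∈ multiIndices d₂ (n₂ + d₂ / 2 + 2),
        eLpNorm (mixedDeriv (stdDir d₁) (stdDir d₂) α β F) 2 volume ≤ R) →
      ∫⁻ κ, ‖ft F κ‖ₑ * ENNReal.ofReal (weight (n₁ + 1) (n₂ + 1) κ) ≤ C * R := by
  set m₁ := n₁ + d₁ / 2 + 2 with hm₁
  set m₂ := n₂ + d₂ / 2 + 2 with hm₂
  set I := (multiIndices d₁ m₁) ×ˢ (multiIndices d₂ m₂) with hI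
  set K : ℝ := ((d₁ : ℝ) + 1) ^ (2 * m₁) * ((d₂ : ℝ) + 1) ^ (2 * m₂) with hK
  set Z := ∫⁻ κ : EuclideanSpace ℝ (Fin d₁) × EuclideanSpace ℝ (Fin d₂),
      ENNReal.ofReal ((weight (d₁ / 2 + 1) (d₂ / 2 + 1) κ)⁻¹) ^ (2 : ℝ) with hZ
  have hZt : Z < ⊤ := lintegral_weight_neg_lt_top d₁ d₂
  refine ⟨(ENNReal.ofReal K * I.card) ^ (1 / 2 : ℝ) * Z ^ (1 / 2 : ℝ), ?_,
    fun F R hF hFc hR => ?_⟩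
  · exact ENNReal.mul_ne_top (ENNReal.rpow_ne_top_of_nonneg (by norm_num)
      (ENNReal.mul_ne_top ENNReal.ofReal_ne_top (ENNReal.natCast_ne_top _)))
      (ENNReal.rpow_ne_top_of_nonneg (by norm_num) hZt.ne)
  have hftm : Measurable fun κ => ‖ft F κ‖ₑ := (continuous_ft hF hFc).measurable.enorm
  have hwm : ∀ a b : ℕ, Measurable fun κ : EuclideanSpace ℝ (Fin d₁) × EuclideanSpace ℝ (Fin d₂) =>
      ENNReal.ofReal (weight a b κ) := fun a b => (continuous_weight a b).measurable.ennreal_ofReal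
  -- Here mᵢ = (nᵢ+1) + (⌊dᵢ/2⌋+1). The inverse weight of order ⌊dᵢ/2⌋+1 is square integrable, so
  -- Cauchy–Schwarz leaves an L² norm with weight mᵢ, which Plancherel converts to derivatives.
  have hsplit : ∀ κ, ‖ft F κ‖ₑ * ENNReal.ofReal (weight (n₁ + 1) (n₂ + 1) κ) =
      (‖ft F κ‖ₑ * ENNReal.ofReal (weight m₁ m₂ κ)) *
        ENNReal.ofReal ((weight (d₁ / 2 + 1) (d₂ / 2 + 1) κ)⁻¹) := by
    intro κ
    rw [mul_assoc, ← ENNReal.ofReal_mul (weight_pos _ _ _).le]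
    congr 2
    have p1 : 1 + ‖κ.1‖ ≠ 0 := by positivity
    have p2 : 1 + ‖κ.2‖ ≠ 0 := by positivity
    rw [eq_mul_inv_iff_mul_eq₀ (weight_pos _ _ _).ne']
    simp only [weight, hm₁, hm₂]
    ring
  have hpt : ∀ κ, (‖ft F κ‖ₑ * ENNReal.ofReal (weight m₁ m₂ κ)) ^ (2 : ℝ) ≤
      ENNReal.ofReal K * ∑ p ∈ I,
        ‖ft (mixedDeriv (stdDir d₁) (stdDir d₂) p.1 p.2 F) κ‖ₑ ^ (2 : ℝ) := by
    intro κ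
    have hr : (‖ft F κ‖ * weight m₁ m₂ κ) ^ 2 ≤
        K * ∑ p ∈ I, ‖ft (mixedDeriv (stdDir d₁) (stdDir d₂) p.1 p.2 F) κ‖ ^ 2 := by
      have hw2 : weight m₁ m₂ κ ^ 2 ≤ K * ∑ p ∈ I, monomial κ p.1 p.2 ^ 2 := by
        have a1 := one_add_norm_pow_le m₁ κ.1
        have a2 := one_add_norm_pow_le m₂ κ.2
        calc weight m₁ m₂ κ ^ 2 = (1 + ‖κ.1‖) ^ (2 * m₁) * (1 + ‖κ.2‖) ^ (2 * m₂) := by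
              rw [weight, mul_pow, pow_mul', pow_mul']
          _ ≤ _ := mul_le_mul a1 a2 (by positivity) (by positivity)
          _ = K * ∑ p ∈ I, monomial κ p.1 p.2 ^ 2 := by
              rw [hK, mul_mul_mul_comm, Finset.sum_mul_sum, hI, Finset.sum_product]
              simp only [monomial, mul_pow]
      calc (‖ft F κ‖ * weight m₁ m₂ κ) ^ 2 = ‖ft F κ‖ ^ 2 * weight m₁ m₂ κ ^ 2 := mul_pow _ _ _
        _ ≤ ‖ft F κ‖ ^ 2 * (K * ∑ p ∈ I, monomial κ p.1 p.2 ^ 2) := by gcongr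
        _ = K * ∑ p ∈ I, (|monomial κ p.1 p.2| * ‖ft F κ‖) ^ 2 := by
            simp only [mul_pow, sq_abs, ← Finset.sum_mul]; ring
        _ ≤ _ := by
            gcongr with p hp
            exact abs_monomial_mul_norm_ft_le hF hFc _ _ _
    have := ENNReal.ofReal_le_ofReal hr
    rw [ENNReal.ofReal_mul (by positivity), ENNReal.ofReal_sum_of_nonneg (fun _ _ => by positivity),
      ENNReal.ofReal_pow (by have := weight_pos m₁ m₂ κ; positivity),
      ENNReal.ofReal_mul (norm_nonneg _), ofReal_norm] at this
    simp only [ENNReal.ofReal_pow (norm_nonneg _), ofReal_norm] at this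
    simpa using this
  have hd : ∀ p : (Fin d₁ → ℕ) × (Fin d₂ → ℕ),
      ContDiff ℝ ∞ (mixedDeriv (stdDir d₁) (stdDir d₂) p.1 p.2 F) ∧
      HasCompactSupport (mixedDeriv (stdDir d₁) (stdDir d₂) p.1 p.2 F) := fun p => by
    rw [mixedDeriv_eq_listDeriv]
    exact ⟨contDiff_listDeriv hF _, hasCompactSupport_listDeriv hFc _⟩
  have hmain : ∫⁻ κ, (‖ft F κ‖ₑ * ENNReal.ofReal (weight m₁ m₂ κ)) ^ (2 : ℝ) ≤
      ENNReal.ofReal K * I.card * R ^ (2 : ℝ) := by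
    calc _ ≤ ∫⁻ κ, ENNReal.ofReal K * ∑ p ∈ I,
        ‖ft (mixedDeriv (stdDir d₁) (stdDir d₂) p.1 p.2 F) κ‖ₑ ^ (2 : ℝ) := lintegral_mono hpt
      _ = ENNReal.ofReal K * ∑ p ∈ I,
          ∫⁻ z, ‖mixedDeriv (stdDir d₁) (stdDir d₂) p.1 p.2 F z‖ₑ ^ (2 : ℝ) := by
          rw [lintegral_const_mul' _ _ ENNReal.ofReal_ne_top, lintegral_finsetSum]
          · congr 1
            refine Finset.sum_congr rfl fun p _ => ?_
            rw [lintegral_ft_sq (hd p).1 (hd p).2]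
          · intro p _
            exact (continuous_ft (hd p).1 (hd p).2).measurable.enorm.pow_const _
      _ ≤ ENNReal.ofReal K * ∑ p ∈ I, R ^ (2 : ℝ) := by
          gcongr with p hp
          rw [hI, Finset.mem_product] at hp
          have := hR p.1 hp.1 p.2 hp.2
          rw [eLpNorm_eq_lintegral_rpow_enorm_toReal (by norm_num) (by norm_num)] at this
          simp only [ENNReal.toReal_ofNat] at this
          have h2 := ENNReal.rpow_le_rpow this (by norm_num : (0 : ℝ) ≤ 2)
          rwa [← ENNReal.rpow_mul, one_div_mul_cancel (by norm_num), ENNReal.rpow_one] at h2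
      _ = _ := by rw [Finset.sum_const, nsmul_eq_mul, mul_assoc]
  calc ∫⁻ κ, ‖ft F κ‖ₑ * ENNReal.ofReal (weight (n₁ + 1) (n₂ + 1) κ)
      = ∫⁻ κ, (‖ft F κ‖ₑ * ENNReal.ofReal (weight m₁ m₂ κ)) *
        ENNReal.ofReal ((weight (d₁ / 2 + 1) (d₂ / 2 + 1) κ)⁻¹) := lintegral_congr hsplit
    _ ≤ (∫⁻ κ, (‖ft F κ‖ₑ * ENNReal.ofReal (weight m₁ m₂ κ)) ^ (2 : ℝ)) ^ (1 / 2 : ℝ) *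
        Z ^ (1 / 2 : ℝ) :=
        ENNReal.lintegral_mul_le_Lp_mul_Lq _ Real.HolderConjugate.two_two
          (hftm.mul (hwm _ _)).aemeasurable
          (continuous_weight _ _).measurable.inv.ennreal_ofReal.aemeasurable
    _ ≤ (ENNReal.ofReal K * I.card * R ^ (2 : ℝ)) ^ (1 / 2 : ℝ) * Z ^ (1 / 2 : ℝ) := by gcongr
    _ = _ := by
        rw [ENNReal.mul_rpow_of_nonneg _ _ (by norm_num : (0 : ℝ) ≤ 1 / 2), ← ENNReal.rpow_mul,
          mul_one_div_cancel (by norm_num), ENNReal.rpow_one]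
        ring

end Barron

/-! ### The ridgelet transform, its weighted bound and the reproducing formula. -/

section Ridgelet

open Filter Topology

variable {E₁ E₂ : Type*} [NormedAddCommGroup E₁] [InnerProductSpace ℝ E₁] [FiniteDimensional ℝ E₁]
  [MeasurableSpace E₁] [BorelSpace E₁]
  [NormedAddCommGroup E₂] [InnerProductSpace ℝ E₂] [FiniteDimensional ℝ E₂]
  [MeasurableSpace E₂] [BorelSpace E₂] {F : E₁ × E₂ → ℝ} {ψ : ℝ × ℝ → ℝ}

/-- Blockwise dilation. -/
def dil (ℓ : ℝ × ℝ) (ξ : E₁ × E₂) : E₁ × E₂ := (ℓ.1 • ξ.1, ℓ.2 • ξ.2)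

lemma continuous_dil : Continuous fun p : (ℝ × ℝ) × (E₁ × E₂) => dil p.1 p.2 := by
  unfold dil; fun_prop

lemma dot_pairing (ℓ : ℝ × ℝ) (ξ z : E₁ × E₂) : dot ℓ (pairing ξ z) = dot (dil ℓ ξ) z := by
  simp [dot, pairing_apply, dil, real_inner_smul_left, mul_comm]

lemma dot_add {G₁ G₂ : Type*} [NormedAddCommGroup G₁] [InnerProductSpace ℝ G₁]
    [NormedAddCommGroup G₂] [InnerProductSpace ℝ G₂] (κ z w : G₁ × G₂) :
    dot κ (z + w) = dot κ z + dot κ w := by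
  simp only [dot, Prod.fst_add, Prod.snd_add, inner_add_right]; ring

lemma dot_neg {G₁ G₂ : Type*} [NormedAddCommGroup G₁] [InnerProductSpace ℝ G₁]
    [NormedAddCommGroup G₂] [InnerProductSpace ℝ G₂] (κ z : G₁ × G₂) :
    dot κ (-z) = -dot κ z := by
  simp only [dot, Prod.fst_neg, Prod.snd_neg, inner_neg_right]; ring

/-- The Jacobian factor of `dil ℓ`. -/
def dilScale (D₁ D₂ : ℕ) (ℓ : ℝ × ℝ) : ℝ := |(ℓ.1 ^ D₁)⁻¹| * |(ℓ.2 ^ D₂)⁻¹|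

lemma dilScale_nonneg (D₁ D₂ : ℕ) (ℓ : ℝ × ℝ) : 0 ≤ dilScale D₁ D₂ ℓ :=
  mul_nonneg (abs_nonneg _) (abs_nonneg _)

lemma map_dil {ℓ : ℝ × ℝ} (h₁ : ℓ.1 ≠ 0) (h₂ : ℓ.2 ≠ 0) :
    Measure.map (dil ℓ) (volume : Measure (E₁ × E₂)) =
      ENNReal.ofReal (dilScale (Module.finrank ℝ E₁) (Module.finrank ℝ E₂) ℓ) • volume := by
  have h : (dil ℓ : E₁ × E₂ → E₁ × E₂) = Prod.map (fun x => ℓ.1 • x) (fun y => ℓ.2 • y) := rfl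
  rw [h, Measure.volume_eq_prod, ← Measure.map_prod_map _ _ (measurable_const_smul _)
    (measurable_const_smul _), Measure.map_addHaar_smul _ h₁, Measure.map_addHaar_smul _ h₂,
    Measure.prod_smul_left, Measure.prod_smul_right, smul_smul,
    dilScale, ENNReal.ofReal_mul (abs_nonneg _)]

/-- The ridgelet transform of `F` with window `ψ`. -/
def ridgelet (F : E₁ × E₂ → ℝ) (ψ : ℝ × ℝ → ℝ) (ξ : E₁ × E₂) (b : ℝ × ℝ) : ℝ :=
  ∫ z, F z * ψ (-(pairing ξ z + b))

/-- Insert Fourier inversion for ψ and apply Fubini. As a function of b, the transform is the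
Fourier transform of the product of `ft ψ` with `ft F` along the dilates of ξ. -/
lemma ridgelet_eq (hF : ContDiff ℝ ∞ F) (hFc : HasCompactSupport F) (hψ : ContDiff ℝ ∞ ψ)
    (hψc : HasCompactSupport ψ) (ξ : E₁ × E₂) (b : ℝ × ℝ) :
    (ridgelet F ψ ξ b : ℂ) = ∫ ℓ, ft ψ ℓ * char (-dot ℓ b) * ft F (dil ℓ ξ) := by
  have hFi : Integrable fun z => (F z : ℂ) :=
    (hF.continuous.integrable_of_hasCompactSupport hFc).ofReal
  have h1 : (ridgelet F ψ ξ b : ℂ) =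
      ∫ z, ∫ ℓ, (F z : ℂ) * (char (dot ℓ (-(pairing ξ z + b))) * ft ψ ℓ) := by
    rw [ridgelet, ← integral_complex_ofReal]
    refine integral_congr_ae (Eventually.of_forall fun z => ?_)
    simp only [Complex.ofReal_mul]
    rw [ft_inversion hψ hψc, integral_const_mul]
  rw [h1, integral_integral_swap]
  · refine integral_congr_ae (Eventually.of_forall fun ℓ => ?_)
    beta_reduce
    rw [show ft F (dil ℓ ξ) = ∫ z, char (-dot (dil ℓ ξ) z) * (F z : ℂ) from rfl,
      ← integral_const_mul]
    refine integral_congr_ae (Eventually.of_forall fun z => ?_)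
    simp only [dot_neg, dot_add, neg_add, char_add, dot_pairing]
    ring
  · refine ((hFi.mul_prod (integrable_ft hψ hψc)).mono ?_ (Eventually.of_forall fun p => ?_))
    · have hc : Continuous fun p : (E₁ × E₂) × (ℝ × ℝ) =>
          char (dot p.2 (-(pairing ξ p.1 + b))) := by
        refine continuous_char.comp (continuous_dot.comp (continuous_snd.prodMk ?_))
        exact (((pairing ξ).continuous.comp continuous_fst).add continuous_const).neg
      exact ((Complex.continuous_ofReal.comp (hF.continuous.comp continuous_fst)).mul
        (hc.mul ((continuous_ft hψ hψc).comp continuous_snd))).aestronglyMeasurable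
    · simp [Function.uncurry]

lemma continuous_ridgelet (hF : ContDiff ℝ ∞ F) (hFc : HasCompactSupport F)
    (hψ : ContDiff ℝ ∞ ψ) (hψc : HasCompactSupport ψ) :
    Continuous fun p : (E₁ × E₂) × (ℝ × ℝ) => ridgelet F ψ p.1 p.2 := by
  obtain ⟨C, hC⟩ := hψ.continuous.bounded_above_of_compact_support hψc
  unfold ridgelet
  refine continuous_of_dominated (bound := fun z => ‖F z‖ * C) (fun p => ?_) (fun p => ?_) ?_ ?_
  · exact (hF.continuous.mul (hψ.continuous.comp
      (((pairing p.1).continuous.add continuous_const).neg))).aestronglyMeasurable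
  · refine Eventually.of_forall fun z => ?_
    rw [norm_mul]
    exact mul_le_mul_of_nonneg_left (hC _) (norm_nonneg _)
  · exact (hF.continuous.norm.integrable_of_hasCompactSupport hFc.norm).mul_const C
  · refine Eventually.of_forall fun z => continuous_const.mul (hψ.continuous.comp ?_)
    simp only [pairing_apply]
    fun_prop

lemma enorm_ridgelet_le (hF : ContDiff ℝ ∞ F) (hFc : HasCompactSupport F) (hψ : ContDiff ℝ ∞ ψ)
    (hψc : HasCompactSupport ψ) (ξ : E₁ × E₂) (b : ℝ × ℝ) :
    ‖ridgelet F ψ ξ b‖ₑ ≤ ∫⁻ ℓ, ‖ft ψ ℓ‖ₑ * ‖ft F (dil ℓ ξ)‖ₑ := by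
  have h : ‖ridgelet F ψ ξ b‖ₑ = ‖(ridgelet F ψ ξ b : ℂ)‖ₑ := by
    rw [← ofReal_norm, ← ofReal_norm, Complex.norm_real]
  rw [h, ridgelet_eq hF hFc hψ hψc]
  refine (enorm_integral_le_lintegral_enorm _).trans (le_of_eq ?_)
  refine lintegral_congr fun ℓ => ?_
  rw [enorm_mul, enorm_mul, ← ofReal_norm (char _), norm_char]
  simp

/-- A nonzero integrand requires z in the support of F and the shifted argument in that of ψ. The
resulting bias box grows linearly in each |ξᵢ| and costs one power of the weight per block. -/
lemma abs_le_of_ridgelet_ne_zero {ρ : ℝ} (hFρ : ∀ z, F z ≠ 0 → ‖z‖ ≤ ρ)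
    (hψρ : ∀ t, ψ t ≠ 0 → ‖t‖ ≤ ρ) {ξ : E₁ × E₂} {b : ℝ × ℝ} (h : ridgelet F ψ ξ b ≠ 0) :
    |b.1| ≤ ρ * (1 + ‖ξ.1‖) ∧ |b.2| ≤ ρ * (1 + ‖ξ.2‖) := by
  obtain ⟨z, hz⟩ : ∃ z, F z * ψ (-(pairing ξ z + b)) ≠ 0 := by
    by_contra! hcon
    exact h (by simp only [ridgelet, hcon, integral_zero])
  have h1 := hFρ z (left_ne_zero_of_mul hz)
  have h2 := hψρ _ (right_ne_zero_of_mul hz)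
  rw [norm_neg, pairing_apply] at h2
  have h3 := (norm_fst_le _).trans h2
  have h4 := (norm_snd_le _).trans h2
  have h5 := (norm_fst_le z).trans h1
  have h6 := (norm_snd_le z).trans h1
  simp only [Prod.fst_add, Prod.snd_add, Real.norm_eq_abs] at h3 h4
  have i1 := abs_real_inner_le_norm ξ.1 z.1
  have i2 := abs_real_inner_le_norm ξ.2 z.2
  have j1 : ‖ξ.1‖ * ‖z.1‖ ≤ ‖ξ.1‖ * ρ := mul_le_mul_of_nonneg_left h5 (norm_nonneg _)
  have j2 : ‖ξ.2‖ * ‖z.2‖ ≤ ‖ξ.2‖ * ρ := mul_le_mul_of_nonneg_left h6 (norm_nonneg _)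
  constructor
  · have := abs_add_le (inner ℝ ξ.1 z.1 + b.1) (-inner ℝ ξ.1 z.1)
    rw [abs_neg, show inner ℝ ξ.1 z.1 + b.1 + -inner ℝ ξ.1 z.1 = b.1 by ring] at this
    linarith
  · have := abs_add_le (inner ℝ ξ.2 z.2 + b.2) (-inner ℝ ξ.2 z.2)
    rw [abs_neg, show inner ℝ ξ.2 z.2 + b.2 + -inner ℝ ξ.2 z.2 = b.2 by ring] at this
    linarith

/-- The admissibility weight for windows of the ridgelet transform. -/
def admWeight (D₁ D₂ a b : ℕ) (ℓ : ℝ × ℝ) : ℝ := dilScale D₁ D₂ ℓ * weight a b (ℓ.1⁻¹, ℓ.2⁻¹)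

lemma ae_ne_zero_prod : ∀ᵐ ℓ : ℝ × ℝ, ℓ.1 ≠ 0 ∧ ℓ.2 ≠ 0 := by
  have h1 : ∀ᵐ s : ℝ, s ≠ 0 := Measure.ae_ne volume 0
  filter_upwards [Measure.quasiMeasurePreserving_fst.ae h1,
    Measure.quasiMeasurePreserving_snd.ae h1] with ℓ h2 h3
  exact ⟨h2, h3⟩

/-- Since ξ is the dilation of `dil ℓ ξ` by the inverse of ℓ, the weight can be moved to the dilated
variable at a cost that depends on ℓ alone. -/
lemma weight_le_mul_weight_dil (a b : ℕ) {ℓ : ℝ × ℝ} (h₁ : ℓ.1 ≠ 0) (h₂ : ℓ.2 ≠ 0) (ξ : E₁ × E₂) :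
    weight a b ξ ≤ weight a b (ℓ.1⁻¹, ℓ.2⁻¹) * weight a b (dil ℓ ξ) := by
  have k1 : 1 + ‖ξ.1‖ ≤ (1 + ‖ℓ.1⁻¹‖) * (1 + ‖ℓ.1 • ξ.1‖) := by
    have : ‖ξ.1‖ = ‖ℓ.1⁻¹‖ * ‖ℓ.1 • ξ.1‖ := by
      rw [← norm_smul, smul_smul, inv_mul_cancel₀ h₁, one_smul]
    nlinarith [norm_nonneg ℓ.1⁻¹, norm_nonneg (ℓ.1 • ξ.1)]
  have k2 : 1 + ‖ξ.2‖ ≤ (1 + ‖ℓ.2⁻¹‖) * (1 + ‖ℓ.2 • ξ.2‖) := by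
    have : ‖ξ.2‖ = ‖ℓ.2⁻¹‖ * ‖ℓ.2 • ξ.2‖ := by
      rw [← norm_smul, smul_smul, inv_mul_cancel₀ h₂, one_smul]
    nlinarith [norm_nonneg ℓ.2⁻¹, norm_nonneg (ℓ.2 • ξ.2)]
  calc weight a b ξ ≤ ((1 + ‖ℓ.1⁻¹‖) * (1 + ‖ℓ.1 • ξ.1‖)) ^ a *
        ((1 + ‖ℓ.2⁻¹‖) * (1 + ‖ℓ.2 • ξ.2‖)) ^ b := by unfold weight; gcongr
    _ = _ := by simp only [weight, dil, mul_pow]; ring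

/-- The weighted bound for the superposition of dilated Fourier transforms. -/
lemma lintegral_weight_mul_lintegral_ft_dil_le (hF : ContDiff ℝ ∞ F) (hFc : HasCompactSupport F)
    (hψ : ContDiff ℝ ∞ ψ) (hψc : HasCompactSupport ψ) (a b : ℕ) :
    ∫⁻ ξ : E₁ × E₂, ENNReal.ofReal (weight a b ξ) * ∫⁻ ℓ, ‖ft ψ ℓ‖ₑ * ‖ft F (dil ℓ ξ)‖ₑ ≤
      (∫⁻ ℓ, ‖ft ψ ℓ‖ₑ * ENNReal.ofReal
        (admWeight (Module.finrank ℝ E₁) (Module.finrank ℝ E₂) a b ℓ)) *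
        ∫⁻ κ, ‖ft F κ‖ₑ * ENNReal.ofReal (weight a b κ) := by
  have hFm := continuous_ft hF hFc
  have hψm := continuous_ft hψ hψc
  have hwm : Measurable fun κ : E₁ × E₂ => ENNReal.ofReal (weight a b κ) :=
    (continuous_weight a b).measurable.ennreal_ofReal
  set Z := ∫⁻ κ, ‖ft F κ‖ₑ * ENNReal.ofReal (weight a b κ) with hZ
  have hm2 : Measurable fun p : (E₁ × E₂) × (ℝ × ℝ) =>
      ENNReal.ofReal (weight a b p.1) * (‖ft ψ p.2‖ₑ * ‖ft F (dil p.2 p.1)‖ₑ) := by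
    refine (hwm.comp measurable_fst).mul ((hψm.measurable.enorm.comp measurable_snd).mul ?_)
    exact (hFm.comp (continuous_dil.comp (continuous_snd.prodMk continuous_fst))).measurable.enorm
  calc _ = ∫⁻ ξ : E₁ × E₂, ∫⁻ ℓ, ENNReal.ofReal (weight a b ξ) *
        (‖ft ψ ℓ‖ₑ * ‖ft F (dil ℓ ξ)‖ₑ) :=
        lintegral_congr fun ξ => (lintegral_const_mul' _ _ ENNReal.ofReal_ne_top).symm
    _ = ∫⁻ ℓ, ∫⁻ ξ : E₁ × E₂, ENNReal.ofReal (weight a b ξ) *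
        (‖ft ψ ℓ‖ₑ * ‖ft F (dil ℓ ξ)‖ₑ) := lintegral_lintegral_swap hm2.aemeasurable
    _ ≤ ∫⁻ ℓ, (‖ft ψ ℓ‖ₑ * ENNReal.ofReal
        (admWeight (Module.finrank ℝ E₁) (Module.finrank ℝ E₂) a b ℓ)) * Z := by
        -- For ℓ off the axes substitute κ = `dil ℓ ξ`. The Jacobian and the cost of moving the
        -- weight together form `admWeight`.
        refine lintegral_mono_ae ?_
        filter_upwards [ae_ne_zero_prod] with ℓ hℓ
        have hdm : Measurable (dil ℓ : E₁ × E₂ → E₁ × E₂) :=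
          (continuous_dil.comp (continuous_const.prodMk continuous_id)).measurable
        calc _ ≤ ∫⁻ ξ : E₁ × E₂, (‖ft ψ ℓ‖ₑ * ENNReal.ofReal (weight a b (ℓ.1⁻¹, ℓ.2⁻¹))) *
              (‖ft F (dil ℓ ξ)‖ₑ * ENNReal.ofReal (weight a b (dil ℓ ξ))) := by
              refine lintegral_mono fun ξ => ?_
              have h1 := ENNReal.ofReal_le_ofReal (weight_le_mul_weight_dil a b hℓ.1 hℓ.2 ξ)
              rw [ENNReal.ofReal_mul (weight_pos _ _ _).le] at h1
              calc _ ≤ _ := mul_le_mul_left h1 _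
                _ = _ := by ring
          _ = (‖ft ψ ℓ‖ₑ * ENNReal.ofReal (weight a b (ℓ.1⁻¹, ℓ.2⁻¹))) *
              ∫⁻ κ, ‖ft F κ‖ₑ * ENNReal.ofReal (weight a b κ) ∂(Measure.map (dil ℓ) volume) := by
              rw [lintegral_const_mul' _ _ (ENNReal.mul_ne_top enorm_ne_top ENNReal.ofReal_ne_top),
                lintegral_map (f := fun κ => ‖ft F κ‖ₑ * ENNReal.ofReal (weight a b κ))
                  (hFm.measurable.enorm.mul hwm) hdm]
          _ = _ := by
              rw [map_dil hℓ.1 hℓ.2, lintegral_smul_measure, admWeight,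
                ENNReal.ofReal_mul (dilScale_nonneg _ _ _)]
              simp only [smul_eq_mul, ← hZ]
              ring
    _ = _ := by
        refine lintegral_mul_const _ (hψm.measurable.enorm.mul ?_)
        refine Measurable.ennreal_ofReal ?_
        unfold admWeight dilScale weight
        fun_prop

/-- The weighted `L¹` bound for the ridgelet transform. -/
lemma lintegral_ridgelet_le (hF : ContDiff ℝ ∞ F) (hFc : HasCompactSupport F)
    (hψ : ContDiff ℝ ∞ ψ) (hψc : HasCompactSupport ψ) {ρ : ℝ} (hρ : 0 ≤ ρ)
    (hFρ : ∀ z, F z ≠ 0 → ‖z‖ ≤ ρ) (hψρ : ∀ t, ψ t ≠ 0 → ‖t‖ ≤ ρ) (a b : ℕ) :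
    ∫⁻ θ : (E₁ × E₂) × (ℝ × ℝ), ‖ridgelet F ψ θ.1 θ.2‖ₑ * ENNReal.ofReal (weight a b θ.1) ≤
      ENNReal.ofReal ((2 * ρ) ^ 2) * (∫⁻ ℓ, ‖ft ψ ℓ‖ₑ * ENNReal.ofReal
        (admWeight (Module.finrank ℝ E₁) (Module.finrank ℝ E₂) (a + 1) (b + 1) ℓ)) *
        ∫⁻ κ, ‖ft F κ‖ₑ * ENNReal.ofReal (weight (a + 1) (b + 1) κ) := by
  have hrc := continuous_ridgelet hF hFc hψ hψc
  have hm : Measurable fun θ : (E₁ × E₂) × (ℝ × ℝ) =>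
      ‖ridgelet F ψ θ.1 θ.2‖ₑ * ENNReal.ofReal (weight a b θ.1) :=
    hrc.measurable.enorm.mul
      ((continuous_weight a b).measurable.ennreal_ofReal.comp measurable_fst)
  rw [Measure.volume_eq_prod, lintegral_prod _ hm.aemeasurable, mul_assoc]
  refine le_trans ?_ (mul_le_mul_right
    (lintegral_weight_mul_lintegral_ft_dil_le hF hFc hψ hψc (a + 1) (b + 1)) _)
  rw [← lintegral_const_mul' _ _ ENNReal.ofReal_ne_top]
  refine lintegral_mono fun ξ => ?_
  set X := ∫⁻ ℓ, ‖ft ψ ℓ‖ₑ * ‖ft F (dil ℓ ξ)‖ₑ with hX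
  -- This box contains every bias with nonzero transform. Its area (2ρ)²(1+|ξ₁|)(1+|ξ₂|) raises the
  -- orders from (a, b) to (a+1, b+1).
  set S : Set (ℝ × ℝ) := Set.Icc (-(ρ * (1 + ‖ξ.1‖))) (ρ * (1 + ‖ξ.1‖)) ×ˢ
    Set.Icc (-(ρ * (1 + ‖ξ.2‖))) (ρ * (1 + ‖ξ.2‖)) with hS
  have hpt : ∀ t : ℝ × ℝ, ‖ridgelet F ψ ξ t‖ₑ * ENNReal.ofReal (weight a b ξ) ≤
      S.indicator (fun _ => X * ENNReal.ofReal (weight a b ξ)) t := by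
    intro t
    by_cases ht : ridgelet F ψ ξ t = 0
    · simp [ht]
    · have h1 := abs_le_of_ridgelet_ne_zero hFρ hψρ ht
      have h2 : t ∈ S := ⟨abs_le.1 h1.1, abs_le.1 h1.2⟩
      rw [Set.indicator_of_mem h2]
      exact mul_le_mul_left (enorm_ridgelet_le hF hFc hψ hψc ξ t) _
  calc _ ≤ ∫⁻ t, S.indicator (fun _ => X * ENNReal.ofReal (weight a b ξ)) t := lintegral_mono hpt
    _ = X * ENNReal.ofReal (weight a b ξ) * volume S := by
        rw [lintegral_indicator_const (measurableSet_Icc.prod measurableSet_Icc)]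
    _ = ENNReal.ofReal ((2 * ρ) ^ 2) * (ENNReal.ofReal (weight (a + 1) (b + 1) ξ) * X) := by
        rw [hS, Measure.volume_eq_prod, Measure.prod_prod, Real.volume_Icc, Real.volume_Icc,
          ← ENNReal.ofReal_mul (by have := mul_nonneg hρ (norm_nonneg ξ.1); linarith), mul_assoc,
          ← ENNReal.ofReal_mul (weight_pos _ _ _).le, ← mul_assoc (ENNReal.ofReal _),
          ← ENNReal.ofReal_mul (by positivity), mul_comm X]
        congr 2
        unfold weight
        ring
    _ ≤ _ := le_rfl

lemma continuous_ft_of_integrable {σ : ℝ × ℝ → ℝ} (hσ : Integrable σ) : Continuous (ft σ) := by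
  unfold ft
  have hcc : ∀ ℓ : ℝ × ℝ, Continuous fun t : ℝ × ℝ => char (-dot ℓ t) := fun ℓ =>
    continuous_char.comp (continuous_dot.comp (continuous_const.prodMk continuous_id)).neg
  refine continuous_of_dominated (bound := fun t => ‖σ t‖) (fun ℓ => ?_) (fun ℓ => ?_) hσ.norm ?_
  · exact (hcc ℓ).aestronglyMeasurable.mul hσ.ofReal.1
  · exact Eventually.of_forall fun t => by simp
  · refine Eventually.of_forall fun t => Continuous.mul ?_ continuous_const
    exact continuous_char.comp (continuous_dot.comp (continuous_id.prodMk continuous_const)).neg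

lemma norm_ft_le (F : E₁ × E₂ → ℝ) (κ : E₁ × E₂) : ‖ft F κ‖ ≤ ∫ z, ‖F z‖ := by
  refine (norm_integral_le_integral_norm _).trans (le_of_eq ?_)
  simp

/-- The ridgelet reproducing formula. -/
lemma integral_ridgelet_eq {σ : ℝ × ℝ → ℝ} (hσ : Integrable σ) (hF : ContDiff ℝ ∞ F)
    (hFc : HasCompactSupport F) (hψ : ContDiff ℝ ∞ ψ) (hψc : HasCompactSupport ψ) {a b : ℕ}
    (hadm : ∫⁻ ℓ, ‖ft ψ ℓ‖ₑ * ENNReal.ofReal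
        (admWeight (Module.finrank ℝ E₁) (Module.finrank ℝ E₂) a b ℓ) < ⊤)
    (hfin : ∫⁻ κ, ‖ft F κ‖ₑ * ENNReal.ofReal (weight a b κ) < ⊤) (z : E₁ × E₂) :
    ∫ ξ, ∫ t, ((σ (pairing ξ z + t) * ridgelet F ψ ξ t : ℝ) : ℂ) =
      (∫ ℓ, ft ψ ℓ * ft σ ℓ * (dilScale (Module.finrank ℝ E₁) (Module.finrank ℝ E₂) ℓ : ℂ)) *
        F z := by
  have hFm := continuous_ft hF hFc
  have hψm := continuous_ft hψ hψc
  have hσm := continuous_ft_of_integrable hσ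
  have hdil : Continuous fun p : (E₁ × E₂) × (ℝ × ℝ) => dil p.2 p.1 :=
    continuous_dil.comp (continuous_snd.prodMk continuous_fst)
  have hshift : ∀ (A ℓ : ℝ × ℝ), ∫ t, (σ (A + t) : ℂ) * char (-dot ℓ t) =
      char (dot ℓ A) * ft σ ℓ := by
    intro A ℓ
    rw [ft, ← integral_const_mul,
      ← integral_add_left_eq_self (fun t => char (dot ℓ A) * (char (-dot ℓ t) * (σ t : ℂ))) A]
    refine integral_congr_ae (Eventually.of_forall fun t => ?_)
    simp only [dot_add, neg_add, char_add]
    rw [← mul_assoc, ← mul_assoc, ← char_add, add_neg_cancel, char_zero]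
    ring
  -- Integrating out the bias replaces the translate of σ by `ft σ ℓ` times a character in z.
  have hinner : ∀ ξ : E₁ × E₂, ∫ t, ((σ (pairing ξ z + t) * ridgelet F ψ ξ t : ℝ) : ℂ) =
      ∫ ℓ, ft ψ ℓ * ft σ ℓ * (char (dot (dil ℓ ξ) z) * ft F (dil ℓ ξ)) := by
    intro ξ
    have hd : Continuous fun ℓ : ℝ × ℝ => dil ℓ ξ :=
      continuous_dil.comp (continuous_id.prodMk continuous_const)
    have h1 : ∀ t, ((σ (pairing ξ z + t) * ridgelet F ψ ξ t : ℝ) : ℂ) =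
        ∫ ℓ, (σ (pairing ξ z + t) : ℂ) * (ft ψ ℓ * char (-dot ℓ t) * ft F (dil ℓ ξ)) := by
      intro t
      rw [Complex.ofReal_mul, ridgelet_eq hF hFc hψ hψc, integral_const_mul]
    simp only [h1]
    rw [integral_integral_swap]
    · refine integral_congr_ae (Eventually.of_forall fun ℓ => ?_)
      simp only []
      have h2 : ∀ t, (σ (pairing ξ z + t) : ℂ) * (ft ψ ℓ * char (-dot ℓ t) * ft F (dil ℓ ξ)) =
          ft ψ ℓ * ft F (dil ℓ ξ) * ((σ (pairing ξ z + t) : ℂ) * char (-dot ℓ t)) := fun t => by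
        ring
      simp only [h2]
      rw [integral_const_mul, hshift, dot_pairing]
      ring
    · have hi1 : Integrable fun t => (σ (pairing ξ z + t) : ℂ) :=
        (hσ.comp_add_left (pairing ξ z)).ofReal
      have hi2 : Integrable fun ℓ => ft ψ ℓ * ft F (dil ℓ ξ) := by
        refine (integrable_ft hψ hψc).mul_bdd (c := ∫ z, ‖F z‖)
          (hFm.comp hd).aestronglyMeasurable (Eventually.of_forall fun ℓ => norm_ft_le F _)
      refine (hi1.mul_prod hi2).mono ?_ (Eventually.of_forall fun p => ?_)
      · have hc : Continuous fun p : (ℝ × ℝ) × (ℝ × ℝ) =>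
            ft ψ p.2 * char (-dot p.2 p.1) * ft F (dil p.2 ξ) :=
          ((hψm.comp continuous_snd).mul (continuous_char.comp
            (continuous_dot.comp (continuous_snd.prodMk continuous_fst)).neg)).mul
            (hFm.comp (hd.comp continuous_snd))
        exact hi1.1.comp_fst.mul hc.aestronglyMeasurable
      · simp [Function.uncurry]
  simp only [hinner]
  rw [integral_integral_swap, ← integral_mul_const]
  · refine integral_congr_ae ?_
    filter_upwards [ae_ne_zero_prod] with ℓ hℓ
    have hd : Continuous fun ξ : E₁ × E₂ => dil ℓ ξ :=
      continuous_dil.comp (continuous_const.prodMk continuous_id)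
    have hGc : Continuous fun κ => char (dot κ z) * ft F κ :=
      (continuous_char.comp (continuous_dot.comp (continuous_id.prodMk continuous_const))).mul hFm
    -- After κ = `dil ℓ ξ`, the ξ-integral is Fourier inversion of F at z. It no longer depends on ℓ
    -- except through the Jacobian, so F(z) factors out.
    rw [integral_const_mul,
      ← integral_map (φ := dil ℓ) (f := fun κ => char (dot κ z) * ft F κ) hd.measurable.aemeasurable
      hGc.aestronglyMeasurable, map_dil hℓ.1 hℓ.2, integral_smul_measure, ← ft_inversion hF hFc,
      ENNReal.toReal_ofReal (dilScale_nonneg _ _ _), Complex.real_smul]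
    ring
  · have hcc : Continuous fun p : (E₁ × E₂) × (ℝ × ℝ) =>
        ft ψ p.2 * ft σ p.2 * (char (dot (dil p.2 p.1) z) * ft F (dil p.2 p.1)) :=
      ((hψm.comp continuous_snd).mul (hσm.comp continuous_snd)).mul
        ((continuous_char.comp (continuous_dot.comp (hdil.prodMk continuous_const))).mul
          (hFm.comp hdil))
    refine ⟨hcc.aestronglyMeasurable, ?_⟩
    refine (lintegral_prod _ hcc.measurable.enorm.aemeasurable).trans_lt ?_
    -- Absolute integrability follows from the weighted bound, because `ft σ` is bounded and the
    -- weight is at least one.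
    have hle := lintegral_weight_mul_lintegral_ft_dil_le hF hFc hψ hψc a b
    have hlt := hle.trans_lt (ENNReal.mul_lt_top hadm hfin)
    set S := ENNReal.ofReal (∫ t, ‖σ t‖) with hS
    refine lt_of_le_of_lt ?_ (ENNReal.mul_lt_top (a := S) ENNReal.ofReal_lt_top hlt)
    rw [← lintegral_const_mul' _ _ ENNReal.ofReal_ne_top]
    refine lintegral_mono fun ξ => ?_
    calc _ ≤ ∫⁻ ℓ, S * (‖ft ψ ℓ‖ₑ * ‖ft F (dil ℓ ξ)‖ₑ) := by
          refine lintegral_mono fun ℓ => ?_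
          simp only [enorm_mul]
          rw [← ofReal_norm (char _), norm_char, ENNReal.ofReal_one, one_mul]
          have : ‖ft σ ℓ‖ₑ ≤ S := by
            rw [← ofReal_norm]
            exact ENNReal.ofReal_le_ofReal (norm_ft_le σ ℓ)
          calc _ ≤ ‖ft ψ ℓ‖ₑ * S * ‖ft F (dil ℓ ξ)‖ₑ := by gcongr
            _ = _ := by ring
      _ = S * ∫⁻ ℓ, ‖ft ψ ℓ‖ₑ * ‖ft F (dil ℓ ξ)‖ₑ :=
          lintegral_const_mul' _ _ ENNReal.ofReal_ne_top
      _ ≤ _ := by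
          gcongr
          refine le_mul_of_one_le_left zero_le ?_
          rw [← ENNReal.ofReal_one]
          exact ENNReal.ofReal_le_ofReal (one_le_weight a b ξ)

end Ridgelet

/-! ### Existence of an admissible window. -/

section Window

open Filter Topology

lemma dot_sub_left {G₁ G₂ : Type*} [NormedAddCommGroup G₁] [InnerProductSpace ℝ G₁]
    [NormedAddCommGroup G₂] [InnerProductSpace ℝ G₂] (κ μ z : G₁ × G₂) :
    dot (κ - μ) z = dot κ z - dot μ z := by
  simp only [dot, Prod.fst_sub, Prod.snd_sub, inner_sub_left]; ring

lemma dot_smul_left {G₁ G₂ : Type*} [NormedAddCommGroup G₁] [InnerProductSpace ℝ G₁]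
    [NormedAddCommGroup G₂] [InnerProductSpace ℝ G₂] (c : ℝ) (κ z : G₁ × G₂) :
    dot (c • κ) z = dot κ (c • z) := by
  simp only [dot, Prod.smul_fst, Prod.smul_snd, real_inner_smul_left, real_inner_smul_right]

/-- An integrable function whose Fourier transform vanishes almost everywhere is zero. -/
lemma ae_eq_zero_of_ft_ae_eq_zero {σ : ℝ × ℝ → ℝ} (hσ : Integrable σ)
    (h : ∀ᵐ ℓ, ft σ ℓ = 0) : σ =ᵐ[volume] 0 := by
  have h0 : ∀ᵐ ℓ : ℝ × ℝ, ft σ (-ℓ) = 0 :=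
    (Measure.measurePreserving_neg (volume : Measure (ℝ × ℝ))).quasiMeasurePreserving.ae h
  refine ae_eq_zero_of_integral_contDiff_smul_eq_zero hσ.locallyIntegrable fun φ hφ hφc => ?_
  have hcc : Continuous fun p : (ℝ × ℝ) × (ℝ × ℝ) => char (dot p.2 p.1) * ft φ p.2 :=
    (continuous_char.comp (continuous_dot.comp (continuous_snd.prodMk continuous_fst))).mul
      ((continuous_ft hφ hφc).comp continuous_snd)
  -- The multiplication formula: pairing σ with a test function φ equals pairing `ft φ` with the
  -- reflected `ft σ`.
  have key : ((∫ t, φ t • σ t : ℝ) : ℂ) = 0 := by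
    rw [← integral_complex_ofReal]
    calc ∫ t, ((φ t • σ t : ℝ) : ℂ) = ∫ t, ∫ ℓ, (σ t : ℂ) * (char (dot ℓ t) * ft φ ℓ) := by
          refine integral_congr_ae (Eventually.of_forall fun t => ?_)
          beta_reduce
          rw [integral_const_mul, ← ft_inversion hφ hφc, smul_eq_mul, Complex.ofReal_mul, mul_comm]
      _ = ∫ ℓ, ∫ t, (σ t : ℂ) * (char (dot ℓ t) * ft φ ℓ) := by
          rw [integral_integral_swap]
          refine (hσ.ofReal.mul_prod (integrable_ft hφ hφc)).mono
            (hσ.ofReal.1.comp_fst.mul hcc.aestronglyMeasurable)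
            (Eventually.of_forall fun p => ?_)
          simp [Function.uncurry]
      _ = ∫ ℓ, ft φ ℓ * ft σ (-ℓ) := by
          refine integral_congr_ae (Eventually.of_forall fun ℓ => ?_)
          beta_reduce
          rw [show ft σ (-ℓ) = ∫ t, char (-dot (-ℓ) t) * (σ t : ℂ) from rfl, ← integral_const_mul]
          refine integral_congr_ae (Eventually.of_forall fun t => ?_)
          have : -dot (-ℓ) t = dot ℓ t := by
            simp only [dot, Prod.fst_neg, Prod.snd_neg, inner_neg_left]
            ring
          beta_reduce
          rw [this]
          ring
      _ = 0 := by
          rw [integral_eq_zero_of_ae]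
          filter_upwards [h0] with ℓ hℓ
          simp [hℓ]
  exact_mod_cast key

/-- A function of polynomial growth that annihilates the Fourier transforms of all test functions
vanishes at its points of continuity. -/
lemma eq_zero_of_integral_mul_ft_eq_zero {g : ℝ × ℝ → ℂ} (hgm : Measurable g) {K : ℝ} {p : ℕ}
    (hg : ∀ ℓ, ‖g ℓ‖ ≤ K * (1 + ‖ℓ‖) ^ p)
    (h : ∀ η : ℝ × ℝ → ℝ, ContDiff ℝ ∞ η → HasCompactSupport η → ∫ ℓ, ft η ℓ * g ℓ = 0)
    {μ : ℝ × ℝ} (hμ : ContinuousAt g μ) : g μ = 0 := by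
  have hK : 0 ≤ K := by simpa using (norm_nonneg _).trans (hg 0)
  set η₀ : ContDiffBump (0 : ℝ × ℝ) := ⟨1, 2, one_pos, one_lt_two⟩
  have hη : ContDiff ℝ ∞ η₀ := η₀.contDiff
  have hηc : HasCompactSupport η₀ := η₀.hasCompactSupport
  have hint : ∀ η : ℝ × ℝ → ℝ, ContDiff ℝ ∞ η → HasCompactSupport η →
      Integrable fun ℓ => ft η ℓ * g ℓ := by
    intro η h1 h2
    refine ((integrable_ft_mul h1 h2 p).const_mul K).mono'
      ((continuous_ft h1 h2).measurable.mul hgm).aestronglyMeasurable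
      (Eventually.of_forall fun ℓ => ?_)
    rw [norm_mul]
    calc _ ≤ ‖ft η ℓ‖ * (K * (1 + ‖ℓ‖) ^ p) := by gcongr; exact hg ℓ
      _ = _ := by ring
  -- Modulating and dilating η₀ translates its Fourier transform to μ and concentrates it there.
  -- Test functions are real, so the modulation is split into its cosine and sine parts.
  have hscaled : ∀ ε : ℝ, 0 < ε → ∫ s, ft η₀ s * g (μ + ε • s) = 0 := by
    intro ε hε
    set c : ℝ × ℝ → ℝ := fun t => Real.cos (2 * Real.pi * dot μ t) * η₀ (ε • t)
    set s : ℝ × ℝ → ℝ := fun t => Real.sin (2 * Real.pi * dot μ t) * η₀ (ε • t)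
    have hdot : ContDiff ℝ ∞ fun t : ℝ × ℝ => 2 * Real.pi * dot μ t := by
      unfold dot
      exact contDiff_const.mul ((contDiff_const.inner ℝ contDiff_fst).add
        (contDiff_const.inner ℝ contDiff_snd))
    have hes : ContDiff ℝ ∞ fun t : ℝ × ℝ => η₀ (ε • t) := hη.comp (contDiff_const_smul ε)
    have hec : HasCompactSupport fun t : ℝ × ℝ => η₀ (ε • t) :=
      hηc.comp_homeomorph (Homeomorph.smulOfNeZero ε hε.ne')
    have hc1 : ContDiff ℝ ∞ c := (Real.contDiff_cos.comp hdot).mul hes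
    have hs1 : ContDiff ℝ ∞ s := (Real.contDiff_sin.comp hdot).mul hes
    have hc2 : HasCompactSupport c := hec.mul_left
    have hs2 : HasCompactSupport s := hec.mul_left
    set J : ℝ := |(ε ^ Module.finrank ℝ (ℝ × ℝ))⁻¹| with hJ
    have hJ0 : J ≠ 0 := by positivity
    have hii : ∀ (η : ℝ × ℝ → ℝ), ContDiff ℝ ∞ η → HasCompactSupport η → ∀ ℓ : ℝ × ℝ,
        Integrable fun t => char (-dot ℓ t) * (η t : ℂ) := fun η h1 h2 ℓ =>
      ((continuous_char.comp (continuous_dot.comp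
        (continuous_const.prodMk continuous_id)).neg).mul
        (Complex.continuous_ofReal.comp h1.continuous)).integrable_of_hasCompactSupport
      (HasCompactSupport.mul_left (h2.comp_left (g := fun x : ℝ => (x : ℂ)) (by simp)))
    have hchar : ∀ x : ℝ, char x = Real.cos (2 * Real.pi * x) +
        Real.sin (2 * Real.pi * x) * Complex.I := by
      intro x
      rw [char, Real.fourierChar_apply, Complex.exp_mul_I, Complex.ofReal_cos, Complex.ofReal_sin]
    have hft : ∀ ℓ, ft c ℓ + Complex.I * ft s ℓ = J * ft η₀ (ε⁻¹ • (ℓ - μ)) := by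
      intro ℓ
      have h1 : ft c ℓ + Complex.I * ft s ℓ =
          ∫ t, char (-dot (ℓ - μ) t) * (η₀ (ε • t) : ℂ) := by
        rw [ft, ft, ← integral_const_mul, ← integral_add (hii c hc1 hc2 ℓ)
          ((hii s hs1 hs2 ℓ).const_mul _)]
        refine integral_congr_ae (Eventually.of_forall fun t => ?_)
        beta_reduce
        rw [dot_sub_left, neg_sub, sub_eq_add_neg, add_comm (dot μ t), char_add, hchar (dot μ t)]
        simp only [c, s, Complex.ofReal_mul]
        ring
      rw [h1]
      have h2 := Measure.integral_comp_smul (volume : Measure (ℝ × ℝ))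
        (fun u => char (-dot (ε⁻¹ • (ℓ - μ)) u) * (η₀ u : ℂ)) ε
      rw [Complex.real_smul] at h2
      rw [ft, ← h2]
      refine integral_congr_ae (Eventually.of_forall fun t => ?_)
      beta_reduce
      rw [dot_smul_left, smul_smul, inv_mul_cancel₀ hε.ne', one_smul]
    have h3 : ∫ ℓ, (J * ft η₀ (ε⁻¹ • (ℓ - μ))) * g ℓ = 0 := by
      have e1 : ∀ ℓ, (J * ft η₀ (ε⁻¹ • (ℓ - μ))) * g ℓ =
          ft c ℓ * g ℓ + Complex.I * (ft s ℓ * g ℓ) := by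
        intro ℓ
        rw [← hft]; ring
      simp only [e1]
      rw [integral_add (hint c hc1 hc2) ((hint s hs1 hs2).const_mul _), integral_const_mul,
        h c hc1 hc2, h s hs1 hs2]
      simp
    rw [← integral_add_left_eq_self _ μ] at h3
    simp only [add_sub_cancel_left, mul_assoc] at h3
    rw [integral_const_mul] at h3
    have h4 := (mul_eq_zero.1 h3).resolve_left (by exact_mod_cast hJ0)
    have h5 := Measure.integral_comp_smul (volume : Measure (ℝ × ℝ))
        (fun u => ft η₀ (ε⁻¹ • u) * g (μ + u)) ε
    rw [h4, smul_zero] at h5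
    rw [← h5]
    refine integral_congr_ae (Eventually.of_forall fun t => ?_)
    beta_reduce
    rw [smul_smul, inv_mul_cancel₀ hε.ne', one_smul]
  set ε : ℕ → ℝ := fun n => 1 / ((n : ℝ) + 1) with hε
  have hε0 : Tendsto ε atTop (𝓝 0) := tendsto_one_div_add_atTop_nhds_zero_nat
  have hεp : ∀ n, 0 < ε n := fun n => by positivity
  have hε1 : ∀ n, ε n ≤ 1 := fun n => by
    simp only [hε]
    rw [div_le_one (by positivity)]
    linarith [(Nat.cast_nonneg n : (0 : ℝ) ≤ n)]
  have hlim : Tendsto (fun n => ∫ s, ft η₀ s * g (μ + ε n • s)) atTop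
      (𝓝 (∫ s, ft η₀ s * g μ)) := by
    refine tendsto_integral_of_dominated_convergence
      (fun s => K * (1 + ‖μ‖) ^ p * ((1 + ‖s‖) ^ p * ‖ft η₀ s‖)) (fun n => ?_)
      ((integrable_ft_mul hη hηc p).const_mul _) (fun n => ?_) ?_
    · refine ((continuous_ft hη hηc).measurable.mul (hgm.comp ?_)).aestronglyMeasurable
      fun_prop
    · refine Eventually.of_forall fun s => ?_
      have h1 : 1 + ‖μ + ε n • s‖ ≤ (1 + ‖μ‖) * (1 + ‖s‖) := by
        have h2 := norm_add_le μ (ε n • s)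
        rw [norm_smul, Real.norm_of_nonneg (hεp n).le] at h2
        nlinarith [norm_nonneg μ, norm_nonneg s, hε1 n,
          mul_le_mul_of_nonneg_right (hε1 n) (norm_nonneg s),
          mul_nonneg (norm_nonneg μ) (norm_nonneg s)]
      rw [norm_mul]
      calc _ ≤ ‖ft η₀ s‖ * (K * ((1 + ‖μ‖) * (1 + ‖s‖)) ^ p) := by
            gcongr
            exact (hg _).trans (by gcongr)
        _ = _ := by rw [mul_pow]; ring
    · refine Eventually.of_forall fun s => Tendsto.const_mul _ ?_
      refine hμ.tendsto.comp ?_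
      have := (hε0.smul_const s).const_add μ
      simpa using this
  have h0 : ∀ n, ∫ s, ft η₀ s * g (μ + ε n • s) = 0 := fun n => hscaled _ (hεp n)
  simp only [h0] at hlim
  have h1 := tendsto_nhds_unique hlim tendsto_const_nhds
  rw [integral_mul_const] at h1
  -- The mass of the concentrating kernel is η₀(0) by Fourier inversion, so the limit is g(μ)
  -- itself.
  have h2 : ∫ s, ft η₀ s = 1 := by
    have := ft_inversion hη hηc 0
    simp only [dot, Prod.fst_zero, Prod.snd_zero, inner_zero_right, add_zero, char_zero,
      one_mul] at this
    rw [← this, η₀.one_of_mem_closedBall (by simp [η₀])]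
    simp
  rwa [h2, one_mul] at h1

/-- Existence of an admissible window for a given integrable activation function. -/
lemma exists_admissible_window {σ : ℝ × ℝ → ℝ} (hσ : Integrable σ) (hσ0 : ¬ σ =ᵐ[volume] 0)
    (D₁ D₂ a b : ℕ) :
    ∃ ψ : ℝ × ℝ → ℝ, ContDiff ℝ ∞ ψ ∧ HasCompactSupport ψ ∧
      ∫⁻ ℓ, ‖ft ψ ℓ‖ₑ * ENNReal.ofReal (admWeight D₁ D₂ a b ℓ) < ⊤ ∧
      ∫ ℓ, ft ψ ℓ * ft σ ℓ * (dilScale D₁ D₂ ℓ : ℂ) ≠ 0 := by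
  -- Windows are sought among derivatives of test functions. The symbol P vanishes to order D₁+a and
  -- D₂+b on the two axes, exactly enough to cancel the singularities of `admWeight`.
  set L : List (ℝ × ℝ) := List.replicate (D₁ + a) (1, 0) ++ List.replicate (D₂ + b) (0, 1) with hL
  set P : ℝ × ℝ → ℂ := fun ℓ => (2 * Real.pi * Complex.I * ℓ.1) ^ (D₁ + a) *
    (2 * Real.pi * Complex.I * ℓ.2) ^ (D₂ + b) with hP
  have hft : ∀ η : ℝ × ℝ → ℝ, ContDiff ℝ ∞ η → HasCompactSupport η → ∀ ℓ,
      ft (listDeriv L η) ℓ = P ℓ * ft η ℓ := by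
    intro η h1 h2 ℓ
    rw [ft_listDeriv h1 h2]
    simp [hL, hP, dot]
  set A : ℝ := (2 * Real.pi) ^ (D₁ + a) * (2 * Real.pi) ^ (D₂ + b) with hA
  have hA0 : 0 ≤ A := by positivity
  have hPn : ∀ ℓ, ‖P ℓ‖ = A * (|ℓ.1| ^ (D₁ + a) * |ℓ.2| ^ (D₂ + b)) := by
    intro ℓ
    simp only [hP, norm_mul, norm_pow, Complex.norm_real, Complex.norm_I, Complex.norm_ofNat,
      Real.norm_eq_abs, abs_of_pos Real.pi_pos, hA, mul_pow]
    ring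
  have hone : ∀ (D a : ℕ) (t : ℝ), |t| ^ (D + a) * (|(t ^ D)⁻¹| * (1 + ‖t⁻¹‖) ^ a) ≤
      (1 + |t|) ^ a := by
    intro D a t
    rcases eq_or_ne t 0 with rfl | ht
    · rcases Nat.eq_zero_or_pos (D + a) with h | h
      · obtain ⟨rfl, rfl⟩ : D = 0 ∧ a = 0 := by omega
        simp
      · simp [zero_pow (by omega : D + a ≠ 0)]
    · have ht' : |t| ≠ 0 := abs_ne_zero.2 ht
      refine le_of_eq ?_
      rw [abs_inv, abs_pow, norm_inv, Real.norm_eq_abs, pow_add]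
      calc _ = (|t| ^ D * (|t| ^ D)⁻¹) * (|t| * (1 + |t|⁻¹)) ^ a := by rw [mul_pow]; ring
        _ = (1 + |t|) ^ a := by
          rw [mul_inv_cancel₀ (pow_ne_zero _ ht'), one_mul, mul_add, mul_inv_cancel₀ ht', mul_one,
            add_comm]
  have hadm : ∀ ℓ, ‖P ℓ‖ * admWeight D₁ D₂ a b ℓ ≤ A * (1 + ‖ℓ‖) ^ (a + b) := by
    intro ℓ
    have h1 := hone D₁ a ℓ.1
    have h2 := hone D₂ b ℓ.2
    rw [hPn, admWeight, dilScale, weight]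
    calc _ = A * ((|ℓ.1| ^ (D₁ + a) * (|(ℓ.1 ^ D₁)⁻¹| * (1 + ‖ℓ.1⁻¹‖) ^ a)) *
          (|ℓ.2| ^ (D₂ + b) * (|(ℓ.2 ^ D₂)⁻¹| * (1 + ‖ℓ.2⁻¹‖) ^ b))) := by ring
      _ ≤ A * ((1 + |ℓ.1|) ^ a * (1 + |ℓ.2|) ^ b) := by gcongr
      _ ≤ A * ((1 + ‖ℓ‖) ^ a * (1 + ‖ℓ‖) ^ b) := by
          gcongr
          · exact norm_fst_le ℓ
          · exact norm_snd_le ℓ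
      _ = _ := by rw [pow_add]
  set g : ℝ × ℝ → ℂ := fun ℓ => P ℓ * ft σ ℓ * (dilScale D₁ D₂ ℓ : ℂ) with hg
  have hσc := continuous_ft_of_integrable hσ
  have hPc : Continuous P := by simp only [hP]; fun_prop
  have hsm : Measurable (dilScale D₁ D₂) := by unfold dilScale; fun_prop
  have hgm : Measurable g :=
    (hPc.measurable.mul hσc.measurable).mul (Complex.measurable_ofReal.comp hsm)
  have hgb : ∀ ℓ, ‖g ℓ‖ ≤ (A * ∫ t, ‖σ t‖) * (1 + ‖ℓ‖) ^ (a + b) := by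
    intro ℓ
    have h1 : dilScale D₁ D₂ ℓ ≤ admWeight D₁ D₂ a b ℓ :=
      le_mul_of_one_le_right (dilScale_nonneg _ _ _) (one_le_weight _ _ _)
    have h2 := norm_ft_le σ ℓ
    calc ‖g ℓ‖ = ‖ft σ ℓ‖ * (‖P ℓ‖ * dilScale D₁ D₂ ℓ) := by
          simp only [hg, norm_mul, Complex.norm_real, Real.norm_of_nonneg (dilScale_nonneg _ _ _)]
          ring
      _ ≤ (∫ t, ‖σ t‖) * (A * (1 + ‖ℓ‖) ^ (a + b)) := by
          refine mul_le_mul h2 ((mul_le_mul_of_nonneg_left h1 (norm_nonneg _)).trans (hadm ℓ))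
            (mul_nonneg (norm_nonneg _) (dilScale_nonneg _ _ _)) ((norm_nonneg _).trans h2)
      _ = _ := by ring
  -- If all these windows gave the constant zero, g would annihilate every `ft η` and so vanish off
  -- the axes, where it is continuous. There P and the Jacobian are nonzero, which forces `ft σ` = 0
  -- almost everywhere.
  by_contra! hcon
  refine hσ0 (ae_eq_zero_of_ft_ae_eq_zero hσ ?_)
  have hzero : ∀ η : ℝ × ℝ → ℝ, ContDiff ℝ ∞ η → HasCompactSupport η →
      ∫ ℓ, ft η ℓ * g ℓ = 0 := by
    intro η h1 h2
    have h3 := hcon (listDeriv L η) (contDiff_listDeriv h1 L) (hasCompactSupport_listDeriv h2 L) ?_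
    · rw [← h3]
      refine integral_congr_ae (Eventually.of_forall fun ℓ => ?_)
      simp only [hg, hft η h1 h2]
      ring
    · have hi := ((integrable_ft_mul h1 h2 (a + b)).const_mul A).lintegral_lt_top
      refine lt_of_le_of_lt (lintegral_mono fun ℓ => ?_) hi
      rw [hft η h1 h2, ← ofReal_norm, ← ENNReal.ofReal_mul (norm_nonneg _), norm_mul]
      refine ENNReal.ofReal_le_ofReal ?_
      calc _ = (‖P ℓ‖ * admWeight D₁ D₂ a b ℓ) * ‖ft η ℓ‖ := by ring
        _ ≤ (A * (1 + ‖ℓ‖) ^ (a + b)) * ‖ft η ℓ‖ :=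
          mul_le_mul_of_nonneg_right (hadm ℓ) (norm_nonneg _)
        _ = _ := by ring
  filter_upwards [ae_ne_zero_prod] with ℓ hℓ
  have hcont : ContinuousAt g ℓ := by
    refine (hPc.continuousAt.mul hσc.continuousAt).mul
      (Complex.continuous_ofReal.continuousAt.comp ?_)
    unfold dilScale
    exact ((continuousAt_fst.pow _).inv₀ (pow_ne_zero _ hℓ.1)).abs.mul
      ((continuousAt_snd.pow _).inv₀ (pow_ne_zero _ hℓ.2)).abs
  have h1 := eq_zero_of_integral_mul_ft_eq_zero hgm hgb hzero hcont
  have h2 : P ℓ ≠ 0 := by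
    rw [← norm_ne_zero_iff, hPn]
    have := abs_pos.2 hℓ.1
    have := abs_pos.2 hℓ.2
    positivity
  have h3 : (dilScale D₁ D₂ ℓ : ℂ) ≠ 0 := by
    rw [Complex.ofReal_ne_zero]
    exact mul_ne_zero (abs_ne_zero.2 (inv_ne_zero (pow_ne_zero _ hℓ.1)))
      (abs_ne_zero.2 (inv_ne_zero (pow_ne_zero _ hℓ.2)))
  simp only [hg] at h1
  exact (mul_eq_zero.1 ((mul_eq_zero.1 h1).resolve_right h3)).resolve_left h2

end Window

/-! ### Maurey's sampling lemma in Hilbert space. -/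

section Maurey

variable {H : Type*} [NormedAddCommGroup H] [InnerProductSpace ℝ H]

/-- For a random s with mean f, the expectation of the left side is E‖s‖² - ‖f‖² ≤ B². In half-space
form: if every s failed, S would lie in an open half-space that does not contain f. -/
lemma exists_inner_add_norm_sq_le {S : Set H} {B : ℝ} (hB : ∀ s ∈ S, ‖s‖ ≤ B) {f : H}
    (hf : f ∈ convexHull ℝ S) (e : H) :
    ∃ s ∈ S, 2 * inner ℝ e (f - s) + ‖f - s‖ ^ 2 ≤ B ^ 2 := by
  by_contra! hcon
  have hsub : S ⊆ {x | inner ℝ (e + f) x < inner ℝ e f + ‖f‖ ^ 2 / 2} := by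
    intro s hs
    have h1 := hcon s hs
    have h2 : ‖s‖ ^ 2 ≤ B ^ 2 := by gcongr; exact hB s hs
    rw [norm_sub_sq_real, inner_sub_right] at h1
    rw [Set.mem_ofPred_eq, inner_add_left]
    linarith
  have hconv : Convex ℝ {x | inner ℝ (e + f) x < inner ℝ e f + ‖f‖ ^ 2 / 2} :=
    convex_halfSpace_lt (innerSL ℝ (e + f)).isLinear _
  have h3 := convexHull_min hsub hconv hf
  rw [Set.mem_ofPred_eq, inner_add_left, real_inner_self_eq_norm_sq] at h3
  nlinarith [sq_nonneg ‖f‖]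

/-- A greedy choice in place of random sampling: with e the current error, the next element raises
the squared error by at most B². -/
lemma exists_norm_sum_sub_sq_le {S : Set H} {B : ℝ} (hB : ∀ s ∈ S, ‖s‖ ≤ B) {f : H}
    (hf : f ∈ convexHull ℝ S) (N : ℕ) :
    ∃ s : Fin N → H, (∀ i, s i ∈ S) ∧ ‖(N : ℝ) • f - ∑ i, s i‖ ^ 2 ≤ N * B ^ 2 := by
  induction N with
  | zero => exact ⟨Fin.elim0, fun i => i.elim0, by simp⟩
  | succ N ih =>
    obtain ⟨s, hs, hle⟩ := ih
    obtain ⟨t, ht, htle⟩ := exists_inner_add_norm_sq_le hB hf ((N : ℝ) • f - ∑ i, s i)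
    refine ⟨Fin.snoc s t, fun i => ?_, ?_⟩
    · refine Fin.lastCases ?_ (fun j => ?_) i
      · simpa using ht
      · simpa using hs j
    · have : ((N + 1 : ℕ) : ℝ) • f - ∑ i, (Fin.snoc s t : Fin (N + 1) → H) i =
          ((N : ℝ) • f - ∑ i, s i) + (f - t) := by
        rw [Fin.sum_univ_castSucc]
        simp only [Fin.snoc_castSucc, Fin.snoc_last]
        push_cast
        rw [add_smul, one_smul]
        abel
      rw [this, norm_add_sq_real]
      push_cast
      linarith

/-- Maurey's approximation rate in a real inner product space. -/
lemma exists_norm_sub_average_le {S : Set H} {B : ℝ} (hB : ∀ s ∈ S, ‖s‖ ≤ B) (hB0 : 0 ≤ B) {f : H}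
    (hf : f ∈ closure (convexHull ℝ S)) {N : ℕ} (hN : 1 ≤ N) {ε : ℝ} (hε : 0 < ε) :
    ∃ s : Fin N → H, (∀ i, s i ∈ S) ∧
      ‖f - (N : ℝ)⁻¹ • ∑ i, s i‖ ≤ B * (N : ℝ) ^ (-(1 / 2) : ℝ) + ε := by
  obtain ⟨g, hg, hfg⟩ := Metric.mem_closure_iff.1 hf ε hε
  obtain ⟨s, hs, hle⟩ := exists_norm_sum_sub_sq_le hB hg N
  refine ⟨s, hs, ?_⟩
  have hN0 : (0 : ℝ) < N := by exact_mod_cast hN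
  have hsplit : f - (N : ℝ)⁻¹ • ∑ i, s i = (f - g) + (N : ℝ)⁻¹ • ((N : ℝ) • g - ∑ i, s i) := by
    rw [smul_sub, inv_smul_smul₀ hN0.ne']
    abel
  have h1 : ‖(N : ℝ) • g - ∑ i, s i‖ ≤ Real.sqrt N * B := by
    refine abs_le_of_sq_le_sq' ?_ (by positivity) |>.2
    rwa [mul_pow, Real.sq_sqrt hN0.le]
  have h2 : (N : ℝ)⁻¹ * (Real.sqrt N * B) = B * (N : ℝ) ^ (-(1 / 2) : ℝ) := by
    rw [Real.rpow_neg hN0.le, ← Real.sqrt_eq_rpow]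
    have h3 := Real.mul_self_sqrt hN0.le
    have h4 := Real.sqrt_pos.2 hN0
    field_simp
    rw [sq, h3]
  calc _ ≤ ‖f - g‖ + ‖(N : ℝ)⁻¹ • ((N : ℝ) • g - ∑ i, s i)‖ := hsplit ▸ norm_add_le _ _
    _ ≤ ε + (N : ℝ)⁻¹ * (Real.sqrt N * B) := by
        rw [norm_smul, Real.norm_of_nonneg (by positivity)]
        refine add_le_add (by rw [← dist_eq_norm]; exact hfg.le) ?_
        gcongr
    _ = _ := by rw [h2, add_comm]

end Maurey

/-! ### Superpositions lie in closed convex hulls of atoms. -/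

section Duality

variable {X Θ : Type*} [MeasurableSpace X] [MeasurableSpace Θ] {m : Measure X}
  {τ : Measure Θ} {K : Θ → X → ℝ} {w a : Θ → ℝ} {A B : ℝ} {G : Set Θ}

/-- The multiples of the functions `K θ`, `θ ∈ G`, with coefficients bounded by `A / w θ`. -/
def atoms (m : Measure X) (K : Θ → X → ℝ) (w : Θ → ℝ) (G : Set Θ) (A : ℝ) : Set (Lp ℝ 2 m) :=
  {h | ∃ θ ∈ G, ∃ t : ℝ, |t| * w θ ≤ A ∧ h =ᵐ[m] fun x => t * K θ x}

lemma memLp_kernel [IsFiniteMeasure m] (hK : Measurable (Function.uncurry K))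
    (hKw : ∀ θ x, |K θ x| ≤ B * w θ) (θ : Θ) : MemLp (K θ) 2 m :=
  MemLp.of_bound (hK.comp measurable_prodMk_left).aestronglyMeasurable (B * w θ)
    (Filter.Eventually.of_forall fun x => hKw θ x)

/-- The weight cancels between coefficient and kernel, so atoms are bounded by AB pointwise. The
total mass of m is later the source of the factor |U|^½ |V|^½. -/
lemma norm_le_of_mem_atoms [IsFiniteMeasure m] (hw : ∀ θ, 0 < w θ) (hB : 0 ≤ B)
    (hKw : ∀ θ x, |K θ x| ≤ B * w θ) {h : Lp ℝ 2 m} (hh : h ∈ atoms m K w G A) :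
    ‖h‖ ≤ A * B * m.real Set.univ ^ (1 / 2 : ℝ) := by
  obtain ⟨θ, -, t, ht, hht⟩ := hh
  have hA : 0 ≤ A := (mul_nonneg (abs_nonneg t) (hw θ).le).trans ht
  have h1 : ∀ᵐ x ∂m, ‖h x‖ ≤ A * B := by
    filter_upwards [hht] with x hx
    rw [hx, norm_mul, Real.norm_eq_abs, Real.norm_eq_abs]
    calc _ ≤ |t| * (B * w θ) := by gcongr; exact hKw θ x
      _ = |t| * w θ * B := by ring
      _ ≤ _ := by gcongr
  have h2 := Lp.norm_le_of_ae_bound (mul_nonneg hA hB) h1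
  rw [mul_comm]
  refine h2.trans (le_of_eq ?_)
  rw [ENNReal.toReal_ofNat, one_div]
  rfl

/-- Otherwise a functional ⟨φ, ·⟩ stays below u on the atoms and exceeds u at F. Testing with t =
±A/w(θ) gives |⟨φ, K θ⟩| ≤ u w(θ)/A, and integrating against a yields ⟨φ, F⟩ ≤ (u/A) ∫ |a| w ≤ u. -/
lemma mem_closure_convexHull_atoms [IsFiniteMeasure m] [SFinite τ] (hA : 0 < A)
    (hK : Measurable (Function.uncurry K)) (hwm : Measurable w) (hw : ∀ θ, 0 < w θ)
    (hKw : ∀ θ x, |K θ x| ≤ B * w θ) (ha : Measurable a)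
    (haA : ∫⁻ θ, ‖a θ‖ₑ * ENNReal.ofReal (w θ) ∂τ ≤ ENNReal.ofReal A)
    (hG : ∀ᵐ θ ∂τ, θ ∈ G) (hGn : G.Nonempty) {F : Lp ℝ 2 m}
    (hF : ∀ᵐ x ∂m, F x = ∫ θ, K θ x * a θ ∂τ) :
    F ∈ closure (convexHull ℝ (atoms m K w G A)) := by
  by_contra hcon
  obtain ⟨Λ, u, hu, huF⟩ := geometric_hahn_banach_closed_point
    (convex_convexHull ℝ (atoms m K w G A)).closure isClosed_closure hcon
  have hat : ∀ h ∈ atoms m K w G A, Λ h < u := fun h hh =>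
    hu h (subset_closure (subset_convexHull ℝ _ hh))
  set φ : Lp ℝ 2 m := (InnerProductSpace.toDual ℝ _).symm Λ with hφ
  have hΛ : ∀ g : Lp ℝ 2 m, Λ g = ∫ x, φ x * g x ∂m := by
    intro g
    rw [← InnerProductSpace.toDual_symm_apply (𝕜 := ℝ) (x := g) (y := Λ), L2.inner_def]
    refine integral_congr_ae (Filter.Eventually.of_forall fun x => ?_)
    simp [hφ, mul_comm]
  -- The zero function is an atom.
  have hu0 : 0 < u := by
    obtain ⟨θ, hθ⟩ := hGn
    have := hat 0 ⟨θ, hθ, 0, by simpa using hA.le, by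
      filter_upwards [Lp.coeFn_zero ℝ 2 m] with x hx
      rw [hx, zero_mul, Pi.zero_apply]⟩
    simpa using this
  have hφi : Integrable φ m := (Lp.memLp φ).integrable (by norm_num)
  have haw : Integrable (fun θ => |a θ| * w θ) τ := by
    refine ⟨(ha.abs.mul hwm).aestronglyMeasurable, lt_of_le_of_lt ?_ (haA.trans_lt ENNReal.ofReal_lt_top)⟩
    refine lintegral_mono fun θ => ?_
    rw [enorm_mul, Real.enorm_abs, Real.enorm_of_nonneg (hw θ).le]
  have hawA : ∫ θ, |a θ| * w θ ∂τ ≤ A := by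
    rw [integral_eq_lintegral_of_nonneg_ae
      (Filter.Eventually.of_forall fun θ => mul_nonneg (abs_nonneg _) (hw θ).le) haw.1]
    refine ENNReal.toReal_le_of_le_ofReal hA.le (le_trans (lintegral_mono fun θ => ?_) haA)
    rw [ENNReal.ofReal_mul (abs_nonneg _), ← Real.norm_eq_abs, ofReal_norm]
  have hbound : ∀ θ ∈ G, |∫ x, φ x * K θ x ∂m| ≤ u * w θ / A := by
    intro θ hθ
    have key : ∀ t : ℝ, |t| * w θ ≤ A → t * ∫ x, φ x * K θ x ∂m ≤ u := by
      intro t ht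
      have hmem : MemLp (fun x => t * K θ x) 2 m := (memLp_kernel hK hKw θ).const_mul t
      have h1 := hat (hmem.toLp _) ⟨θ, hθ, t, ht, hmem.coeFn_toLp⟩
      rw [hΛ] at h1
      refine le_of_eq_of_le ?_ h1.le
      rw [← integral_const_mul]
      refine integral_congr_ae ?_
      filter_upwards [hmem.coeFn_toLp] with x hx
      rw [hx]
      ring
    have hwθ := hw θ
    have h1 := key (A / w θ) (by rw [abs_of_pos (by positivity)]; field_simp; exact le_rfl)
    have h2 := key (-(A / w θ)) (by rw [abs_neg, abs_of_pos (by positivity)]; field_simp; exact le_rfl)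
    rw [le_div_iff₀ hA, ← abs_of_pos hA, ← abs_mul, abs_le]
    constructor
    · have := mul_le_mul_of_nonneg_right h2 hwθ.le
      field_simp at this
      linarith
    · have := mul_le_mul_of_nonneg_right h1 hwθ.le
      field_simp at this
      linarith
  have hint : Integrable (fun p : X × Θ => φ p.1 * (K p.2 p.1 * a p.2)) (m.prod τ) := by
    refine ((hφi.norm.mul_prod haw).const_mul |B|).mono ?_ ?_
    · exact hφi.1.comp_fst.mul ((hK.comp measurable_swap).mul
        (ha.comp measurable_snd)).aestronglyMeasurable
    · refine Filter.Eventually.of_forall fun p => ?_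
      have hwp := (hw p.2).le
      simp only [norm_mul, Real.norm_eq_abs, abs_abs, abs_of_nonneg hwp]
      have := (hKw p.2 p.1).trans (mul_le_mul_of_nonneg_right (le_abs_self B) hwp)
      calc _ ≤ |φ p.1| * (|B| * w p.2 * |a p.2|) := by gcongr
        _ = _ := by ring
  have hΛF : Λ F = ∫ θ, a θ * ∫ x, φ x * K θ x ∂m ∂τ := by
    calc Λ F = ∫ x, ∫ θ, φ x * (K θ x * a θ) ∂τ ∂m := by
          rw [hΛ]
          refine integral_congr_ae ?_
          filter_upwards [hF] with x hx
          rw [hx, integral_const_mul]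
      _ = ∫ θ, ∫ x, φ x * (K θ x * a θ) ∂m ∂τ := integral_integral_swap hint
      _ = _ := by
          refine integral_congr_ae (Filter.Eventually.of_forall fun θ => ?_)
          beta_reduce
          rw [← integral_const_mul]
          refine integral_congr_ae (Filter.Eventually.of_forall fun x => ?_)
          beta_reduce
          ring
  refine absurd huF (not_lt.2 ?_)
  calc Λ F ≤ ∫ θ, u / A * (|a θ| * w θ) ∂τ := by
        rw [hΛF]
        refine integral_mono_ae ?_ (haw.const_mul _) ?_
        · refine hint.integral_prod_right.congr (Filter.Eventually.of_forall fun θ => ?_)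
          beta_reduce
          rw [← integral_const_mul]
          refine integral_congr_ae (Filter.Eventually.of_forall fun x => ?_)
          beta_reduce
          ring
        · filter_upwards [hG] with θ hθ
          calc _ ≤ |a θ| * |∫ x, φ x * K θ x ∂m| := by
                rw [← abs_mul]
                exact le_abs_self _
            _ ≤ |a θ| * (u * w θ / A) := by gcongr; exact hbound θ hθ
            _ = _ := by ring
    _ ≤ u / A * A := by
        rw [integral_const_mul]
        gcongr
    _ = u := by field_simp

/-- Approximation by `N` terms of a function which is a superposition of the functions `K θ`. -/
lemma exists_sum_kernel_approx [IsFiniteMeasure m] (hw : ∀ θ, 1 ≤ w θ) (hA : 0 ≤ A) (hB : 0 ≤ B)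
    (hKw : ∀ θ x, |K θ x| ≤ B * w θ) {F : Lp ℝ 2 m}
    (hF : F ∈ closure (convexHull ℝ (atoms m K w G A))) {N : ℕ} (hN : 1 ≤ N) {ε : ℝ} (hε : 0 < ε) :
    ∃ (c : Fin N → ℝ) (θ : Fin N → Θ), (∀ j, θ j ∈ G) ∧ ∑ j, |c j| ≤ A ∧
      eLpNorm (fun x => F x - ∑ j, c j * K (θ j) x) 2 m ≤
        ENNReal.ofReal (A * B * m.real Set.univ ^ (1 / 2 : ℝ) * (N : ℝ) ^ (-(1 / 2) : ℝ) + ε) := by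
  have hw0 : ∀ θ, 0 < w θ := fun θ => one_pos.trans_le (hw θ)
  obtain ⟨s, hs, hle⟩ := exists_norm_sub_average_le
    (fun h hh => norm_le_of_mem_atoms hw0 hB hKw hh) (by positivity) hF hN hε
  choose θ hθ t ht hst using hs
  have hN0 : (0 : ℝ) < N := by exact_mod_cast hN
  -- Since w ≥ 1, each |tⱼ| is at most A, and the N averaged coefficients sum to at most A in
  -- absolute value.
  refine ⟨fun j => (N : ℝ)⁻¹ * t j, θ, hθ, ?_, ?_⟩
  · have h1 : ∀ j, |(N : ℝ)⁻¹ * t j| ≤ (N : ℝ)⁻¹ * A := by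
      intro j
      rw [abs_mul, abs_of_pos (inv_pos.2 hN0)]
      gcongr
      refine le_trans ?_ (ht j)
      exact le_mul_of_one_le_right (abs_nonneg _) (hw _)
    refine (Finset.sum_le_sum fun j _ => h1 j).trans (le_of_eq ?_)
    simp
    field_simp
  · have hae : (fun x => F x - ∑ j, (N : ℝ)⁻¹ * t j * K (θ j) x) =ᵐ[m]
        (F - (N : ℝ)⁻¹ • ∑ j, s j : Lp ℝ 2 m) := by
      have hsum : ∀ᵐ x ∂m, (∑ j, s j : Lp ℝ 2 m) x = ∑ j, s j x := by
        filter_upwards [Lp.coeFn_finsetSum Finset.univ s] with x hx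
        rw [hx, Finset.sum_apply]
      filter_upwards [Lp.coeFn_sub F ((N : ℝ)⁻¹ • ∑ j, s j), Lp.coeFn_smul (N : ℝ)⁻¹ (∑ j, s j),
        hsum, ae_all_iff.2 hst] with x h1 h2 h3 h4
      rw [h1, Pi.sub_apply, h2, Pi.smul_apply, h3, smul_eq_mul, Finset.mul_sum]
      congr 1
      refine Finset.sum_congr rfl fun j _ => ?_
      rw [h4 j]
      ring
    rw [eLpNorm_congr_ae hae]
    rw [Lp.norm_def] at hle
    exact ENNReal.le_ofReal_iff_toReal_le (Lp.eLpNorm_ne_top _) (by positivity) |>.2 hle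

end Duality

/-! ### Finite tuples of L² functions as a single L² function. -/

section CountProd

variable {ι X : Type*} [Fintype ι] [MeasurableSpace ι] [MeasurableSingletonClass ι]
  [MeasurableSpace X] {ν : Measure X} [SFinite ν]

lemma ae_count_prod {P : ι → X → Prop} (h : ∀ i, ∀ᵐ x ∂ν, P i x) :
    ∀ᵐ p ∂((Measure.count : Measure ι).prod ν), P p.1 p.2 := by
  have hsub : {p : ι × X | ¬ P p.1 p.2} ⊆ ⋃ i, {i} ×ˢ {x | ¬ P i x} := by
    rintro ⟨i, x⟩ hx
    exact Set.mem_iUnion.2 ⟨i, rfl, hx⟩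
  refine measure_mono_null hsub (measure_iUnion_null fun i => ?_)
  rw [Measure.prod_prod]
  simp [ae_iff.1 (h i)]

lemma aestronglyMeasurable_count_prod {g : ι → X → ℝ} (hg : ∀ i, AEStronglyMeasurable (g i) ν) :
    AEStronglyMeasurable (fun p : ι × X => g p.1 p.2) ((Measure.count : Measure ι).prod ν) := by
  refine ⟨fun p => (hg p.1).mk (g p.1) p.2, Measurable.stronglyMeasurable ?_,
    ae_count_prod fun i => (hg i).ae_eq_mk⟩
  exact measurable_from_prod_countable_right fun i => (hg i).stronglyMeasurable_mk.measurable

/-- With counting measure on the index, the Sobolev norm becomes one Hilbert norm, so all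
derivatives are approximated simultaneously by the same neurons. -/
lemma eLpNorm_count_prod {g : ι → X → ℝ} (hg : ∀ i, AEStronglyMeasurable (g i) ν) :
    eLpNorm (fun p : ι × X => g p.1 p.2) 2 ((Measure.count : Measure ι).prod ν) =
      (∑ i, eLpNorm (g i) 2 ν ^ (2 : ℝ)) ^ (1 / 2 : ℝ) := by
  have h2 : ∀ (i : ι), eLpNorm (g i) 2 ν ^ (2 : ℝ) = ∫⁻ x, ‖g i x‖ₑ ^ (2 : ℝ) ∂ν := fun i => by
    rw [eLpNorm_eq_lintegral_rpow_enorm_toReal (by norm_num) (by norm_num), ← ENNReal.rpow_mul]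
    simp
  rw [eLpNorm_eq_lintegral_rpow_enorm_toReal (by norm_num) (by norm_num)]
  simp only [ENNReal.toReal_ofNat]
  rw [lintegral_prod _ ((aestronglyMeasurable_count_prod hg).enorm.pow_const _)]
  rw [lintegral_fintype]
  simp [h2]

lemma memLp_count_prod {g : ι → X → ℝ} (hg : ∀ i, MemLp (g i) 2 ν) :
    MemLp (fun p : ι × X => g p.1 p.2) 2 ((Measure.count : Measure ι).prod ν) := by
  refine ⟨aestronglyMeasurable_count_prod fun i => (hg i).1, ?_⟩
  rw [eLpNorm_count_prod fun i => (hg i).1]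
  refine ENNReal.rpow_lt_top_of_nonneg (by norm_num) (ENNReal.sum_ne_top.2 fun i _ => ?_)
  exact ENNReal.rpow_ne_top_of_nonneg (by norm_num) (hg i).2.ne

end CountProd

/-! ### Weak derivatives of superpositions. -/

section WeakDerivCongr

variable {E₁ E₂ : Type*} [NormedAddCommGroup E₁] [NormedSpace ℝ E₁] [FiniteDimensional ℝ E₁]
  [MeasureSpace E₁] [BorelSpace E₁] [(volume : Measure E₁).IsAddHaarMeasure]
  [NormedAddCommGroup E₂] [NormedSpace ℝ E₂] [FiniteDimensional ℝ E₂]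
  [MeasureSpace E₂] [BorelSpace E₂] [(volume : Measure E₂).IsAddHaarMeasure]
  {d₁ d₂ : ℕ} {e₁ : Fin d₁ → E₁} {e₂ : Fin d₂ → E₂} {U : Set E₁} {V : Set E₂}
  {α : Fin d₁ → ℕ} {β : Fin d₂ → ℕ}

lemma locallyIntegrableOn_congr {f g : E₁ × E₂ → ℝ} {W : Set (E₁ × E₂)}
    (hf : LocallyIntegrableOn f W volume) (h : f =ᵐ[volume] g) :
    LocallyIntegrableOn g W volume := fun x hx => by
  obtain ⟨t, ht, hi⟩ := hf x hx
  exact ⟨t, ht, hi.congr_fun_ae (ae_restrict_of_ae h)⟩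

lemma IsWeakDeriv.congr {f f' g g' : E₁ × E₂ → ℝ} (h : IsWeakDeriv e₁ e₂ U V α β f g)
    (hf : f =ᵐ[volume] f') (hg : g =ᵐ[volume] g') : IsWeakDeriv e₁ e₂ U V α β f' g' := by
  refine ⟨locallyIntegrableOn_congr h.1 hf, locallyIntegrableOn_congr h.2.1 hg,
    fun φ h1 h2 h3 => ?_⟩
  have e1 : ∫ z in U ×ˢ V, f' z * mixedDeriv e₁ e₂ α β φ z =
      ∫ z in U ×ˢ V, f z * mixedDeriv e₁ e₂ α β φ z :=
    integral_congr_ae ((ae_restrict_of_ae hf).mono fun z hz => by simp only [hz])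
  have e2 : ∫ z in U ×ˢ V, g' z * φ z = ∫ z in U ×ˢ V, g z * φ z :=
    integral_congr_ae ((ae_restrict_of_ae hg).mono fun z hz => by simp only [hz])
  rw [e1, e2, h.2.2 φ h1 h2 h3]

/-- Weak derivatives commute with absolutely convergent superpositions. -/
lemma isWeakDeriv_integral {Θ : Type*} [MeasurableSpace Θ] {τ : Measure Θ} [SFinite τ]
    {k k' : Θ → E₁ × E₂ → ℝ} {D a : Θ → ℝ} (hk : Measurable (Function.uncurry k))
    (hk' : Measurable (Function.uncurry k')) (hkD : ∀ θ z, |k θ z| ≤ D θ)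
    (hkD' : ∀ θ z, |k' θ z| ≤ D θ) (ha : Measurable a) (hDa : Integrable (fun θ => D θ * |a θ|) τ)
    (h : ∀ᵐ θ ∂τ, IsWeakDeriv e₁ e₂ U V α β (k θ) (k' θ)) :
    IsWeakDeriv e₁ e₂ U V α β (fun z => ∫ θ, k θ z * a θ ∂τ) (fun z => ∫ θ, k' θ z * a θ ∂τ) := by
  have hli : ∀ q : Θ → E₁ × E₂ → ℝ, Measurable (Function.uncurry q) → (∀ θ z, |q θ z| ≤ D θ) →
      LocallyIntegrable (fun z => ∫ θ, q θ z * a θ ∂τ) := by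
    intro q hq hqD
    have hm : StronglyMeasurable (Function.uncurry fun z θ => q θ z * a θ) :=
      ((hq.comp measurable_swap).mul (ha.comp measurable_snd)).stronglyMeasurable
    refine locallyIntegrable_of_ae_abs_le (B := ∫ θ, D θ * |a θ| ∂τ)
      hm.integral_prod_right.aestronglyMeasurable (Filter.Eventually.of_forall fun z => ?_)
    rw [← Real.norm_eq_abs]
    refine norm_integral_le_of_norm_le hDa (Filter.Eventually.of_forall fun θ => ?_)
    rw [norm_mul, Real.norm_eq_abs, Real.norm_eq_abs]
    exact mul_le_mul_of_nonneg_right (hqD θ z) (abs_nonneg _)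
  -- Fubini moves the pairing with a test function inside the superposition, where the weak
  -- derivative identity holds for almost every θ.
  have hsw : ∀ q : Θ → E₁ × E₂ → ℝ, Measurable (Function.uncurry q) → (∀ θ z, |q θ z| ≤ D θ) →
      ∀ φ : E₁ × E₂ → ℝ, Continuous φ → HasCompactSupport φ →
      ∫ z in U ×ˢ V, (∫ θ, q θ z * a θ ∂τ) * φ z =
        ∫ θ, a θ * (∫ z in U ×ˢ V, q θ z * φ z) ∂τ := by
    intro q hq hqD φ hφ hφc
    calc _ = ∫ z in U ×ˢ V, ∫ θ, q θ z * a θ * φ z ∂τ := by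
          simp only [integral_mul_const]
      _ = ∫ θ, (∫ z in U ×ˢ V, q θ z * a θ * φ z) ∂τ := by
          refine integral_integral_swap ?_
          have hφi : Integrable φ (volume.restrict (U ×ˢ V)) :=
            (hφ.integrable_of_hasCompactSupport hφc).restrict
          refine (hφi.norm.mul_prod hDa).mono ?_ (Filter.Eventually.of_forall fun p => ?_)
          · exact (((hq.comp measurable_swap).mul (ha.comp measurable_snd)).mul
              (hφ.measurable.comp measurable_fst)).aestronglyMeasurable
          · simp only [Function.uncurry, norm_mul, Real.norm_eq_abs, abs_abs]
            have := (hqD p.2 p.1).trans (le_abs_self _)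
            calc _ ≤ |D p.2| * |a p.2| * |φ p.1| := by gcongr
              _ = _ := by ring
      _ = _ := by
          refine integral_congr_ae (Filter.Eventually.of_forall fun θ => ?_)
          beta_reduce
          rw [← integral_const_mul]
          refine integral_congr_ae (Filter.Eventually.of_forall fun z => ?_)
          beta_reduce
          ring
  refine ⟨(hli k hk hkD).locallyIntegrableOn _, (hli k' hk' hkD').locallyIntegrableOn _,
    fun φ h1 h2 h3 => ?_⟩
  rw [hsw k' hk' hkD' φ h1.continuous h2, mixedDeriv_eq_listDeriv,
    hsw k hk hkD _ (contDiff_listDeriv h1 _).continuous (hasCompactSupport_listDeriv h2 _),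
    ← mixedDeriv_eq_listDeriv, ← integral_const_mul]
  refine integral_congr_ae ?_
  filter_upwards [h] with θ hθ
  rw [hθ.2.2 φ h1 h2 h3]
  ring

end WeakDerivCongr

/-! ### Integrability and bounded derivatives of the activation function. -/

section Activation

lemma one_le_bracket_rpow (t : ℝ) {γ : ℝ} (hγ : 0 ≤ γ) : 1 ≤ bracket t ^ γ :=
  Real.one_le_rpow (Real.one_le_sqrt.2 (by nlinarith [sq_nonneg t])) hγ

lemma bracket_rpow (t γ : ℝ) : bracket t ^ γ = (1 + ‖t‖ ^ 2) ^ (γ / 2) := by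
  rw [bracket, Real.sqrt_eq_rpow, ← Real.rpow_mul (by positivity), Real.norm_eq_abs, sq_abs]
  ring_nf

/-- Bounded measurable representatives of the weak derivatives of an activation function. -/
lemma exists_bounded_derivs {k₁ k₂ : ℕ} {γ₁ γ₂ : ℝ} (hγ₁ : 1 < γ₁) (hγ₂ : 1 < γ₂)
    {ϑ : ℝ × ℝ → ℝ} (hϑ_meas : Measurable ϑ)
    (hϑ_ell : ∃ c : ℝ, 0 < c ∧ ∀ t : ℝ × ℝ, bracket t.1 ^ γ₁ * bracket t.2 ^ γ₂ ≤ c * ϑ t)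
    {σ : ℝ × ℝ → ℝ}
    (hσ : MemBochnerSobolev realDir realDir k₁ k₂ ⊤ ⊤ ϑ Set.univ Set.univ σ) :
    ∃ (s : ℕ → ℕ → ℝ × ℝ → ℝ) (B : ℝ), 0 ≤ B ∧ (∀ i j, Measurable (s i j)) ∧
      (∀ i j t, |s i j t| ≤ B) ∧ (∀ i ≤ k₁, ∀ j ≤ k₂,
        IsWeakDeriv realDir realDir Set.univ Set.univ (fun _ => i) (fun _ => j) σ (s i j)) ∧
      σ =ᵐ[volume] s 0 0 ∧ Integrable σ := by
  obtain ⟨c, hc, hcϑ⟩ := hϑ_ell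
  have hvol : (volume : Measure (ℝ × ℝ)).restrict (Set.univ ×ˢ Set.univ) = volume := by
    rw [Set.univ_prod_univ, Measure.restrict_univ]
  have hraw : ∀ i ≤ k₁, ∀ j ≤ k₂, ∃ (g : ℝ × ℝ → ℝ) (b : ℝ), 0 ≤ b ∧
      IsWeakDeriv realDir realDir Set.univ Set.univ (fun _ => i) (fun _ => j) σ g ∧
      ∀ᵐ t, |g t| ≤ b * (bracket t.1 ^ γ₁ * bracket t.2 ^ γ₂)⁻¹ := by
    intro i hi j hj
    obtain ⟨g, hg, hlt⟩ := hσ (fun _ => i) (mem_multiIndices.2 (by simpa using hi)) (fun _ => j)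
      (mem_multiIndices.2 (by simpa using hj))
    have hgm := hg.aestronglyMeasurable
    rw [hvol] at hgm
    obtain ⟨B, hB⟩ := ae_abs_le_of_mixedLpNorm_top_lt_top
      (hϑ_meas.aestronglyMeasurable.mul hgm) hlt
    refine ⟨g, c * |B|, by positivity, hg, ?_⟩
    filter_upwards [hB] with t ht
    have hpos : 0 < bracket t.1 ^ γ₁ * bracket t.2 ^ γ₂ :=
      mul_pos (one_pos.trans_le (one_le_bracket_rpow _ (by linarith)))
        (one_pos.trans_le (one_le_bracket_rpow _ (by linarith)))
    rw [← div_eq_mul_inv, le_div_iff₀ hpos]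
    have hϑ : 0 < ϑ t := pos_of_mul_pos_right (hpos.trans_le (hcϑ t)) hc.le
    calc |g t| * (bracket t.1 ^ γ₁ * bracket t.2 ^ γ₂) ≤ |g t| * (c * ϑ t) :=
          mul_le_mul_of_nonneg_left (hcϑ t) (abs_nonneg _)
      _ = c * |ϑ t * g t| := by rw [abs_mul, abs_of_pos hϑ]; ring
      _ ≤ c * |B| := mul_le_mul_of_nonneg_left (ht.trans (le_abs_self B)) hc.le
  have hrep : ∀ i j : ℕ, ∃ (s : ℝ × ℝ → ℝ) (b : ℝ), 0 ≤ b ∧ Measurable s ∧ (∀ t, |s t| ≤ b) ∧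
      (¬ (i ≤ k₁ ∧ j ≤ k₂) → b = 0) ∧ (i ≤ k₁ → j ≤ k₂ →
        IsWeakDeriv realDir realDir Set.univ Set.univ (fun _ => i) (fun _ => j) σ s) := by
    intro i j
    by_cases hij : i ≤ k₁ ∧ j ≤ k₂
    swap
    · exact ⟨0, 0, le_rfl, measurable_const, by simp, fun _ => rfl,
        fun h1 h2 => absurd ⟨h1, h2⟩ hij⟩
    obtain ⟨g, b, hb, hg, hgb⟩ := hraw i hij.1 j hij.2
    have hgm := hg.aestronglyMeasurable
    rw [hvol] at hgm
    -- Clamping a measurable representative to [-b, b] makes the bound hold everywhere. It changes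
    -- nothing almost everywhere, as the bracket weight is at least one.
    refine ⟨fun t => max (-b) (min b (hgm.mk g t)), b, hb,
      measurable_const.max (measurable_const.min hgm.stronglyMeasurable_mk.measurable),
      fun t => abs_le.2 ⟨le_max_left _ _, max_le (by linarith) (min_le_left _ _)⟩,
      fun h => absurd hij h, fun _ _ => hg.congr Filter.EventuallyEq.rfl ?_⟩
    filter_upwards [hgb, hgm.ae_eq_mk] with t ht hmk
    have h1 : (bracket t.1 ^ γ₁ * bracket t.2 ^ γ₂)⁻¹ ≤ 1 :=
      inv_le_one_of_one_le₀ (one_le_mul_of_one_le_of_one_le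
        (one_le_bracket_rpow _ (by linarith)) (one_le_bracket_rpow _ (by linarith)))
    have h2 := abs_le.1 (ht.trans (mul_le_of_le_one_right hb h1))
    rw [← hmk, min_eq_right h2.2, max_eq_right h2.1]
  choose s b hb hsm hsb hb0 hs using hrep
  have hσ00 : IsWeakDeriv realDir realDir Set.univ Set.univ 0 0 σ σ :=
    isWeakDeriv_zero (hs 0 0 (Nat.zero_le _) (Nat.zero_le _)).1
  -- Beyond the orders k₁, k₂ the functions s are zero with bound zero, so this finite sum bounds
  -- all of them.
  refine ⟨s, ∑ i ∈ Finset.range (k₁ + 1), ∑ j ∈ Finset.range (k₂ + 1), b i j,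
    Finset.sum_nonneg fun i _ => Finset.sum_nonneg fun j _ => hb i j, hsm, fun i j t => ?_,
    fun i hi j hj => hs i j hi hj, ?_, ?_⟩
  · by_cases hij : i ≤ k₁ ∧ j ≤ k₂
    · refine (hsb i j t).trans ?_
      refine le_trans ?_ (Finset.single_le_sum (f := fun i => ∑ j ∈ Finset.range (k₂ + 1), b i j)
        (fun i _ => Finset.sum_nonneg fun j _ => hb i j) (Finset.mem_range.2 (by omega : i < k₁ + 1)))
      exact Finset.single_le_sum (f := fun j => b i j) (fun j _ => hb i j)
        (Finset.mem_range.2 (by omega : j < k₂ + 1))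
    · exact ((hsb i j t).trans (hb0 i j hij).le).trans
        (Finset.sum_nonneg fun i _ => Finset.sum_nonneg fun j _ => hb i j)
  · have := hσ00.ae_eq isOpen_univ isOpen_univ (hs 0 0 (Nat.zero_le _) (Nat.zero_le _))
    rwa [hvol] at this
  · obtain ⟨g, B, hB, hg, hgb⟩ := hraw 0 (Nat.zero_le _) 0 (Nat.zero_le _)
    have hσg := hσ00.ae_eq isOpen_univ isOpen_univ hg
    have hσm := hσ00.aestronglyMeasurable
    rw [hvol] at hσg hσm
    -- The exponents γ₁, γ₂ > 1 make the product of inverse brackets integrable over ℝ²; it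
    -- dominates σ.
    have hint : ∀ γ : ℝ, 1 < γ → Integrable fun t : ℝ => (bracket t ^ γ)⁻¹ := by
      intro γ hγ
      refine (integrable_rpow_neg_one_add_norm_sq (E := ℝ) (μ := volume) (r := γ)
        (by simpa using hγ)).congr (Filter.Eventually.of_forall fun t => ?_)
      beta_reduce
      rw [bracket_rpow, neg_div, Real.rpow_neg (by positivity)]
    refine (((hint γ₁ hγ₁).mul_prod (hint γ₂ hγ₂)).const_mul B).mono' hσm ?_
    filter_upwards [hσg, hgb] with t h1 h2
    rw [h1, Real.norm_eq_abs, ← mul_inv]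
    exact h2

end Activation

/-! ### Test functions and their derivatives as integrals of neurons. -/

section Kernel

variable {d₁ d₂ n₁ n₂ : ℕ} {s : ℕ → ℕ → ℝ × ℝ → ℝ} {B : ℝ}

lemma abs_monomial_le_weight {α : Fin d₁ → ℕ} {β : Fin d₂ → ℕ} (hα : α ∈ multiIndices d₁ n₁)
    (hβ : β ∈ multiIndices d₂ n₂) (ξ : EuclideanSpace ℝ (Fin d₁) × EuclideanSpace ℝ (Fin d₂)) :
    |monomial ξ α β| ≤ weight n₁ n₂ ξ := by
  have key : ∀ {d n : ℕ} (x : EuclideanSpace ℝ (Fin d)) (α : Fin d → ℕ), ∑ i, α i ≤ n →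
      |∏ i, x i ^ α i| ≤ (1 + ‖x‖) ^ n := by
    intro d n x α h
    rw [Finset.abs_prod]
    calc ∏ i, |x i ^ α i| ≤ ∏ i, (1 + ‖x‖) ^ α i := by
          refine Finset.prod_le_prod (fun i _ => abs_nonneg _) fun i _ => ?_
          rw [abs_pow]
          gcongr
          have := PiLp.norm_apply_le x i
          rw [Real.norm_eq_abs] at this
          linarith
      _ = (1 + ‖x‖) ^ ∑ i, α i := Finset.prod_pow_eq_pow_sum _ _ _
      _ ≤ _ := pow_le_pow_right₀ (by linarith [norm_nonneg x]) h
  rw [monomial, abs_mul, weight]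
  exact mul_le_mul (key _ _ (mem_multiIndices.1 hα)) (key _ _ (mem_multiIndices.1 hβ))
    (abs_nonneg _) (by positivity)

lemma measurable_monomial_mul (hsm : ∀ i j, Measurable (s i j)) (α : Fin d₁ → ℕ)
    (β : Fin d₂ → ℕ) : Measurable fun p : ((EuclideanSpace ℝ (Fin d₁) × EuclideanSpace ℝ (Fin d₂)) ×
      (ℝ × ℝ)) × (EuclideanSpace ℝ (Fin d₁) × EuclideanSpace ℝ (Fin d₂)) =>
      monomial p.1.1 α β * s (∑ i, α i) (∑ j, β j) (pairing p.1.1 p.2 + p.1.2) := by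
  refine Measurable.mul (Continuous.measurable ?_) ((hsm _ _).comp (Continuous.measurable ?_))
  · unfold monomial
    fun_prop
  · simp only [pairing_apply]
    fun_prop

/-- Zero weights form a null set because both dimensions are positive; they are the parameters for
which the chain rule is not available. -/
lemma ae_ne_zero_weights (hd₁ : 0 < d₁) (hd₂ : 0 < d₂) :
    ∀ᵐ θ : (EuclideanSpace ℝ (Fin d₁) × EuclideanSpace ℝ (Fin d₂)) × (ℝ × ℝ),
      θ.1.1 ≠ 0 ∧ θ.1.2 ≠ 0 := by
  have : Nonempty (Fin d₁) := ⟨⟨0, hd₁⟩⟩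
  have : Nonempty (Fin d₂) := ⟨⟨0, hd₂⟩⟩
  have h1 : ∀ᵐ x : EuclideanSpace ℝ (Fin d₁), x ≠ 0 := Measure.ae_ne volume 0
  have h2 : ∀ᵐ x : EuclideanSpace ℝ (Fin d₂), x ≠ 0 := Measure.ae_ne volume 0
  have h3 : ∀ᵐ ξ : EuclideanSpace ℝ (Fin d₁) × EuclideanSpace ℝ (Fin d₂), ξ.1 ≠ 0 ∧ ξ.2 ≠ 0 := by
    filter_upwards [Measure.quasiMeasurePreserving_fst.ae h1,
      Measure.quasiMeasurePreserving_snd.ae h2] with ξ h h'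
    exact ⟨h, h'⟩
  exact Measure.quasiMeasurePreserving_fst.ae h3

/-- A smooth compactly supported function and its derivatives as superpositions of neurons and
their derivatives. -/
lemma mixedDeriv_ae_eq_integral_neurons (hd₁ : 0 < d₁) (hd₂ : 0 < d₂)
    (hsm : ∀ i j, Measurable (s i j)) (hsB : ∀ i j t, |s i j t| ≤ B)
    (hs : ∀ i ≤ n₁, ∀ j ≤ n₂,
      IsWeakDeriv realDir realDir Set.univ Set.univ (fun _ => i) (fun _ => j) (s 0 0) (s i j))
    (hs0 : Integrable (s 0 0)) {ψ : ℝ × ℝ → ℝ} (hψ : ContDiff ℝ ∞ ψ) (hψc : HasCompactSupport ψ)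
    (hadm : ∫⁻ ℓ, ‖ft ψ ℓ‖ₑ * ENNReal.ofReal (admWeight d₁ d₂ (n₁ + 1) (n₂ + 1) ℓ) < ⊤)
    {c : ℂ} (hc : c = ∫ ℓ, ft ψ ℓ * ft (s 0 0) ℓ * (dilScale d₁ d₂ ℓ : ℂ)) (hc0 : c ≠ 0)
    {F : EuclideanSpace ℝ (Fin d₁) × EuclideanSpace ℝ (Fin d₂) → ℝ} (hF : ContDiff ℝ ∞ F)
    (hFc : HasCompactSupport F)
    (hfin : ∫⁻ κ, ‖ft F κ‖ₑ * ENNReal.ofReal (weight (n₁ + 1) (n₂ + 1) κ) < ⊤)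
    (hrid : ∫⁻ θ : (EuclideanSpace ℝ (Fin d₁) × EuclideanSpace ℝ (Fin d₂)) × (ℝ × ℝ),
      ‖ridgelet F ψ θ.1 θ.2‖ₑ * ENNReal.ofReal (weight n₁ n₂ θ.1) < ⊤)
    {α : Fin d₁ → ℕ} {β : Fin d₂ → ℕ} (hα : α ∈ multiIndices d₁ n₁)
    (hβ : β ∈ multiIndices d₂ n₂) :
    ∀ᵐ z, mixedDeriv (stdDir d₁) (stdDir d₂) α β F z =
      ∫ θ : (EuclideanSpace ℝ (Fin d₁) × EuclideanSpace ℝ (Fin d₂)) × (ℝ × ℝ),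
        (monomial θ.1 α β * s (∑ i, α i) (∑ j, β j) (pairing θ.1 z + θ.2)) *
          (ridgelet F ψ θ.1 θ.2 * (c⁻¹).re) := by
  have hB : 0 ≤ B := (abs_nonneg _).trans (hsB 0 0 0)
  set a : (EuclideanSpace ℝ (Fin d₁) × EuclideanSpace ℝ (Fin d₂)) × (ℝ × ℝ) → ℝ :=
    fun θ => ridgelet F ψ θ.1 θ.2 with ha
  have ham : Continuous a := continuous_ridgelet hF hFc hψ hψc
  have haw : Integrable fun θ => weight n₁ n₂ θ.1 * |a θ| := by
    refine ⟨(((continuous_weight n₁ n₂).comp continuous_fst).mul ham.abs).aestronglyMeasurable,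
      lt_of_le_of_lt (lintegral_mono fun θ => ?_) hrid⟩
    rw [enorm_mul, Real.enorm_abs, Real.enorm_of_nonneg (weight_pos _ _ _).le, mul_comm]
  have hai : Integrable a := haw.mono ham.aestronglyMeasurable
    (Filter.Eventually.of_forall fun θ => by
      rw [norm_mul, Real.norm_eq_abs, Real.norm_eq_abs, Real.norm_eq_abs, abs_abs,
        abs_of_pos (weight_pos _ _ _)]
      exact le_mul_of_one_le_left (abs_nonneg _) (one_le_weight _ _ _))
  have hrep : ∀ z, F z = ∫ θ, s 0 0 (pairing θ.1 z + θ.2) * (a θ * (c⁻¹).re) := by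
    intro z
    have h1 := integral_ridgelet_eq hs0 hF hFc hψ hψc (a := n₁ + 1) (b := n₂ + 1)
      (by simpa using hadm) hfin z
    simp only [finrank_euclideanSpace, Fintype.card_fin, ← hc] at h1
    have h2 : Integrable fun θ : (EuclideanSpace ℝ (Fin d₁) × EuclideanSpace ℝ (Fin d₂)) × (ℝ × ℝ) =>
        s 0 0 (pairing θ.1 z + θ.2) * a θ := by
      refine (hai.norm.const_mul B).mono (Measurable.aestronglyMeasurable ?_)
        (Filter.Eventually.of_forall fun θ => ?_)
      · refine ((hsm 0 0).comp (Continuous.measurable ?_)).mul ham.measurable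
        simp only [pairing_apply]
        fun_prop
      · rw [norm_mul, norm_mul, norm_norm, Real.norm_of_nonneg hB]
        exact mul_le_mul_of_nonneg_right (hsB _ _ _) (norm_nonneg _)
    have h3 : ∫ ξ, ∫ t, ((s 0 0 (pairing ξ z + t) * ridgelet F ψ ξ t : ℝ) : ℂ) =
        ((∫ θ, s 0 0 (pairing θ.1 z + θ.2) * a θ : ℝ) : ℂ) := by
      simp only [integral_complex_ofReal]
      exact congrArg _ (integral_prod _ h2).symm
    rw [h3] at h1
    simp only [← mul_assoc]
    rw [integral_mul_const]
    have h4 : (F z : ℂ) = c⁻¹ * ((∫ θ, s 0 0 (pairing θ.1 z + θ.2) * a θ : ℝ) : ℂ) := by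
      rw [h1, inv_mul_cancel_left₀ hc0]
    -- F(z) and the integral are real, so only the real part of c⁻¹ contributes.
    have h5 := congrArg Complex.re h4
    rw [Complex.ofReal_re, Complex.re_mul_ofReal] at h5
    rw [h5, mul_comm]
  have hm0 : Measurable (Function.uncurry fun (θ : (EuclideanSpace ℝ (Fin d₁) ×
      EuclideanSpace ℝ (Fin d₂)) × (ℝ × ℝ)) z => s 0 0 (pairing θ.1 z + θ.2)) := by
    refine (hsm 0 0).comp (Continuous.measurable ?_)
    simp only [pairing_apply]
    fun_prop
  have hm1 : Measurable (Function.uncurry fun (θ : (EuclideanSpace ℝ (Fin d₁) ×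
      EuclideanSpace ℝ (Fin d₂)) × (ℝ × ℝ)) z =>
      monomial θ.1 α β * s (∑ i, α i) (∑ j, β j) (pairing θ.1 z + θ.2)) :=
    measurable_monomial_mul hsm α β
  have hw : IsWeakDeriv (stdDir d₁) (stdDir d₂) Set.univ Set.univ α β
      (fun z => ∫ θ, s 0 0 (pairing θ.1 z + θ.2) * (a θ * (c⁻¹).re))
      (fun z => ∫ θ, (monomial θ.1 α β * s (∑ i, α i) (∑ j, β j) (pairing θ.1 z + θ.2)) *
        (a θ * (c⁻¹).re)) := by
    refine isWeakDeriv_integral (D := fun θ => B * weight n₁ n₂ θ.1)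
      hm0 hm1
      (fun θ z => (hsB _ _ _).trans (le_mul_of_one_le_right hB (one_le_weight _ _ _)))
      (fun θ z => ?_) (ham.measurable.mul_const _) ?_ ?_
    · rw [abs_mul, mul_comm]
      exact mul_le_mul (hsB _ _ _) (abs_monomial_le_weight hα hβ _) (abs_nonneg _) hB
    · refine (haw.const_mul (B * |(c⁻¹).re|)).congr (Filter.Eventually.of_forall fun θ => ?_)
      beta_reduce
      rw [abs_mul]
      ring
    · filter_upwards [ae_ne_zero_weights hd₁ hd₂] with θ hθ
      exact isWeakDeriv_neuron (hs _ (mem_multiIndices.1 hα) _ (mem_multiIndices.1 hβ))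
        (Filter.Eventually.of_forall (hsB 0 0)) (Filter.Eventually.of_forall (hsB _ _)) hθ.1 hθ.2
        θ.2 _ _
  -- The superposition is F itself, so uniqueness of weak derivatives identifies its classical
  -- derivative with the differentiated superposition.
  rw [← funext hrep] at hw
  have := (isWeakDeriv_of_contDiff (e₁ := stdDir d₁) (e₂ := stdDir d₂) (U := Set.univ)
    (V := Set.univ) (α := α) (β := β) hF).ae_eq isOpen_univ isOpen_univ hw
  rwa [Set.univ_prod_univ, Measure.restrict_univ] at this

end Kernel

/-! ### Jets of test functions in the closed convex hull of neuron jets. -/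

section Jets

/-- Pairs of multi-indices of order at most `n₁` and `n₂`. -/
def JetIndex (d₁ d₂ n₁ n₂ : ℕ) : Type := ↥(multiIndices d₁ n₁ ×ˢ multiIndices d₂ n₂)

instance (d₁ d₂ n₁ n₂ : ℕ) : Fintype (JetIndex d₁ d₂ n₁ n₂) :=
  inferInstanceAs (Fintype ↥(multiIndices d₁ n₁ ×ˢ multiIndices d₂ n₂))

instance (d₁ d₂ n₁ n₂ : ℕ) : MeasurableSpace (JetIndex d₁ d₂ n₁ n₂) := ⊤

instance (d₁ d₂ n₁ n₂ : ℕ) : MeasurableSingletonClass (JetIndex d₁ d₂ n₁ n₂) :=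
  ⟨fun _ => trivial⟩

variable {d₁ d₂ : ℕ}

/-- The measure whose `L²` space contains the tuples of derivatives on `U × V`. -/
def jetMeasure (n₁ n₂ : ℕ) (U : Set (EuclideanSpace ℝ (Fin d₁)))
    (V : Set (EuclideanSpace ℝ (Fin d₂))) :
    Measure (JetIndex d₁ d₂ n₁ n₂ × (EuclideanSpace ℝ (Fin d₁) × EuclideanSpace ℝ (Fin d₂))) :=
  Measure.count.prod (volume.restrict (U ×ˢ V))

/-- The derivatives of the neuron with parameters `θ = (ξ, b)`. -/
def neuronJet (n₁ n₂ : ℕ) (s : ℕ → ℕ → ℝ × ℝ → ℝ)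
    (θ : (EuclideanSpace ℝ (Fin d₁) × EuclideanSpace ℝ (Fin d₂)) × (ℝ × ℝ))
    (p : JetIndex d₁ d₂ n₁ n₂ × (EuclideanSpace ℝ (Fin d₁) × EuclideanSpace ℝ (Fin d₂))) : ℝ :=
  monomial θ.1 p.1.1.1 p.1.1.2 *
    s (∑ i, p.1.1.1 i) (∑ j, p.1.1.2 j) (pairing θ.1 p.2 + θ.2)

/-- Parameters with nonzero weights in both blocks. -/
def regularParams (d₁ d₂ : ℕ) :
    Set ((EuclideanSpace ℝ (Fin d₁) × EuclideanSpace ℝ (Fin d₂)) × (ℝ × ℝ)) :=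
  {θ | θ.1.1 ≠ 0 ∧ θ.1.2 ≠ 0}

variable {n₁ n₂ : ℕ} {s : ℕ → ℕ → ℝ × ℝ → ℝ} {B : ℝ}

lemma measurable_neuronJet (hsm : ∀ i j, Measurable (s i j)) :
    Measurable (Function.uncurry (neuronJet (d₁ := d₁) (d₂ := d₂) n₁ n₂ s)) := by
  have h : Measurable fun q : JetIndex d₁ d₂ n₁ n₂ × (((EuclideanSpace ℝ (Fin d₁) ×
      EuclideanSpace ℝ (Fin d₂)) × (ℝ × ℝ)) ×
        (EuclideanSpace ℝ (Fin d₁) × EuclideanSpace ℝ (Fin d₂))) =>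
      monomial q.2.1.1 q.1.1.1 q.1.1.2 *
        s (∑ i, q.1.1.1 i) (∑ j, q.1.1.2 j) (pairing q.2.1.1 q.2.2 + q.2.1.2) :=
    measurable_from_prod_countable_right fun i => measurable_monomial_mul hsm i.1.1 i.1.2
  have hm : Measurable fun p : ((EuclideanSpace ℝ (Fin d₁) ×
      EuclideanSpace ℝ (Fin d₂)) × (ℝ × ℝ)) × (JetIndex d₁ d₂ n₁ n₂ ×
        (EuclideanSpace ℝ (Fin d₁) × EuclideanSpace ℝ (Fin d₂))) => (p.2.1, (p.1, p.2.2)) :=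
    (measurable_fst.comp measurable_snd).prodMk
      (measurable_fst.prodMk (measurable_snd.comp measurable_snd))
  have h' := h.comp hm
  unfold Function.comp at h'
  unfold neuronJet Function.uncurry
  exact h'

lemma abs_neuronJet_le (hsB : ∀ i j t, |s i j t| ≤ B)
    (θ : (EuclideanSpace ℝ (Fin d₁) × EuclideanSpace ℝ (Fin d₂)) × (ℝ × ℝ))
    (p : JetIndex d₁ d₂ n₁ n₂ × (EuclideanSpace ℝ (Fin d₁) × EuclideanSpace ℝ (Fin d₂))) :
    |neuronJet n₁ n₂ s θ p| ≤ B * weight n₁ n₂ θ.1 := by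
  have hp := Finset.mem_product.1 p.1.2
  rw [neuronJet, abs_mul, mul_comm]
  exact mul_le_mul (hsB _ _ _) (abs_monomial_le_weight hp.1 hp.2 _) (abs_nonneg _)
    ((abs_nonneg _).trans (hsB 0 0 0))

lemma regularParams_nonempty (hd₁ : 0 < d₁) (hd₂ : 0 < d₂) : (regularParams d₁ d₂).Nonempty := by
  have : Nonempty (Fin d₁) := ⟨⟨0, hd₁⟩⟩
  have : Nonempty (Fin d₂) := ⟨⟨0, hd₂⟩⟩
  obtain ⟨x, hx⟩ := exists_ne (0 : EuclideanSpace ℝ (Fin d₁))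
  obtain ⟨y, hy⟩ := exists_ne (0 : EuclideanSpace ℝ (Fin d₂))
  exact ⟨((x, y), 0), hx, hy⟩

/-- Jets of smooth compactly supported functions lie in the closed convex hull of the neurons. -/
lemma exists_jet_mem_closure (hd₁ : 0 < d₁) (hd₂ : 0 < d₂)
    (hsm : ∀ i j, Measurable (s i j)) (hsB : ∀ i j t, |s i j t| ≤ B)
    (hs : ∀ i ≤ n₁, ∀ j ≤ n₂,
      IsWeakDeriv realDir realDir Set.univ Set.univ (fun _ => i) (fun _ => j) (s 0 0) (s i j))
    (hs0 : Integrable (s 0 0)) (hsne : ¬ s 0 0 =ᵐ[volume] 0) (r : ℝ) :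
    ∃ C : ℝ≥0∞, C ≠ ⊤ ∧ ∀ (U : Set (EuclideanSpace ℝ (Fin d₁)))
      (V : Set (EuclideanSpace ℝ (Fin d₂))), IsFiniteMeasure (jetMeasure n₁ n₂ U V) →
      ∀ (F : EuclideanSpace ℝ (Fin d₁) × EuclideanSpace ℝ (Fin d₂) → ℝ) (R : ℝ≥0∞),
      ContDiff ℝ ∞ F → HasCompactSupport F → (∀ z, F z ≠ 0 → ‖z‖ ≤ r) → R ≠ ⊤ →
      (∀ α ∈ multiIndices d₁ (n₁ + d₁ / 2 + 2), ∀ β ∈ multiIndices d₂ (n₂ + d₂ / 2 + 2),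
        eLpNorm (mixedDeriv (stdDir d₁) (stdDir d₂) α β F) 2 volume ≤ R) →
      ∀ A : ℝ, 0 < A → C * R ≤ ENNReal.ofReal A → ∀ J : Lp ℝ 2 (jetMeasure n₁ n₂ U V),
      J =ᵐ[jetMeasure n₁ n₂ U V] (fun p =>
        mixedDeriv (stdDir d₁) (stdDir d₂) p.1.1.1 p.1.1.2 F p.2) →
      J ∈ closure (convexHull ℝ (atoms (jetMeasure n₁ n₂ U V) (neuronJet n₁ n₂ s)
        (fun θ => weight n₁ n₂ θ.1) (regularParams d₁ d₂) A)) := by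
  -- The window depends only on σ and the orders, so the constant is uniform in U, V and F. The
  -- orders are nᵢ+1 because the bias box costs one power.
  obtain ⟨ψ, hψ, hψc, hadm, hc0⟩ := exists_admissible_window hs0 hsne d₁ d₂ (n₁ + 1) (n₂ + 1)
  set c : ℂ := ∫ ℓ, ft ψ ℓ * ft (s 0 0) ℓ * (dilScale d₁ d₂ ℓ : ℂ) with hc
  obtain ⟨C₀, hC₀, hbar⟩ := exists_lintegral_ft_weight_le d₁ d₂ n₁ n₂
  obtain ⟨r', hr'⟩ := hψc.isBounded.subset_closedBall 0
  -- A common nonnegative radius for the supports of F and ψ.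
  set ρ : ℝ := max 0 (max r r') with hρ
  have hψρ : ∀ t, ψ t ≠ 0 → ‖t‖ ≤ ρ := fun t ht => by
    have := hr' (subset_tsupport _ ht)
    rw [mem_closedBall_zero_iff] at this
    exact this.trans ((le_max_right _ _).trans (le_max_right _ _))
  set Q : ℝ≥0∞ := ENNReal.ofReal ((2 * ρ) ^ 2) * ∫⁻ ℓ, ‖ft ψ ℓ‖ₑ *
    ENNReal.ofReal (admWeight d₁ d₂ (n₁ + 1) (n₂ + 1) ℓ) with hQ
  have hQt : Q ≠ ⊤ := ENNReal.mul_ne_top ENNReal.ofReal_ne_top hadm.ne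
  refine ⟨‖(c⁻¹).re‖ₑ * (Q * C₀), ENNReal.mul_ne_top enorm_ne_top (ENNReal.mul_ne_top hQt hC₀),
    fun U V hfm F R hF hFc hFr hR hFR A hA hCA J hJ => ?_⟩
  have hft := hbar F R hF hFc hFR
  have hfin : ∫⁻ κ, ‖ft F κ‖ₑ * ENNReal.ofReal (weight (n₁ + 1) (n₂ + 1) κ) < ⊤ :=
    hft.trans_lt (ENNReal.mul_lt_top hC₀.lt_top hR.lt_top)
  have hrid := lintegral_ridgelet_le hF hFc hψ hψc (le_max_left 0 (max r r'))
    (fun z hz => (hFr z hz).trans ((le_max_left _ _).trans (le_max_right _ _))) hψρ n₁ n₂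
  simp only [finrank_euclideanSpace, Fintype.card_fin] at hrid
  rw [← hρ, ← hQ] at hrid
  have hrid' := hrid.trans (mul_le_mul_right hft Q)
  have hwm : Measurable fun θ : (EuclideanSpace ℝ (Fin d₁) × EuclideanSpace ℝ (Fin d₂)) ×
      (ℝ × ℝ) => weight n₁ n₂ θ.1 := (continuous_weight n₁ n₂).measurable.comp measurable_fst
  have ham : Measurable fun θ : (EuclideanSpace ℝ (Fin d₁) × EuclideanSpace ℝ (Fin d₂)) ×
      (ℝ × ℝ) => ridgelet F ψ θ.1 θ.2 * (c⁻¹).re :=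
    (continuous_ridgelet hF hFc hψ hψc).measurable.mul_const _
  refine mem_closure_convexHull_atoms (τ := volume) hA (measurable_neuronJet hsm)
    hwm (fun θ => weight_pos _ _ _) (abs_neuronJet_le hsB) ham ?_
    (ae_ne_zero_weights hd₁ hd₂) (regularParams_nonempty hd₁ hd₂) ?_
  · calc _ = ‖(c⁻¹).re‖ₑ * ∫⁻ θ : (EuclideanSpace ℝ (Fin d₁) × EuclideanSpace ℝ (Fin d₂)) ×
          (ℝ × ℝ), ‖ridgelet F ψ θ.1 θ.2‖ₑ * ENNReal.ofReal (weight n₁ n₂ θ.1) := by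
          rw [← lintegral_const_mul' _ _ enorm_ne_top]
          refine lintegral_congr fun θ => ?_
          rw [enorm_mul]
          ring
      _ ≤ ‖(c⁻¹).re‖ₑ * (Q * (C₀ * R)) := mul_le_mul_right hrid' _
      _ = ‖(c⁻¹).re‖ₑ * (Q * C₀) * R := by ring
      _ ≤ _ := hCA
  · have hrlt : ∫⁻ θ : (EuclideanSpace ℝ (Fin d₁) × EuclideanSpace ℝ (Fin d₂)) × (ℝ × ℝ),
        ‖ridgelet F ψ θ.1 θ.2‖ₑ * ENNReal.ofReal (weight n₁ n₂ θ.1) < ⊤ :=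
      hrid'.trans_lt (ENNReal.mul_lt_top hQt.lt_top (ENNReal.mul_lt_top hC₀.lt_top hR.lt_top))
    have hall : ∀ i : JetIndex d₁ d₂ n₁ n₂, ∀ᵐ z ∂(volume.restrict (U ×ˢ V)),
        mixedDeriv (stdDir d₁) (stdDir d₂) i.1.1 i.1.2 F z =
        ∫ θ, neuronJet n₁ n₂ s θ (i, z) * (ridgelet F ψ θ.1 θ.2 * (c⁻¹).re) := fun i =>
      ae_restrict_of_ae (mixedDeriv_ae_eq_integral_neurons hd₁ hd₂ hsm hsB hs hs0 hψ hψc hadm hc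
        hc0 hF hFc hfin hrlt (Finset.mem_product.1 i.2).1 (Finset.mem_product.1 i.2).2)
    filter_upwards [hJ, ae_count_prod hall] with p h1 h2
    rw [h1, h2]

end Jets

/-! ### Locality of derivatives. -/

section Locality

/-- Used to discard the cut-off on U × V, where it equals one in a neighbourhood of each point. -/
lemma listDeriv_eventuallyEq {E : Type*} [NormedAddCommGroup E] [NormedSpace ℝ E] (L : List E)
    {φ φ' : E → ℝ} {z : E} (h : φ =ᶠ[nhds z] φ') :
    listDeriv L φ =ᶠ[nhds z] listDeriv L φ' := by
  induction L with
  | nil => exact h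
  | cons v L ih =>
    rw [listDeriv_cons, listDeriv_cons]
    exact ih.fderiv.fun_comp fun T : E →L[ℝ] ℝ => T v

end Locality

/-! ### From test functions to Sobolev functions. -/

section Approximation

variable {d₁ d₂ n₁ n₂ : ℕ} {s : ℕ → ℕ → ℝ × ℝ → ℝ} {B : ℝ}

lemma multiIndices_mono {d m n : ℕ} (h : m ≤ n) : multiIndices d m ⊆ multiIndices d n :=
  fun _ hα => mem_multiIndices.2 ((mem_multiIndices.1 hα).trans h)

lemma eLpNorm_le_bochnerSobolevNorm {m n : ℕ}
    {f : EuclideanSpace ℝ (Fin d₁) × EuclideanSpace ℝ (Fin d₂) → ℝ}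
    {g : (Fin d₁ → ℕ) → (Fin d₂ → ℕ) → EuclideanSpace ℝ (Fin d₁) × EuclideanSpace ℝ (Fin d₂) → ℝ}
    (hg : ∀ α ∈ multiIndices d₁ m, ∀ β ∈ multiIndices d₂ n,
      IsWeakDeriv (stdDir d₁) (stdDir d₂) Set.univ Set.univ α β f (g α β) ∧
        MemLp (g α β) 2 (volume.restrict (Set.univ ×ˢ Set.univ)))
    {α : Fin d₁ → ℕ} {β : Fin d₂ → ℕ} (hα : α ∈ multiIndices d₁ m) (hβ : β ∈ multiIndices d₂ n) :
    eLpNorm (g α β) 2 volume ≤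
      bochnerSobolevNorm (stdDir d₁) (stdDir d₂) m n 2 2 Set.univ Set.univ f := by
  rw [bochnerSobolevNorm_two isOpen_univ isOpen_univ hg, Set.univ_prod_univ, Measure.restrict_univ]
  calc eLpNorm (g α β) 2 volume = (eLpNorm (g α β) 2 volume ^ (2 : ℝ)) ^ (1 / 2 : ℝ) := by
        rw [← ENNReal.rpow_mul]
        norm_num
    _ ≤ _ := by
        refine ENNReal.rpow_le_rpow ?_ (by norm_num)
        refine le_trans ?_ (Finset.single_le_sum
          (f := fun α => ∑ β ∈ multiIndices d₂ n, eLpNorm (g α β) 2 volume ^ (2 : ℝ))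
          (fun _ _ => zero_le) hα)
        exact Finset.single_le_sum (f := fun β => eLpNorm (g α β) 2 volume ^ (2 : ℝ))
          (fun _ _ => zero_le) hβ

lemma bochnerSobolevNorm_ne_top {m n : ℕ}
    {f : EuclideanSpace ℝ (Fin d₁) × EuclideanSpace ℝ (Fin d₂) → ℝ}
    (hf : MemBochnerSobolev (stdDir d₁) (stdDir d₂) m n 2 2 (fun _ => 1) Set.univ Set.univ f) :
    bochnerSobolevNorm (stdDir d₁) (stdDir d₂) m n 2 2 Set.univ Set.univ f ≠ ⊤ := by
  obtain ⟨g, hg⟩ := hf.exists_memLp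
  rw [bochnerSobolevNorm_two isOpen_univ isOpen_univ hg]
  refine ENNReal.rpow_ne_top_of_nonneg (by norm_num) (ENNReal.sum_ne_top.2 fun α hα =>
    ENNReal.sum_ne_top.2 fun β hβ => ENNReal.rpow_ne_top_of_nonneg (by norm_num) (hg α hα β hβ).2.2.ne)

/-- Jets of Sobolev functions lie in the closed convex hull of the neurons. -/
lemma exists_sobolev_jet_mem_closure (hd₁ : 0 < d₁) (hd₂ : 0 < d₂)
    (hsm : ∀ i j, Measurable (s i j)) (hsB : ∀ i j t, |s i j t| ≤ B)
    (hs : ∀ i ≤ n₁, ∀ j ≤ n₂,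
      IsWeakDeriv realDir realDir Set.univ Set.univ (fun _ => i) (fun _ => j) (s 0 0) (s i j))
    (hs0 : Integrable (s 0 0)) (hsne : ¬ s 0 0 =ᵐ[volume] 0) (r₁ r₂ : ℝ) :
    ∃ C : ℝ≥0∞, C ≠ ⊤ ∧ ∀ (U : Set (EuclideanSpace ℝ (Fin d₁)))
      (V : Set (EuclideanSpace ℝ (Fin d₂))), IsOpen U → IsOpen V →
      U ⊆ Metric.closedBall 0 r₁ → V ⊆ Metric.closedBall 0 r₂ →
      IsFiniteMeasure (jetMeasure n₁ n₂ U V) →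
      ∀ (f : EuclideanSpace ℝ (Fin d₁) × EuclideanSpace ℝ (Fin d₂) → ℝ)
      (g : (Fin d₁ → ℕ) → (Fin d₂ → ℕ) →
        EuclideanSpace ℝ (Fin d₁) × EuclideanSpace ℝ (Fin d₂) → ℝ),
      (∀ α ∈ multiIndices d₁ (n₁ + d₁ / 2 + 2), ∀ β ∈ multiIndices d₂ (n₂ + d₂ / 2 + 2),
        IsWeakDeriv (stdDir d₁) (stdDir d₂) Set.univ Set.univ α β f (g α β) ∧
          MemLp (g α β) 2 (volume.restrict (Set.univ ×ˢ Set.univ))) →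
      ∀ A : ℝ, 0 < A → C * bochnerSobolevNorm (stdDir d₁) (stdDir d₂)
        (n₁ + d₁ / 2 + 2) (n₂ + d₂ / 2 + 2) 2 2 Set.univ Set.univ f ≤ ENNReal.ofReal A →
      ∀ J : Lp ℝ 2 (jetMeasure n₁ n₂ U V),
      J =ᵐ[jetMeasure n₁ n₂ U V] (fun p => g p.1.1.1 p.1.1.2 p.2) →
      J ∈ closure (convexHull ℝ (atoms (jetMeasure n₁ n₂ U V) (neuronJet n₁ n₂ s)
        (fun θ => weight n₁ n₂ θ.1) (regularParams d₁ d₂) A)) := by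
  -- In the maximum norm U × V lies in the closed ball of radius r, hence inside the open ball of
  -- radius r+1 on which the cut-off is one. The maximum with 0 covers negative radii.
  set r : ℝ := max 0 (max r₁ r₂) with hr
  have hr0 : 0 ≤ r := le_max_left _ _
  let χ : ContDiffBump (0 : EuclideanSpace ℝ (Fin d₁) × EuclideanSpace ℝ (Fin d₂)) :=
    { rIn := r + 1, rOut := r + 2, rIn_pos := by linarith, rIn_lt_rOut := by linarith }
  have hχ : ContDiff ℝ ∞ χ := χ.contDiff
  have hχc : HasCompactSupport χ := χ.hasCompactSupport
  obtain ⟨C₁, hC₁, hcut⟩ := exists_eLpNorm_mixedDeriv_mul_le (stdDir d₁) (stdDir d₂)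
    (n₁ + d₁ / 2 + 2) (n₂ + d₂ / 2 + 2) hχ hχc
  obtain ⟨C₂, hC₂, hjet⟩ := exists_jet_mem_closure hd₁ hd₂ hsm hsB hs hs0 hsne (r + 2)
  refine ⟨C₂ * C₁, ENNReal.mul_ne_top hC₂ hC₁,
    fun U V hU hV hUr hVr hfm f g hg A hA hCA J hJ => ?_⟩
  set R := bochnerSobolevNorm (stdDir d₁) (stdDir d₂)
    (n₁ + d₁ / 2 + 2) (n₂ + d₂ / 2 + 2) 2 2 Set.univ Set.univ f with hRdef
  have hR : R ≠ ⊤ := bochnerSobolevNorm_ne_top (memBochnerSobolev_two_of_memLp hg)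
  have hgm : ∀ α ∈ multiIndices d₁ (n₁ + d₁ / 2 + 2), ∀ β ∈ multiIndices d₂ (n₂ + d₂ / 2 + 2),
      MemLp (g α β) 2 volume := fun α hα β hβ => by
    have := (hg α hα β hβ).2
    rwa [Set.univ_prod_univ, Measure.restrict_univ] at this
  have hfl : LocallyIntegrable f volume := by
    have := (hg 0 (zero_mem_multiIndices _ _) 0 (zero_mem_multiIndices _ _)).1.1
    rwa [Set.univ_prod_univ, locallyIntegrableOn_univ] at this
  set G : ℕ → EuclideanSpace ℝ (Fin d₁) × EuclideanSpace ℝ (Fin d₂) → ℝ :=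
    fun n => mollify volume (mollifier volume n) f with hG
  have hGs : ∀ n, ContDiff ℝ ∞ (G n) := fun n =>
    contDiff_mollify (contDiff_mollifier n) (hasCompactSupport_mollifier n) hfl
  have hGd : ∀ n, ∀ α ∈ multiIndices d₁ (n₁ + d₁ / 2 + 2),
      ∀ β ∈ multiIndices d₂ (n₂ + d₂ / 2 + 2),
      mixedDeriv (stdDir d₁) (stdDir d₂) α β (G n) =
        mollify volume (mollifier volume n) (g α β) := by
    intro n α hα β hβ
    rw [mixedDeriv_eq_listDeriv]
    refine listDeriv_mollify_of_weak _ (contDiff_mollifier n) (hasCompactSupport_mollifier n) hfl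
      fun φ h1 h2 => ?_
    have := (hg α hα β hβ).1.2.2 φ h1 h2 (by rw [Set.univ_prod_univ]; exact Set.subset_univ _)
    rwa [Set.univ_prod_univ, Measure.restrict_univ, mixedDeriv_eq_listDeriv,
      ← length_mixedList (stdDir d₁) (stdDir d₂) α β] at this
  -- Mollification does not increase L² norms, so the bound is uniform in n and one value of A
  -- serves the whole sequence.
  have hFbound : ∀ n, ∀ α ∈ multiIndices d₁ (n₁ + d₁ / 2 + 2),
      ∀ β ∈ multiIndices d₂ (n₂ + d₂ / 2 + 2),
      eLpNorm (mixedDeriv (stdDir d₁) (stdDir d₂) α β (fun z => χ z * G n z)) 2 volume ≤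
        C₁ * R := by
    intro n
    refine hcut (G n) R (hGs n) fun α hα β hβ => ?_
    rw [hGd n α hα β hβ]
    exact (eLpNorm_mollify_mollifier_le (hgm α hα β hβ).1 n).trans
      (eLpNorm_le_bochnerSobolevNorm hg hα hβ)
  have hI : ∀ i : JetIndex d₁ d₂ n₁ n₂, i.1.1 ∈ multiIndices d₁ (n₁ + d₁ / 2 + 2) ∧
      i.1.2 ∈ multiIndices d₂ (n₂ + d₂ / 2 + 2) := fun i =>
    ⟨multiIndices_mono (by omega) (Finset.mem_product.1 i.2).1,
      multiIndices_mono (by omega) (Finset.mem_product.1 i.2).2⟩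
  have hmoll : ∀ n, ∀ i : JetIndex d₁ d₂ n₁ n₂,
      MemLp (mollify volume (mollifier volume n) (g i.1.1 i.1.2)) 2 volume := fun n i => by
    refine ⟨?_, (eLpNorm_mollify_mollifier_le (hgm _ (hI i).1 _ (hI i).2).1 n).trans_lt
      (hgm _ (hI i).1 _ (hI i).2).2⟩
    rw [← hGd n _ (hI i).1 _ (hI i).2, mixedDeriv_eq_listDeriv]
    exact (contDiff_listDeriv (hGs n) _).continuous.aestronglyMeasurable
  have hjm : ∀ n, MemLp (fun p : JetIndex d₁ d₂ n₁ n₂ × _ =>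
      mollify volume (mollifier volume n) (g p.1.1.1 p.1.1.2) p.2) 2 (jetMeasure n₁ n₂ U V) :=
    fun n => memLp_count_prod fun i => (hmoll n i).restrict _
  have hloc : ∀ n, ∀ i : JetIndex d₁ d₂ n₁ n₂, ∀ᵐ z ∂(volume.restrict (U ×ˢ V)),
      mollify volume (mollifier volume n) (g i.1.1 i.1.2) z =
        mixedDeriv (stdDir d₁) (stdDir d₂) i.1.1 i.1.2 (fun z => χ z * G n z) z := by
    intro n i
    filter_upwards [ae_restrict_mem (hU.prod hV).measurableSet] with z hz
    rw [← hGd n _ (hI i).1 _ (hI i).2, mixedDeriv_eq_listDeriv, mixedDeriv_eq_listDeriv]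
    refine (listDeriv_eventuallyEq _ ?_).eq_of_nhds
    have hzb : z ∈ Metric.ball 0 χ.rIn := by
      have h1 := hUr hz.1
      have h2 := hVr hz.2
      rw [mem_closedBall_zero_iff] at h1 h2
      rw [mem_ball_zero_iff]
      have h3 : r₁ ≤ r := (le_max_left _ _).trans (le_max_right _ _)
      have h4 : r₂ ≤ r := (le_max_right _ _).trans (le_max_right _ _)
      exact lt_of_le_of_lt (max_le (h1.trans h3) (h2.trans h4)) (lt_add_one r)
    filter_upwards [χ.eventuallyEq_one_of_mem_ball hzb] with w hw
    rw [hw, Pi.one_apply, one_mul]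
  have hmem : ∀ n, (hjm n).toLp _ ∈ closure (convexHull ℝ (atoms (jetMeasure n₁ n₂ U V)
      (neuronJet n₁ n₂ s) (fun θ => weight n₁ n₂ θ.1) (regularParams d₁ d₂) A)) := by
    intro n
    refine hjet U V hfm (fun z => χ z * G n z) (C₁ * R) (hχ.mul (hGs n)) hχc.mul_right
      (fun z hz => ?_) (ENNReal.mul_ne_top hC₁ hR) (hFbound n) A hA
      (by rw [← mul_assoc]; exact hCA) _ ?_
    · have h1 : z ∈ Function.support χ := left_ne_zero_of_mul hz
      rw [χ.support_eq, mem_ball_zero_iff] at h1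
      exact h1.le
    · exact (hjm n).coeFn_toLp.trans (ae_count_prod (hloc n))
  -- The mollified jets lie in a closed set, and each of the finitely many components converges in
  -- L².
  refine isClosed_closure.mem_of_tendsto (f := fun n => (hjm n).toLp _) (b := Filter.atTop) ?_
    (Filter.Eventually.of_forall hmem)
  have hJm : MemLp (fun p : JetIndex d₁ d₂ n₁ n₂ × _ => g p.1.1.1 p.1.1.2 p.2) 2
      (jetMeasure n₁ n₂ U V) :=
    memLp_count_prod fun i => (hgm _ (hI i).1 _ (hI i).2).restrict _
  have hJeq : J = hJm.toLp _ := Lp.ext (hJ.trans hJm.coeFn_toLp.symm)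
  rw [hJeq, Lp.tendsto_Lp_iff_tendsto_eLpNorm'']
  have hn : ∀ n, eLpNorm ((fun p : JetIndex d₁ d₂ n₁ n₂ × _ =>
      mollify volume (mollifier volume n) (g p.1.1.1 p.1.1.2) p.2) -
      fun p => g p.1.1.1 p.1.1.2 p.2) 2 (jetMeasure n₁ n₂ U V) =
      (∑ i : JetIndex d₁ d₂ n₁ n₂, eLpNorm (mollify volume (mollifier volume n) (g i.1.1 i.1.2) -
        g i.1.1 i.1.2) 2 (volume.restrict (U ×ˢ V)) ^ (2 : ℝ)) ^ (1 / 2 : ℝ) := fun n =>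
    eLpNorm_count_prod (ν := volume.restrict (U ×ˢ V))
      (g := fun i : JetIndex d₁ d₂ n₁ n₂ =>
        mollify volume (mollifier volume n) (g i.1.1 i.1.2) - g i.1.1 i.1.2)
      fun i => (((hmoll n i).sub (hgm _ (hI i).1 _ (hI i).2)).restrict _).1
  simp only [hn]
  have hz : (0 : ℝ≥0∞) = (∑ i : JetIndex d₁ d₂ n₁ n₂, (0 : ℝ≥0∞) ^ (2 : ℝ)) ^ (1 / 2 : ℝ) := by
    simp
  rw [hz]
  refine (tendsto_finsetSum _ fun i _ => ?_).ennrpow_const _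
  refine Filter.Tendsto.ennrpow_const _ ?_
  refine tendsto_of_tendsto_of_tendsto_of_le_of_le tendsto_const_nhds
    (tendsto_eLpNorm_mollify_sub (hgm _ (hI i).1 _ (hI i).2)) (fun _ => zero_le) fun n => ?_
  exact eLpNorm_mono_measure _ Measure.restrict_le_self

end Approximation

/-! ### From approximated jets to networks. -/

section Networks

variable {d₁ d₂ n₁ n₂ : ℕ} {s : ℕ → ℕ → ℝ × ℝ → ℝ} {B : ℝ}
  {U : Set (EuclideanSpace ℝ (Fin d₁))} {V : Set (EuclideanSpace ℝ (Fin d₂))}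

lemma jetMeasure_univ : jetMeasure n₁ n₂ U V Set.univ =
    (Fintype.card (JetIndex d₁ d₂ n₁ n₂) : ℝ≥0∞) * (volume U * volume V) := by
  rw [jetMeasure, ← Set.univ_prod_univ, Measure.prod_prod, Measure.count_univ,
    Measure.restrict_apply_univ, Measure.volume_eq_prod, Measure.prod_prod]
  simp

/-- The norm of a function is the `L²` norm of its jet. -/
lemma bochnerSobolevNorm_eq_eLpNorm_jet (hU : IsOpen U) (hV : IsOpen V)
    {f : EuclideanSpace ℝ (Fin d₁) × EuclideanSpace ℝ (Fin d₂) → ℝ}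
    {g : (Fin d₁ → ℕ) → (Fin d₂ → ℕ) →
      EuclideanSpace ℝ (Fin d₁) × EuclideanSpace ℝ (Fin d₂) → ℝ}
    (hg : ∀ α ∈ multiIndices d₁ n₁, ∀ β ∈ multiIndices d₂ n₂,
      IsWeakDeriv (stdDir d₁) (stdDir d₂) U V α β f (g α β) ∧
        MemLp (g α β) 2 (volume.restrict (U ×ˢ V))) :
    bochnerSobolevNorm (stdDir d₁) (stdDir d₂) n₁ n₂ 2 2 U V f =
      eLpNorm (fun p : JetIndex d₁ d₂ n₁ n₂ × _ => g p.1.1.1 p.1.1.2 p.2) 2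
        (jetMeasure n₁ n₂ U V) := by
  rw [bochnerSobolevNorm_two hU hV hg, jetMeasure, eLpNorm_count_prod
    (g := fun i : JetIndex d₁ d₂ n₁ n₂ => g i.1.1 i.1.2) fun i =>
    (hg _ (Finset.mem_product.1 i.2).1 _ (Finset.mem_product.1 i.2).2).2.1]
  rw [← Finset.sum_product (multiIndices d₁ n₁) (multiIndices d₂ n₂)
    fun q => eLpNorm (g q.1 q.2) 2 (volume.restrict (U ×ˢ V)) ^ (2 : ℝ)]
  congr 1
  exact (Finset.sum_coe_sort (multiIndices d₁ n₁ ×ˢ multiIndices d₂ n₂)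
    fun q => eLpNorm (g q.1 q.2) 2 (volume.restrict (U ×ˢ V)) ^ (2 : ℝ)).symm

/-- Approximation by networks of a function whose jet lies in the closed convex hull of the
neurons. -/
lemma exists_network_approx {σ : ℝ × ℝ → ℝ}
    (hsB : ∀ i j t, |s i j t| ≤ B)
    (hs : ∀ i ≤ n₁, ∀ j ≤ n₂,
      IsWeakDeriv realDir realDir Set.univ Set.univ (fun _ => i) (fun _ => j) σ (s i j))
    (hσB : ∀ᵐ t, |σ t| ≤ B) (hU : IsOpen U) (hV : IsOpen V)
    (hfm : IsFiniteMeasure (jetMeasure n₁ n₂ U V)) (hUV : volume (U ×ˢ V) ≠ ⊤)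
    {f : EuclideanSpace ℝ (Fin d₁) × EuclideanSpace ℝ (Fin d₂) → ℝ}
    {g : (Fin d₁ → ℕ) → (Fin d₂ → ℕ) →
      EuclideanSpace ℝ (Fin d₁) × EuclideanSpace ℝ (Fin d₂) → ℝ}
    (hg : ∀ α ∈ multiIndices d₁ n₁, ∀ β ∈ multiIndices d₂ n₂,
      IsWeakDeriv (stdDir d₁) (stdDir d₂) U V α β f (g α β) ∧
        MemLp (g α β) 2 (volume.restrict (U ×ˢ V)))
    {J : Lp ℝ 2 (jetMeasure n₁ n₂ U V)}
    (hJg : J =ᵐ[jetMeasure n₁ n₂ U V] (fun p => g p.1.1.1 p.1.1.2 p.2)) {A : ℝ} (hA : 0 ≤ A)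
    (hJ : J ∈ closure (convexHull ℝ (atoms (jetMeasure n₁ n₂ U V) (neuronJet n₁ n₂ s)
        (fun θ => weight n₁ n₂ θ.1) (regularParams d₁ d₂) A)))
    {M : ℝ} (hAM : A ≤ M) {N : ℕ} (hN : 1 ≤ N) {ε : ℝ} (hε : 0 < ε) :
    ∃ h ∈ sparseSpan N M (dictionary σ n₁ n₂ U V),
      bochnerSobolevNorm (stdDir d₁) (stdDir d₂) n₁ n₂ 2 2 U V (fun z => f z - h z) ≤
        ENNReal.ofReal (A * B * (jetMeasure n₁ n₂ U V).real Set.univ ^ (1 / 2 : ℝ) *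
          (N : ℝ) ^ (-(1 / 2) : ℝ) + ε) := by
  have hB : 0 ≤ B := (abs_nonneg _).trans (hsB 0 0 0)
  obtain ⟨c, θ, hθ, hcA, hle⟩ := exists_sum_kernel_approx
    (fun θ : (EuclideanSpace ℝ (Fin d₁) × EuclideanSpace ℝ (Fin d₂)) × (ℝ × ℝ) =>
      one_le_weight n₁ n₂ θ.1) hA hB (abs_neuronJet_le hsB) hJ hN hε
  have hfin : IsFiniteMeasure ((volume : Measure (EuclideanSpace ℝ (Fin d₁) ×
      EuclideanSpace ℝ (Fin d₂))).restrict (U ×ˢ V)) := ⟨by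
    rw [Measure.restrict_apply_univ]
    exact hUV.lt_top⟩
  -- The dictionary uses σ, whereas the atoms use the bounded representatives s. The neuron of σ has
  -- the components of the atom as its weak derivatives.
  have hneu : ∀ j, ∀ α ∈ multiIndices d₁ n₁, ∀ β ∈ multiIndices d₂ n₂,
      IsWeakDeriv (stdDir d₁) (stdDir d₂) U V α β (neuron σ (θ j).1 (θ j).2)
        (fun z => monomial (θ j).1 α β * s (∑ i, α i) (∑ i, β i) (pairing (θ j).1 z + (θ j).2)) ∧
      MemLp (fun z => monomial (θ j).1 α β *
        s (∑ i, α i) (∑ i, β i) (pairing (θ j).1 z + (θ j).2)) 2 (volume.restrict (U ×ˢ V)) := by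
    intro j α hα β hβ
    have hw : IsWeakDeriv (stdDir d₁) (stdDir d₂) U V α β (neuron σ (θ j).1 (θ j).2)
        (fun z => monomial (θ j).1 α β *
          s (∑ i, α i) (∑ i, β i) (pairing (θ j).1 z + (θ j).2)) :=
      isWeakDeriv_neuron (hs _ (mem_multiIndices.1 hα) _ (mem_multiIndices.1 hβ)) hσB
        (Filter.Eventually.of_forall (hsB _ _)) (hθ j).1 (hθ j).2 (θ j).2 U V
    refine ⟨hw, MemLp.of_bound hw.aestronglyMeasurable (|monomial (θ j).1 α β| * B)
      (Filter.Eventually.of_forall fun z => ?_)⟩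
    rw [norm_mul, Real.norm_eq_abs, Real.norm_eq_abs]
    exact mul_le_mul_of_nonneg_left (hsB _ _ _) (abs_nonneg _)
  refine ⟨fun z => ∑ j, c j * neuron σ (θ j).1 (θ j).2 z,
    ⟨c, fun j => neuron σ (θ j).1 (θ j).2, fun j =>
      ⟨memBochnerSobolev_two_of_memLp (hneu j), _, _, rfl⟩, hcA.trans hAM, rfl⟩, ?_⟩
  rw [bochnerSobolevNorm_eq_eLpNorm_jet hU hV (g := fun α β z => g α β z - ∑ j, c j *
    (monomial (θ j).1 α β * s (∑ i, α i) (∑ i, β i) (pairing (θ j).1 z + (θ j).2)))]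
  · refine le_of_eq_of_le (eLpNorm_congr_ae ?_) hle
    filter_upwards [hJg] with p hp
    rw [hp]
    rfl
  · intro α hα β hβ
    exact ⟨(hg α hα β hβ).1.sub (IsWeakDeriv.sum Finset.univ c hU hV fun j _ => (hneu j α hα β hβ).1),
      (hg α hα β hβ).2.sub (memLp_finsetSum _ fun j _ => (hneu j α hα β hβ).2.const_mul (c j))⟩

end Networks

end TwoBlock

end

/-! ### Assembly of the approximation rate. -/

theorem mainTheorem5 (d₁ d₂ n₁ n₂ k₁ k₂ : ℕ) (hd₁ : 0 < d₁) (hd₂ : 0 < d₂)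
    (hk₁ : n₁ ≤ k₁) (hk₂ : n₂ ≤ k₂)
    (γ₁ γ₂ : ℝ) (hγ₁ : 1 < γ₁) (hγ₂ : 1 < γ₂)
    (ϑ : ℝ × ℝ → ℝ) (hϑ_meas : Measurable ϑ) (hϑ_pos : ∀ t, 0 < ϑ t)
    (hϑ_ell : ∃ c : ℝ, 0 < c ∧
      ∀ t : ℝ × ℝ, TwoBlock.bracket t.1 ^ γ₁ * TwoBlock.bracket t.2 ^ γ₂ ≤ c * ϑ t)
    (σ : ℝ × ℝ → ℝ)
    (hσ : TwoBlock.MemBochnerSobolev TwoBlock.realDir TwoBlock.realDir k₁ k₂ ⊤ ⊤ ϑ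
      Set.univ Set.univ σ)
    (hσ_ne : ¬ σ =ᵐ[volume] 0)
    (r₁ r₂ : ℝ) :
    ∃ C : ℝ, 0 < C ∧
      ∀ (U : Set (EuclideanSpace ℝ (Fin d₁))) (V : Set (EuclideanSpace ℝ (Fin d₂))),
        IsOpen U → IsOpen V →
        U ⊆ Metric.closedBall 0 r₁ → V ⊆ Metric.closedBall 0 r₂ →
        ∀ f : EuclideanSpace ℝ (Fin d₁) × EuclideanSpace ℝ (Fin d₂) → ℝ,
          TwoBlock.MemBochnerSobolev (TwoBlock.stdDir d₁) (TwoBlock.stdDir d₂)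
            (n₁ + d₁ / 2 + 2) (n₂ + d₂ / 2 + 2) 2 2 (fun _ => 1) Set.univ Set.univ f →
          ∃ M₀ : ℝ, 0 < M₀ ∧ ∀ M : ℝ, M₀ ≤ M → ∀ N : ℕ, 1 ≤ N →
            (⨅ g ∈ TwoBlock.sparseSpan N M (TwoBlock.dictionary σ n₁ n₂ U V),
              TwoBlock.bochnerSobolevNorm (TwoBlock.stdDir d₁) (TwoBlock.stdDir d₂) n₁ n₂ 2 2 U V
                (fun z => f z - g z))
            ≤ ENNReal.ofReal (C * (N : ℝ) ^ (-(1 / 2) : ℝ)) *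
                volume U ^ (1 / 2 : ℝ) * volume V ^ (1 / 2 : ℝ) *
                TwoBlock.bochnerSobolevNorm (TwoBlock.stdDir d₁) (TwoBlock.stdDir d₂)
                  (n₁ + d₁ / 2 + 2) (n₂ + d₂ / 2 + 2) 2 2 Set.univ Set.univ f := by
  open TwoBlock in
  obtain ⟨s, B, hB, hsm, hsB, hs, hσs, hσi⟩ := exists_bounded_derivs hγ₁ hγ₂ hϑ_meas hϑ_ell hσ
  have hsσ : ∀ i ≤ n₁, ∀ j ≤ n₂,
      IsWeakDeriv realDir realDir Set.univ Set.univ (fun _ => i) (fun _ => j) σ (s i j) :=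
    fun i hi j hj => hs i (hi.trans hk₁) j (hj.trans hk₂)
  have hσB : ∀ᵐ t, |σ t| ≤ B := by
    filter_upwards [hσs] with t ht
    rw [ht]
    exact hsB 0 0 t
  obtain ⟨C₀, hC₀, hjet⟩ := exists_sobolev_jet_mem_closure hd₁ hd₂ hsm hsB
    (fun i hi j hj => (hsσ i hi j hj).congr hσs Filter.EventuallyEq.rfl) (hσi.congr hσs)
    (fun h => hσ_ne (hσs.trans h)) r₁ r₂
  set q : ℝ := (Fintype.card (JetIndex d₁ d₂ n₁ n₂) : ℝ) ^ (1 / 2 : ℝ) with hq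
  -- The factor q is the square root of the number of derivatives in a jet; adding 1 only ensures
  -- positivity.
  refine ⟨C₀.toReal * B * q + 1, by positivity, fun U V hU hV hUr hVr f hf => ?_⟩
  obtain ⟨g, hg⟩ := hf.exists_memLp
  set R := bochnerSobolevNorm (stdDir d₁) (stdDir d₂)
    (n₁ + d₁ / 2 + 2) (n₂ + d₂ / 2 + 2) 2 2 Set.univ Set.univ f with hRdef
  have hR : R ≠ ⊤ := bochnerSobolevNorm_ne_top hf
  have hUt : volume U ≠ ⊤ := ((measure_mono hUr).trans_lt measure_closedBall_lt_top).ne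
  have hVt : volume V ≠ ⊤ := ((measure_mono hVr).trans_lt measure_closedBall_lt_top).ne
  have hUVt : volume (U ×ˢ V) ≠ ⊤ := by
    rw [Measure.volume_eq_prod, Measure.prod_prod]
    exact ENNReal.mul_ne_top hUt hVt
  have hfm : IsFiniteMeasure (jetMeasure n₁ n₂ U V) := ⟨by
    rw [jetMeasure_univ]
    exact ENNReal.mul_lt_top (ENNReal.natCast_lt_top _)
      (ENNReal.mul_lt_top hUt.lt_top hVt.lt_top)⟩
  have hgUV : ∀ α ∈ multiIndices d₁ n₁, ∀ β ∈ multiIndices d₂ n₂,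
      IsWeakDeriv (stdDir d₁) (stdDir d₂) U V α β f (g α β) ∧
        MemLp (g α β) 2 (volume.restrict (U ×ˢ V)) := by
    intro α hα β hβ
    have := hg α (multiIndices_mono (by omega) hα) β (multiIndices_mono (by omega) hβ)
    exact ⟨this.1.mono (Set.subset_univ _) (Set.subset_univ _),
      this.2.mono_measure (Measure.restrict_mono
        (Set.prod_mono (Set.subset_univ _) (Set.subset_univ _)) le_rfl)⟩
  have hJm : MemLp (fun p : JetIndex d₁ d₂ n₁ n₂ × _ => g p.1.1.1 p.1.1.2 p.2) 2
      (jetMeasure n₁ n₂ U V) :=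
    memLp_count_prod fun i : JetIndex d₁ d₂ n₁ n₂ =>
      (hgUV _ (Finset.mem_product.1 i.2).1 _ (Finset.mem_product.1 i.2).2).2
  set a : ℝ := C₀.toReal * R.toReal with ha
  have ha0 : 0 ≤ a := by positivity
  -- The hull has size A = a + δ with 0 < δ < 1: positive even when f vanishes, and below the
  -- threshold a + 1, which does not involve N.
  refine ⟨a + 1, by positivity, fun M hM N hN => ?_⟩
  have hN0 : (0 : ℝ) < N := by exact_mod_cast hN
  set κ : ℝ := (jetMeasure n₁ n₂ U V).real Set.univ ^ (1 / 2 : ℝ) with hκ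
  have hstep : ∀ δ ∈ Set.Ioo (0 : ℝ) 1,
      (⨅ g ∈ sparseSpan N M (dictionary σ n₁ n₂ U V),
        bochnerSobolevNorm (stdDir d₁) (stdDir d₂) n₁ n₂ 2 2 U V (fun z => f z - g z)) ≤
      ENNReal.ofReal ((a + δ) * B * κ * (N : ℝ) ^ (-(1 / 2) : ℝ) + δ) := by
    intro δ hδ
    have hCA : C₀ * R ≤ ENNReal.ofReal (a + δ) := by
      rw [← ENNReal.ofReal_toReal (ENNReal.mul_ne_top hC₀ hR), ENNReal.toReal_mul]
      exact ENNReal.ofReal_le_ofReal (by linarith [hδ.1])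
    have hmem := hjet U V hU hV hUr hVr hfm f g hg (a + δ) (by linarith [hδ.1]) hCA
      (hJm.toLp _) hJm.coeFn_toLp
    obtain ⟨h, hh, hle⟩ := exists_network_approx hsB hsσ hσB hU hV hfm hUVt hgUV
      hJm.coeFn_toLp (by linarith [hδ.1]) hmem (M := M) (by linarith [hδ.2]) hN hδ.1
    exact (iInf₂_le h hh).trans hle
  have hlim : Filter.Tendsto
      (fun δ : ℝ => ENNReal.ofReal ((a + δ) * B * κ * (N : ℝ) ^ (-(1 / 2) : ℝ) + δ))
      (nhdsWithin 0 (Set.Ioi 0))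
      (nhds (ENNReal.ofReal ((a + 0) * B * κ * (N : ℝ) ^ (-(1 / 2) : ℝ) + 0))) := by
    refine ((ENNReal.continuous_ofReal.comp ?_).tendsto 0).mono_left nhdsWithin_le_nhds
    fun_prop
  -- The infimum does not depend on δ, so δ may tend to 0 with N and M fixed.
  refine (ge_of_tendsto hlim
    (Filter.mem_of_superset (Ioo_mem_nhdsGT one_pos) hstep)).trans ?_
  rw [← ENNReal.ofReal_toReal hUt, ← ENNReal.ofReal_toReal hVt, ← ENNReal.ofReal_toReal hR,
    ENNReal.ofReal_rpow_of_nonneg ENNReal.toReal_nonneg (by norm_num),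
    ENNReal.ofReal_rpow_of_nonneg ENNReal.toReal_nonneg (by norm_num),
    ← ENNReal.ofReal_mul (by positivity), ← ENNReal.ofReal_mul (by positivity),
    ← ENNReal.ofReal_mul (by positivity)]
  refine ENNReal.ofReal_le_ofReal ?_
  -- The mass of the jet measure is the number of derivatives times |U||V|; its square root yields
  -- the volume factors.
  have hκ' : κ = q * ((volume U).toReal ^ (1 / 2 : ℝ) * (volume V).toReal ^ (1 / 2 : ℝ)) := by
    rw [hκ, hq, Measure.real, jetMeasure_univ, ENNReal.toReal_mul, ENNReal.toReal_mul,
      ENNReal.toReal_natCast, Real.mul_rpow (by positivity) (by positivity),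
      Real.mul_rpow (by positivity) (by positivity)]
  rw [hκ', ha]
  have hpos : 0 ≤ (N : ℝ) ^ (-(1 / 2) : ℝ) * (volume U).toReal ^ (1 / 2 : ℝ) *
      (volume V).toReal ^ (1 / 2 : ℝ) * R.toReal := by positivity
  nlinarith [hpos]
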